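/- Let $\mathcal H(0)=\mathrm{SL}_2(\mathbb Z)\backslash \mathrm{SL}_2(\mathbb R)$ be the space of area-one tori with one marked point; the class of $g$ corresponds to the unimodular lattice $\Lambda=\mathbb Z^2g\subset\mathbb R^2$. Equip it with the invariant (Masur--Veech) measure induced by the Haar measure of $\mathrm{SL}_2(\mathbb R)$. The absolute Siegel--Veech transform of $f:\mathbb R^2\to\mathbb C$ is $$\mathrm{SV}(f)(\Lambda)=\sum_{v\in\Lambda\ \text{primitive}} f(v).$$ On continuous compactly supported functions $f$ with $\int_{\mathbb R^2}f=0$ it extends to a unique bounded linear operator $\mathrm{SV}:L^2(\mathbb R^2)\to L^2(\mathcal H(0))$. The kernel of this operator strictly contains the space of odd functions $\{f\in L^2(\mathbb R^2): f(-x)=-f(x)\ \text{a.e.}\}$. More precisely, let $\xi(w)=\pi^{-w/2}\Gamma(w/2)\zeta(w)$ be the completed Riemann zeta function. For every smooth function $\eta:(0,\infty)\to\mathbb C$ of compact support, the radial function $$f_\eta(x)=\int_0^\infty \eta(t)\left(\xi(1-it)\,r^{-1+it}-\xi(1+it)\,r^{-1-it}\right)dt,\qquad r=\|x\|,$$ belongs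 to $L^2(\mathbb R^2)$ and to the kernel of $\mathrm{SV}$, and it is not odd unless $\eta=0$. -/

import Mathlib

open MeasureTheory
open scoped MatrixGroups UpperHalfPlane ContDiff

namespace SiegelVeech

/-- The Euclidean plane `ℝ²`. -/
abbrev Plane : Type := EuclideanSpace ℝ (Fin 2)

/-- `SL₂(ℤ)` as a subgroup of `SL₂(ℝ)`. -/
def integralSubgroup : Subgroup SL(2, ℝ) :=
  (Matrix.SpecialLinearGroup.map (n := Fin 2) (Int.castRingHom ℝ)).range

/-- The stratum `H(0)` of area-one tori with one marked point, as the space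
`SL₂(ℤ) \ SL₂(ℝ)`; the class of `g` corresponds to the unimodular lattice `ℤ² g`
spanned by the rows of `g`. -/
def H0 : Type := Quotient (QuotientGroup.rightRel integralSubgroup)

/-- The point of `H(0)` given by `g`. -/
def H0.mk (g : SL(2, ℝ)) : H0 := Quotient.mk (QuotientGroup.rightRel integralSubgroup) g

/-- The quotient topology of `SL₂(ℝ)`. -/
instance : TopologicalSpace H0 :=
  inferInstanceAs (TopologicalSpace (Quotient (QuotientGroup.rightRel integralSubgroup)))

instance : MeasurableSpace H0 := borel H0

instance : BorelSpace H0 := ⟨rfl⟩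

/-- The row vector `(m, n) g`. -/
noncomputable def rowVec (g : SL(2, ℝ)) (m n : ℤ) : Plane :=
  !₂[(m : ℝ) * g.1 0 0 + (n : ℝ) * g.1 1 0, (m : ℝ) * g.1 0 1 + (n : ℝ) * g.1 1 1]

/-- The primitive vectors of the lattice `ℤ² g`. -/
def primitiveRows (g : SL(2, ℝ)) : Set Plane :=
  {v | ∃ m n : ℤ, IsCoprime m n ∧ v = rowVec g m n}

theorem primitiveRows_mul_subset (γ : SL(2, ℤ)) (g : SL(2, ℝ)) :
    primitiveRows (Matrix.SpecialLinearGroup.map (Int.castRingHom ℝ) γ * g) ⊆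
      primitiveRows g := by
  rintro v ⟨m, n, hmn, rfl⟩
  obtain ⟨a, b, hab⟩ := hmn
  have hdet : γ.1 0 0 * γ.1 1 1 - γ.1 0 1 * γ.1 1 0 = 1 := by
    rw [← Matrix.det_fin_two]; exact γ.2
  refine ⟨m * γ.1 0 0 + n * γ.1 1 0, m * γ.1 0 1 + n * γ.1 1 1,
    ⟨a * γ.1 1 1 - b * γ.1 0 1, b * γ.1 0 0 - a * γ.1 1 0, ?_⟩, ?_⟩
  · linear_combination hab + (a * m + b * n) * hdet
  · ext i
    fin_cases i <;>
    · simp [rowVec, Matrix.mul_apply, Fin.sum_univ_two]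
      ring

/-- The set of holonomy vectors of saddle connections of the flat torus `x`: the primitive vectors
of its period lattice. -/
def primitiveVectors : H0 → Set Plane :=
  Quotient.lift primitiveRows (by
    intro g g' h
    obtain ⟨γ, hγ⟩ := QuotientGroup.rightRel_apply.mp h
    have h1 : g' = Matrix.SpecialLinearGroup.map (Int.castRingHom ℝ) γ * g := by
      simp [hγ]
    have h2 : g = Matrix.SpecialLinearGroup.map (Int.castRingHom ℝ) γ⁻¹ * g' := by
      rw [h1, map_inv, inv_mul_cancel_left]
    apply Set.Subset.antisymm
    · conv_lhs => rw [h2]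
      exact primitiveRows_mul_subset γ⁻¹ g'
    · rw [h1]
      exact primitiveRows_mul_subset γ g)

/-- The absolute Siegel--Veech transform of a function on the plane. -/
noncomputable def transform (f : Plane → ℂ) (x : H0) : ℂ :=
  ∑' v : primitiveVectors x, f v

/-- The unipotent matrix `n(x)`. -/
def unipotent (x : ℝ) : SL(2, ℝ) :=
  ⟨!![1, x; 0, 1], by simp [Matrix.det_fin_two_of]⟩

/-- The diagonal matrix `a(√y)`, for `y` the imaginary part of `τ`. -/
noncomputable def diagonal (τ : ℍ) : SL(2, ℝ) :=
  ⟨!![√τ.im, 0; 0, (√τ.im)⁻¹], by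
    simp [Matrix.det_fin_two_of, (Real.sqrt_pos.mpr τ.im_pos).ne']⟩

/-- The rotation matrix `k(θ)`. -/
noncomputable def rotation (θ : ℝ) : SL(2, ℝ) :=
  ⟨!![Real.cos θ, Real.sin θ; -Real.sin θ, Real.cos θ], by
    rw [Matrix.det_fin_two_of]; linear_combination Real.sin_sq_add_cos_sq θ⟩

/-- The matrix `n(x) a(√y) k(θ)` of the Iwasawa decomposition, where `τ = x + i y`. -/
noncomputable def iwasawa (τ : ℍ) (θ : ℝ) : SL(2, ℝ) :=
  unipotent τ.re * diagonal τ * rotation θ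

/-- The invariant (Masur--Veech) measure on `H(0)`, up to normalization. It is induced by the Haar
measure `dx dy dθ / y²` of `SL₂(ℝ)` in Iwasawa coordinates: the set of all `(τ, θ)` with `τ` in the
standard fundamental domain of `SL₂(ℤ)` on `ℍ` and `θ ∈ (0, π]` is a fundamental domain of
`SL₂(ℤ)` on `SL₂(ℝ)`, as `-1` acts by `θ ↦ θ + π`. -/
noncomputable def muH0 : Measure H0 :=
  Measure.map (fun p : ℍ × ℝ => H0.mk (iwasawa p.1 p.2))
    (((volume : Measure ℍ).restrict ModularGroup.fd).prod
      ((volume : Measure ℝ).restrict (Set.Ioc 0 Real.pi)))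

/-- The map in the definition of `muH0` is continuous (so the push-forward is not a junk value). -/
theorem continuous_mk_iwasawa :
    Continuous (fun p : ℍ × ℝ => H0.mk (iwasawa p.1 p.2)) := by
  have h : Continuous (fun p : ℍ × ℝ => iwasawa p.1 p.2) := by
    have hre : Continuous fun p : ℍ × ℝ => p.1.re :=
      UpperHalfPlane.continuous_re.comp continuous_fst
    have him : Continuous fun p : ℍ × ℝ => √p.1.im :=
      (UpperHalfPlane.continuous_im.comp continuous_fst).sqrt
    have him' : Continuous fun p : ℍ × ℝ => (√p.1.im)⁻¹ :=
      him.inv₀ fun p => (Real.sqrt_pos.mpr p.1.im_pos).ne'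
    have h1 : Continuous fun p : ℍ × ℝ => unipotent p.1.re := by
      refine continuous_induced_rng.mpr (continuous_matrix fun i j => ?_)
      fin_cases i <;> fin_cases j <;> simp [unipotent] <;> fun_prop
    have h2 : Continuous fun p : ℍ × ℝ => diagonal p.1 := by
      refine continuous_induced_rng.mpr (continuous_matrix fun i j => ?_)
      fin_cases i <;> fin_cases j <;> simp [diagonal] <;> fun_prop
    have h3 : Continuous fun p : ℍ × ℝ => rotation p.2 := by
      refine continuous_induced_rng.mpr (continuous_matrix fun i j => ?_)
      fin_cases i <;> fin_cases j <;> simp [rotation] <;> fun_prop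
    exact (h1.mul h2).mul h3
  exact continuous_quotient_mk'.comp h

/-- `L²(ℝ²)`. -/
abbrev L2Plane : Type := Lp ℂ 2 (volume : Measure Plane)

/-- `L²(H(0))`. -/
abbrev L2H0 : Type := Lp ℂ 2 muH0

/-- `S` is a bounded operator `L²(ℝ²) → L²(H(0))` that is given by the Siegel--Veech transform on
the continuous compactly supported functions of mean zero. -/
def IsTransformOperator (S : L2Plane →L[ℂ] L2H0) : Prop :=
  ∀ (f : Plane → ℂ) (hf : Continuous f) (hs : HasCompactSupport f), ∫ x, f x = 0 →
    S ((hf.memLp_of_hasCompactSupport hs (p := 2) (μ := volume)).toLp f) =ᵐ[muH0] transform f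

/-- The odd functions in `L²(ℝ²)`. -/
def oddFunctions : Set L2Plane :=
  {f | ∀ᵐ x : Plane, f (-x) = -f x}

/-- The radial function
`∫₀^∞ η(t) (ξ(1 - i t) r^{-1 + i t} - ξ(1 + i t) r^{-1 - i t}) dt`, `r = ‖x‖`, where
`ξ(w) = π^{-w/2} Γ(w/2) ζ(w)`. -/
noncomputable def radialFunction (η : ℝ → ℂ) (x : Plane) : ℂ :=
  ∫ t in Set.Ioi (0 : ℝ), η t *
    (completedRiemannZeta (1 - t * Complex.I) * ((‖x‖ : ℝ) : ℂ) ^ (-1 + t * Complex.I) -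
      completedRiemannZeta (1 + t * Complex.I) * ((‖x‖ : ℝ) : ℂ) ^ (-1 - t * Complex.I))

end SiegelVeech

namespace SiegelVeech

/-! ### Dirichlet series in commuting unitary operators -/

section DirichletOperators

/-! Everything is read off from the second moment of the transform. Unfolding the double sum over
primitive vectors along the upper unipotent subgroup gives, for an even test function f, the
identity ‖SV f‖² = 4(‖f‖² + ∑_{m ≥ 1} (φ(m)/m) c(m)). Here c(p) is the integral of conj f(u) f(v)
over pairs (u, v) spanning a parallelogram of signed area p (`IsTestFunction.integral_latticeSum`).

The arithmetic sum is a limit of matrix coefficients of isometries. Let D_a f = a f(a ·) be the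
unitary dilations of L²(ℂ) and F the Fourier transform followed by rotation by i. The Fourier
transform of c at a > 0 is a⁻¹⟨f, D_a F f⟩ (`IsTestFunction.fourier_pairCorrelation`). Poisson
summation, ∑_{n ∣ k} μ(n)/n = φ(k)/k and the vanishing of 1/ζ at 1 then show that ∑ (φ(m)/m) c(m) is
the limit of ⟨f, M_ε f⟩ as ε → 0+, where M_ε = A F A⁻¹, A = ∑ m^{-1-ε} D_m and A⁻¹ = ∑ μ(n) n^{-1-ε}
D_n (`QuadraticDecay.tendsto_regularized_totient`). Since D_n F D_n = F, F intertwines A* with A; as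
A is normal, M_ε is isometric (`exists_hasSum_inner_regularized`).

Two consequences follow. By Cauchy–Schwarz ‖SV f‖² ≤ 8‖f‖², so SV extends from a dense subspace,
uniquely. By uniform continuity of the forms ⟨h, M_ε h⟩, an even h lies in the kernel as soon as ⟨h,
M_ε h⟩ → -‖h‖² (`complexTransform_eq_zero`).

On radial functions ∫ ψ(t) r^{-1+it} dt everything is diagonal in the profile ψ. The operator D_a
multiplies ψ by a^{it}, and F sends ψ(t) to ψ(-t) Γ_ℝ(1-it)/Γ_ℝ(1+it). The Dirichlet series
contribute ζ(1+ε-it)/ζ(1+ε+it). In the limit ψ(t) becomes ψ(-t) ξ(1-it)/ξ(1+it), so ψ(t) = g(t)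
ξ(1-it) with g odd is sent to -ψ. The functions f_η are exactly of this form, with g the odd
extension of η. They are even, and they are nonzero for η ≠ 0 by Plancherel and the non-vanishing of
ζ on Re s = 1; hence they are not odd. -/

theorem _root_.HasSum.congr_fun' {α β : Type*} [AddCommMonoid α] [TopologicalSpace α] {f g : β → α}
    {a : α} (hf : HasSum f a) (h : ∀ b, f b = g b) : HasSum g a :=
  funext h ▸ hf

open ArithmeticFunction in
-- Regrouping the absolutely convergent double sum by k = mn reduces this to ζ * μ = 1 for Dirichlet
-- convolution. Index 0 has weight 0 ^ (-(1 + ε)) = 0, which is why multiplicativity is asked only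
-- for nonzero indices.
theorem tsum_moebius_mul_rpow_smul {R : Type*} [NormedRing R] [NormedAlgebra ℝ R] [CompleteSpace R]
    {ε : ℝ} (hε : 0 < ε) (u : ℕ → R) (hu : ∀ n, ‖u n‖ ≤ 1) (hu1 : u 1 = 1)
    (hmul : ∀ m n, m ≠ 0 → n ≠ 0 → u (m * n) = u m * u n) :
    (∑' m : ℕ, (m : ℝ) ^ (-(1 + ε)) • u m) *
      (∑' n : ℕ, ((moebius n : ℝ) * (n : ℝ) ^ (-(1 + ε))) • u n) = 1 := by
  have hs : Summable fun m : ℕ => (m : ℝ) ^ (-(1 + ε)) :=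
    Real.summable_nat_rpow.mpr (by linarith)
  have hz : ((0 : ℕ) : ℝ) ^ (-(1 + ε)) = 0 := by
    rw [Nat.cast_zero, Real.zero_rpow (by linarith)]
  have hnn : ∀ m : ℕ, 0 ≤ (m : ℝ) ^ (-(1 + ε)) := fun m => Real.rpow_nonneg (Nat.cast_nonneg m) _
  have hμ : ∀ n : ℕ, |(moebius n : ℝ)| ≤ 1 := fun n => by exact_mod_cast abs_moebius_le_one
  have hA : Summable fun m : ℕ => ‖(m : ℝ) ^ (-(1 + ε)) • u m‖ := by
    refine Summable.of_nonneg_of_le (fun _ => norm_nonneg _) (fun m => ?_) hs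
    rw [norm_smul, Real.norm_of_nonneg (hnn m)]
    exact mul_le_of_le_one_right (hnn m) (hu m)
  have hB : Summable fun n : ℕ => ‖((moebius n : ℝ) * (n : ℝ) ^ (-(1 + ε))) • u n‖ := by
    refine Summable.of_nonneg_of_le (fun _ => norm_nonneg _) (fun m => ?_) hs
    rw [norm_smul, norm_mul, Real.norm_of_nonneg (hnn m), Real.norm_eq_abs, mul_assoc]
    have h1 : (m : ℝ) ^ (-(1 + ε)) * ‖u m‖ ≤ (m : ℝ) ^ (-(1 + ε)) :=
      mul_le_of_le_one_right (hnn m) (hu m)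
    have h2 : 0 ≤ (m : ℝ) ^ (-(1 + ε)) * ‖u m‖ := mul_nonneg (hnn m) (norm_nonneg _)
    calc _ ≤ 1 * ((m : ℝ) ^ (-(1 + ε)) * ‖u m‖) := mul_le_mul_of_nonneg_right (hμ m) h2
      _ ≤ _ := by rw [one_mul]; exact h1
  have hsum := summable_mul_of_summable_norm hA hB
  have key := (hA.of_norm.hasSum.mul hB.of_norm.hasSum hsum).tsum_fiberwise
    (fun p : ℕ × ℕ => p.1 * p.2)
  refine key.unique ?_
  have : ∀ k : ℕ, (∑' b : (fun p : ℕ × ℕ => p.1 * p.2) ⁻¹' {k},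
      ((b.1.1 : ℕ) : ℝ) ^ (-(1 + ε)) • u b.1.1 *
        (((moebius b.1.2 : ℝ) * ((b.1.2 : ℕ) : ℝ) ^ (-(1 + ε))) • u b.1.2)) =
      if k = 1 then (1 : R) else 0 := by
    intro k
    -- The fibre over 0 is infinite, but each of its terms contains the weight of index 0, which
    -- vanishes.
    rcases eq_or_ne k 0 with rfl | hk
    · have : ∀ b : (fun p : ℕ × ℕ => p.1 * p.2) ⁻¹' {0},
          ((b.1.1 : ℕ) : ℝ) ^ (-(1 + ε)) • u b.1.1 *
            (((moebius b.1.2 : ℝ) * ((b.1.2 : ℕ) : ℝ) ^ (-(1 + ε))) • u b.1.2) = 0 := by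
        rintro ⟨⟨a, b⟩, hb⟩
        rcases Nat.mul_eq_zero.mp hb with rfl | rfl
        · simp only [hz, zero_smul, zero_mul]
        · simp only [hz, mul_zero, zero_smul]
      simp_rw [this, tsum_zero]
      rfl
    · rw [show (fun p : ℕ × ℕ ↦ p.1 * p.2) ⁻¹' {k} = k.divisorsAntidiagonal by ext; simp [hk],
        Finset.tsum_subtype' k.divisorsAntidiagonal (fun p : ℕ × ℕ =>
          ((p.1 : ℕ) : ℝ) ^ (-(1 + ε)) • u p.1 *
            (((moebius p.2 : ℝ) * ((p.2 : ℕ) : ℝ) ^ (-(1 + ε))) • u p.2))]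
      have h1 : ∀ p ∈ k.divisorsAntidiagonal, ((p.1 : ℕ) : ℝ) ^ (-(1 + ε)) • u p.1 *
            (((moebius p.2 : ℝ) * ((p.2 : ℕ) : ℝ) ^ (-(1 + ε))) • u p.2) =
          (moebius p.2 : ℝ) • ((k : ℝ) ^ (-(1 + ε)) • u k) := by
        rintro ⟨a, b⟩ hp
        have hab := Nat.ne_zero_of_mem_divisorsAntidiagonal hp
        obtain ⟨rfl, -⟩ := Nat.mem_divisorsAntidiagonal.mp hp
        simp only at hab ⊢
        rw [hmul a b hab.1 hab.2, Nat.cast_mul,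
          Real.mul_rpow (Nat.cast_nonneg a) (Nat.cast_nonneg b), smul_mul_smul_comm, smul_smul]
        congr 1
        ring
      rw [Finset.sum_congr rfl h1, ← Finset.sum_smul]
      have h2 : (∑ p ∈ k.divisorsAntidiagonal, (moebius p.2 : ℝ)) = if k = 1 then 1 else 0 := by
        have := congrArg (fun f : ArithmeticFunction ℤ => f k) coe_zeta_mul_moebius
        simp only [mul_apply, one_apply] at this
        have h3 : ∑ p ∈ k.divisorsAntidiagonal, moebius p.2 = if k = 1 then 1 else 0 := by
          rw [← this]
          refine Finset.sum_congr rfl fun p hp => ?_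
          have := (Nat.ne_zero_of_mem_divisorsAntidiagonal hp).1
          simp [this]
        exact_mod_cast h3
      rw [h2]
      split_ifs with h
      · subst h; simp [hu1]
      · simp
  simp only [this]
  exact hasSum_ite_eq 1 1

variable {H : Type*} [NormedAddCommGroup H] [InnerProductSpace ℂ H] [CompleteSpace H]

/-- If `A = ∑ m^{-1-ε} U_m` and `B = ∑ μ(n) n^{-1-ε} U_n` for commuting unitary operators `U_m` that
are inverted by the isometry `F`, then `A F B` is isometric. -/
theorem exists_hasSum_inner_regularized (U : ℕ → H ≃ₗᵢ[ℂ] H) (F : H →ₗᵢ[ℂ] H)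
    (hU1 : ∀ x, U 1 x = x) (hmul : ∀ m n, m ≠ 0 → n ≠ 0 → ∀ x, U (m * n) x = U m (U n x))
    (hcomm : ∀ m n x, U m (U n x) = U n (U m x))
    (hF : ∀ n x, U n (F (U n x)) = F x) {ε : ℝ} (hε : 0 < ε) :
    ∃ M : H →L[ℂ] H, (∀ x, ‖M x‖ = ‖x‖) ∧ ∀ x y : H, inner ℂ x (M y) =
      ∑' n : ℕ, ((ArithmeticFunction.moebius n : ℝ) * (n : ℝ) ^ (-(1 + ε)) : ℝ) *
        ∑' m : ℕ, (((m : ℝ) ^ (-(1 + ε)) : ℝ) : ℂ) *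
          inner ℂ x (U m ((U n).symm (F y))) := by
  have hs : Summable fun m : ℕ => (m : ℝ) ^ (-(1 + ε)) :=
    Real.summable_nat_rpow.mpr (by linarith)
  have hnn : ∀ m : ℕ, 0 ≤ (m : ℝ) ^ (-(1 + ε)) := fun m => Real.rpow_nonneg (Nat.cast_nonneg m) _
  have hμ : ∀ n : ℕ, |(ArithmeticFunction.moebius n : ℝ)| ≤ 1 := fun n => by
    exact_mod_cast ArithmeticFunction.abs_moebius_le_one
  let u : ℕ → H →L[ℂ] H := fun n => (U n : H ≃L[ℂ] H)
  let v : ℕ → H →L[ℂ] H := fun n => ((U n).symm : H ≃L[ℂ] H)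
  have hua : ∀ n x, u n x = U n x := fun _ _ => rfl
  have hva : ∀ n x, v n x = (U n).symm x := fun _ _ => rfl
  have hu : ∀ n, ‖u n‖ ≤ 1 := fun n =>
    ContinuousLinearMap.opNorm_le_bound _ zero_le_one fun x => by
      rw [one_mul, hua, LinearIsometryEquiv.norm_map]
  have hv : ∀ n, ‖v n‖ ≤ 1 := fun n =>
    ContinuousLinearMap.opNorm_le_bound _ zero_le_one fun x => by
      rw [one_mul, hva, LinearIsometryEquiv.norm_map]
  have sumW : ∀ w : ℕ → H →L[ℂ] H, (∀ n, ‖w n‖ ≤ 1) →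
      Summable fun m : ℕ => (m : ℝ) ^ (-(1 + ε)) • w m := fun w hw => by
    refine Summable.of_norm_bounded hs (fun m => ?_)
    rw [norm_smul, Real.norm_of_nonneg (hnn m)]
    exact mul_le_of_le_one_right (hnn m) (hw m)
  have sumB : Summable fun n : ℕ =>
      ((ArithmeticFunction.moebius n : ℝ) * (n : ℝ) ^ (-(1 + ε))) • u n := by
    refine Summable.of_norm_bounded hs (fun m => ?_)
    rw [norm_smul, norm_mul, Real.norm_of_nonneg (hnn m), Real.norm_eq_abs, mul_assoc]
    calc _ ≤ 1 * ((m : ℝ) ^ (-(1 + ε)) * ‖u m‖) :=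
          mul_le_mul_of_nonneg_right (hμ m) (mul_nonneg (hnn m) (norm_nonneg _))
      _ ≤ _ := by rw [one_mul]; exact mul_le_of_le_one_right (hnn m) (hu m)
  set A : H →L[ℂ] H := ∑' m : ℕ, (m : ℝ) ^ (-(1 + ε)) • u m with hA
  set A' : H →L[ℂ] H := ∑' m : ℕ, (m : ℝ) ^ (-(1 + ε)) • v m with hA'
  set B : H →L[ℂ] H := ∑' n : ℕ,
    ((ArithmeticFunction.moebius n : ℝ) * (n : ℝ) ^ (-(1 + ε))) • u n with hB
  have hAB : A * B = 1 := tsum_moebius_mul_rpow_smul hε u hu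
    (by ext x; exact hU1 x) (fun m n hm hn => by ext x; exact hmul m n hm hn x)
  have hAx : ∀ x, HasSum (fun m : ℕ => (m : ℝ) ^ (-(1 + ε)) • U m x) (A x) := fun x =>
    (sumW u hu).hasSum.mapL (ContinuousLinearMap.apply ℂ H x)
  have hA'x : ∀ x, HasSum (fun m : ℕ => (m : ℝ) ^ (-(1 + ε)) • (U m).symm x) (A' x) := fun x =>
    (sumW v hv).hasSum.mapL (ContinuousLinearMap.apply ℂ H x)
  have hBx : ∀ x, HasSum (fun n : ℕ =>
      ((ArithmeticFunction.moebius n : ℝ) * (n : ℝ) ^ (-(1 + ε))) • U n x) (B x) := fun x =>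
    sumB.hasSum.mapL (ContinuousLinearMap.apply ℂ H x)
  have hadj : ContinuousLinearMap.adjoint A = A' := by
    rw [← ContinuousLinearMap.star_eq_adjoint]
    refine (sumW u hu).hasSum.star.unique ?_
    convert (sumW v hv).hasSum using 2 with m
    rw [star_smul, star_trivial, ContinuousLinearMap.star_eq_adjoint]
    congr 1
    exact (U m).adjoint_eq_symm
  have hF' : ∀ n x, F (U n x) = (U n).symm (F x) := fun n x => by
    rw [LinearIsometryEquiv.eq_symm_apply, hF]
  have hF'' : ∀ n x, U n (F x) = F ((U n).symm x) := fun n x => by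
    rw [← LinearIsometryEquiv.eq_symm_apply, ← hF', LinearIsometryEquiv.apply_symm_apply]
  have hcomm' : ∀ m n x, U m ((U n).symm x) = (U n).symm (U m x) := fun m n x => by
    rw [LinearIsometryEquiv.eq_symm_apply, hcomm, LinearIsometryEquiv.apply_symm_apply]
  have hsm : ∀ (T : H →L[ℂ] H) (r : ℝ) (x : H), T (r • x) = r • T x := fun T r x =>
    T.map_smul_of_tower r x
  have hAV : ∀ m x, A ((U m).symm x) = (U m).symm (A x) := fun m x => by
    refine (hAx _).unique (((hAx x).mapL (v m)).congr_fun' fun k => ?_)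
    rw [hsm, hva, hcomm']
  -- The `U m` are commuting unitaries, so `A` commutes with every inverse `(U m).symm` and hence
  -- with its adjoint `A'`.
  have hnormal : ∀ x, ‖A x‖ = ‖A' x‖ := by
    have : IsStarNormal A := by
      refine ⟨?_⟩
      rw [ContinuousLinearMap.star_eq_adjoint, hadj]
      ext x
      refine (hA'x (A x)).unique (((hA'x x).mapL A).congr_fun' fun k => ?_)
      rw [hsm, hAV]
    intro x
    rw [ContinuousLinearMap.isStarNormal_iff_norm_eq_adjoint.mp this x, hadj]
  let F' : H →L[ℂ] H := F.toContinuousLinearMap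
  have hFF : ∀ x, F' x = F x := fun _ => rfl
  refine ⟨A * F' * B, fun x => ?_, fun x y => ?_⟩
  -- Passing `F` through `A` inverts each `U m`, which turns `A` into its adjoint. Normality then
  -- trades `A'` back for `A` inside the norm, and `A * B = 1` finishes.
  · have h1 : A (F (B x)) = F (A' (B x)) := by
      refine (hAx _).unique (((hA'x (B x)).mapL F').congr_fun' fun k => ?_)
      rw [hsm, hF'', hFF]
    change ‖A (F (B x))‖ = _
    rw [h1, F.norm_map, ← hnormal]
    exact congrArg (fun T : H →L[ℂ] H => ‖T x‖) hAB
  · symm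
    have h1 := ((hBx y).mapL (A * F')).mapL (innerSL ℂ x)
    rw [show inner ℂ x ((A * F' * B) y) = innerSL ℂ x ((A * F') (B y)) from rfl, ← h1.tsum_eq]
    refine tsum_congr fun n => ?_
    have h2 := (hAx ((U n).symm (F y))).mapL (innerSL ℂ x)
    rw [hsm, ← Complex.coe_smul, map_smul, smul_eq_mul]
    congr 1
    change _ = inner ℂ x (A (F (U n y)))
    rw [hF']
    refine Eq.trans ?_ h2.tsum_eq
    refine tsum_congr fun m => ?_
    rw [← Complex.coe_smul, map_smul, smul_eq_mul]
    rfl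

end DirichletOperators

end SiegelVeech

namespace SiegelVeech

/-! ### Sums against integrals, and the zero of 1/ζ at 1 -/

section RegularizedSums

open Filter Topology

/-- Comparison of a sum with an integral for a function with decaying derivative. -/
theorem norm_tsum_sub_integral_le {h h' : ℝ → ℂ} {E : ℝ}
    (hd : ∀ x, 0 < x → HasDerivAt h (h' x) x)
    (hb : ∀ x, 0 < x → ‖h' x‖ ≤ E * (1 + x) ^ (-(3 / 2) : ℝ))
    (hint : IntegrableOn h (Set.Ioi 0)) (hsum : Summable fun k : ℕ => h (k + 1)) :
    ‖(∑' k : ℕ, h (k + 1)) - ∫ x in Set.Ioi 0, h x‖ ≤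
      E * ∑' k : ℕ, ((k : ℝ) + 1) ^ (-(3 / 2) : ℝ) := by
  have hsE : Summable fun k : ℕ => ((k : ℝ) + 1) ^ (-(3 / 2) : ℝ) := by
    have := (summable_nat_add_iff 1).mpr
      (Real.summable_nat_rpow (p := (-(3 / 2) : ℝ)).mpr (by norm_num))
    simpa using this
  have hE : 0 ≤ E := by
    have := (norm_nonneg _).trans (hb 1 one_pos)
    by_contra hneg
    have h2 : (0 : ℝ) < (1 + 1) ^ (-(3 / 2) : ℝ) := by positivity
    nlinarith
  -- Mean value inequality on one unit cell, with the derivative bound taken at the left end point.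
  have hcell : ∀ k : ℕ, ‖h (k + 1) - ∫ x in (k : ℝ)..((k + 1 : ℕ) : ℝ), h x‖ ≤
      E * ((k : ℝ) + 1) ^ (-(3 / 2) : ℝ) := by
    intro k
    have hk : (0 : ℝ) ≤ k := Nat.cast_nonneg k
    have hle : (k : ℝ) ≤ ((k + 1 : ℕ) : ℝ) := by push_cast; linarith
    have hii : IntervalIntegrable h volume (k : ℝ) ((k + 1 : ℕ) : ℝ) := by
      rw [intervalIntegrable_iff_integrableOn_Ioc_of_le hle]
      exact hint.mono_set fun x hx => lt_of_le_of_lt hk hx.1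
    have h1 : h (k + 1) = ∫ x in (k : ℝ)..((k + 1 : ℕ) : ℝ), h (k + 1) := by
      simp
    rw [h1, ← intervalIntegral.integral_sub (by simp) hii]
    have := intervalIntegral.norm_integral_le_of_norm_le_const (a := (k : ℝ))
      (b := ((k + 1 : ℕ) : ℝ)) (f := fun x => h (k + 1) - h x)
      (C := E * ((k : ℝ) + 1) ^ (-(3 / 2) : ℝ)) ?_
    · simpa using this
    · intro x hx
      rw [Set.uIoc_of_le hle] at hx
      push_cast at hx
      have hx0 : 0 < x := lt_of_le_of_lt hk hx.1
      have := (convex_Icc x ((k : ℝ) + 1)).norm_image_sub_le_of_norm_hasDerivWithin_le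
        (f := h) (f' := h') (C := E * ((k : ℝ) + 1) ^ (-(3 / 2) : ℝ))
        (fun y hy => (hd y (lt_of_lt_of_le hx0 hy.1)).hasDerivWithinAt)
        (fun y hy => (hb y (lt_of_lt_of_le hx0 hy.1)).trans ?_)
        (Set.left_mem_Icc.mpr hx.2) (Set.right_mem_Icc.mpr hx.2)
      · refine this.trans (mul_le_of_le_one_right (by positivity) ?_)
        rw [Real.norm_of_nonneg (by linarith [hx.2])]
        linarith [hx.1]
      · refine mul_le_mul_of_nonneg_left ?_ hE
        exact Real.rpow_le_rpow_of_nonpos (by linarith) (by linarith [hx.1, hy.1]) (by norm_num)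
  have hfin : ∀ N : ℕ, ‖(∑ k ∈ Finset.range N, h (k + 1)) - ∫ x in (0 : ℝ)..(N : ℝ), h x‖ ≤
      E * ∑' k : ℕ, ((k : ℝ) + 1) ^ (-(3 / 2) : ℝ) := by
    intro N
    have hadj := intervalIntegral.sum_integral_adjacent_intervals (f := h) (μ := volume)
      (a := fun k : ℕ => (k : ℝ)) (n := N) (fun k _ => by
        rw [intervalIntegrable_iff_integrableOn_Ioc_of_le (by push_cast; linarith)]
        exact hint.mono_set fun x hx => lt_of_le_of_lt (Nat.cast_nonneg k) hx.1)
    simp only [Nat.cast_zero] at hadj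
    rw [← hadj, ← Finset.sum_sub_distrib]
    refine (norm_sum_le _ _).trans ((Finset.sum_le_sum fun k _ => hcell k).trans ?_)
    rw [← Finset.mul_sum]
    exact mul_le_mul_of_nonneg_left (hsE.sum_le_tsum _ fun k _ => by positivity) hE
  have hlim := (hsum.hasSum.tendsto_sum_nat).sub
    (intervalIntegral_tendsto_integral_Ioi 0 hint tendsto_natCast_atTop_atTop)
  exact le_of_tendsto hlim.norm (Eventually.of_forall hfin)

/-- The series is 1/ζ(1+δ), and δ ζ(1+δ) → 1. This zero is what removes the divergent main term from
the regularized sums below. -/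
theorem tendsto_tsum_moebius_mul_rpow :
    Tendsto (fun δ : ℝ => ∑' n : ℕ, (ArithmeticFunction.moebius n : ℝ) * (n : ℝ) ^ (-(1 + δ)))
      (𝓝[>] 0) (𝓝 0) := by
  have h1 : Tendsto (fun δ : ℝ => 1 + δ) (𝓝[>] 0) (𝓝[>] 1) := by
    refine tendsto_nhdsWithin_of_tendsto_nhds_of_eventually_within _ ?_ ?_
    · exact tendsto_nhdsWithin_of_tendsto_nhds
        (by simpa using (continuous_const.add continuous_id).tendsto (0 : ℝ) (f := fun δ : ℝ => 1 + δ))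
    · filter_upwards [self_mem_nhdsWithin] with δ hδ
      simpa using hδ
  have h2 := tendsto_sub_mul_tsum_nat_rpow.comp h1
  have h3 : Tendsto (fun δ : ℝ => δ) (𝓝[>] 0) (𝓝 0) := tendsto_nhdsWithin_of_tendsto_nhds tendsto_id
  have h4 := h3.mul (h2.inv₀ one_ne_zero)
  rw [zero_mul] at h4
  refine h4.congr' ?_
  filter_upwards [self_mem_nhdsWithin] with δ hδ
  have hδ : 0 < δ := hδ
  have key := tsum_moebius_mul_rpow_smul (R := ℝ) hδ (fun _ => 1) (by simp) rfl (by simp)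
  simp only [smul_eq_mul, mul_one] at key
  simp only [Function.comp, add_sub_cancel_left, one_div, ← Real.rpow_neg (Nat.cast_nonneg _)]
  set A := ∑' n : ℕ, (n : ℝ) ^ (-(1 + δ))
  have hA : A ≠ 0 := left_ne_zero_of_mul_eq_one key
  rw [eq_inv_of_mul_eq_one_right key]
  field_simp

end RegularizedSums

end SiegelVeech

namespace SiegelVeech

/-! ### Estimates that are uniform in the regularization parameter -/

section RegularizedLimit

open Filter Topology

/-- Quadratic vanishing at `0` and quadratic decay at `∞` of a function and its derivative. -/
structure QuadraticDecay (W W' : ℝ → ℂ) (C : ℝ) : Prop where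
  hasDerivAt : ∀ a, 0 < a → HasDerivAt W (W' a) a
  norm_le_sq : ∀ a, 0 ≤ a → ‖W a‖ ≤ C * a ^ 2
  norm_le_inv : ∀ a, 0 < a → ‖W a‖ ≤ C * (a ^ 2)⁻¹
  norm_deriv_le : ∀ a, 0 ≤ a → ‖W' a‖ ≤ C * a
  norm_deriv_le_inv : ∀ a, 0 < a → ‖W' a‖ ≤ C * (a ^ 2)⁻¹

namespace QuadraticDecay

variable {W W' : ℝ → ℂ} {C : ℝ}

theorem nonneg (hW : QuadraticDecay W W' C) : 0 ≤ C := by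
  simpa using (norm_nonneg _).trans (hW.norm_le_sq 1 zero_le_one)

theorem apply_zero (hW : QuadraticDecay W W' C) : W 0 = 0 := by
  simpa using hW.norm_le_sq 0 le_rfl

/-- For ε ≤ 1 the factor u^{-ε} costs at most one power of u near 0, which quadratic vanishing can
afford; for u ≥ 1 it is at most 1. The bound does not depend on ε, so it serves as a dominating
function. The 4 comes from (1+u)² ≤ 4 max(1, u²). -/
theorem rpow_mul_norm_le (hW : QuadraticDecay W W' C) {ε : ℝ} (h0 : 0 ≤ ε) (h1 : ε ≤ 1) {u : ℝ}
    (hu : 0 < u) : u ^ (-ε) * ‖W u‖ ≤ 4 * C * ((1 + u) ^ 2)⁻¹ := by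
  have hC := hW.nonneg
  rw [← div_eq_mul_inv, le_div_iff₀ (by positivity)]
  rcases le_total u 1 with h | h
  · have h2 : u ^ (-ε) ≤ u⁻¹ := by
      rw [← Real.rpow_neg_one]
      exact Real.rpow_le_rpow_of_exponent_ge hu h (by linarith)
    have h3 : u ^ (-ε) * ‖W u‖ ≤ C := by
      calc u ^ (-ε) * ‖W u‖ ≤ u⁻¹ * (C * u ^ 2) :=
            mul_le_mul h2 (hW.norm_le_sq u hu.le) (norm_nonneg _) (by positivity)
        _ = C * u := by field_simp
        _ ≤ C := mul_le_of_le_one_right hC h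
    have h4 : (1 + u) ^ 2 ≤ 4 := by nlinarith
    calc _ ≤ C * 4 := mul_le_mul h3 h4 (by positivity) hC
      _ = _ := by ring
  · have h2 : u ^ (-ε) ≤ 1 := Real.rpow_le_one_of_one_le_of_nonpos h (by linarith)
    have h3 : u ^ (-ε) * ‖W u‖ ≤ C * (u ^ 2)⁻¹ := by
      calc _ ≤ 1 * ‖W u‖ := mul_le_mul_of_nonneg_right h2 (norm_nonneg _)
        _ ≤ _ := by rw [one_mul]; exact hW.norm_le_inv u hu
    have h4 : (1 + u) ^ 2 ≤ 4 * u ^ 2 := by nlinarith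
    calc _ ≤ C * (u ^ 2)⁻¹ * (4 * u ^ 2) := mul_le_mul h3 h4 (by positivity) (by positivity)
      _ = _ := by field_simp

theorem rpow_mul_norm_deriv_le (hW : QuadraticDecay W W' C) {ε : ℝ} (h0 : 0 ≤ ε) (h1 : ε ≤ 1)
    {u : ℝ} (hu : 0 < u) : u ^ (-ε) * ‖W' u‖ ≤ 4 * C * ((1 + u) ^ 2)⁻¹ := by
  have hC := hW.nonneg
  rw [← div_eq_mul_inv, le_div_iff₀ (by positivity)]
  rcases le_total u 1 with h | h
  · have h2 : u ^ (-ε) ≤ u⁻¹ := by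
      rw [← Real.rpow_neg_one]
      exact Real.rpow_le_rpow_of_exponent_ge hu h (by linarith)
    have h3 : u ^ (-ε) * ‖W' u‖ ≤ C := by
      calc u ^ (-ε) * ‖W' u‖ ≤ u⁻¹ * (C * u) :=
            mul_le_mul h2 (hW.norm_deriv_le u hu.le) (norm_nonneg _) (by positivity)
        _ = C := by field_simp
    have h4 : (1 + u) ^ 2 ≤ 4 := by nlinarith
    calc _ ≤ C * 4 := mul_le_mul h3 h4 (by positivity) hC
      _ = _ := by ring
  · have h2 : u ^ (-ε) ≤ 1 := Real.rpow_le_one_of_one_le_of_nonpos h (by linarith)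
    have h3 : u ^ (-ε) * ‖W' u‖ ≤ C * (u ^ 2)⁻¹ := by
      calc _ ≤ 1 * ‖W' u‖ := mul_le_mul_of_nonneg_right h2 (norm_nonneg _)
        _ ≤ _ := by rw [one_mul]; exact hW.norm_deriv_le_inv u hu
    have h4 : (1 + u) ^ 2 ≤ 4 * u ^ 2 := by nlinarith
    calc _ ≤ C * (u ^ 2)⁻¹ * (4 * u ^ 2) := mul_le_mul h3 h4 (by positivity) (by positivity)
      _ = _ := by field_simp

theorem rpow_succ_mul_norm_le (hW : QuadraticDecay W W' C) {ε : ℝ} (h0 : 0 ≤ ε) (h1 : ε ≤ 1)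
    {u : ℝ} (hu : 0 < u) : u ^ (-ε - 1) * ‖W u‖ ≤ 4 * C * ((1 + u) ^ 2)⁻¹ := by
  have hC := hW.nonneg
  rw [← div_eq_mul_inv, le_div_iff₀ (by positivity)]
  rcases le_total u 1 with h | h
  · have h2 : u ^ (-ε - 1) ≤ (u ^ 2)⁻¹ := by
      rw [← Real.rpow_natCast, ← Real.rpow_neg hu.le]
      exact Real.rpow_le_rpow_of_exponent_ge hu h (by push_cast; linarith)
    have h3 : u ^ (-ε - 1) * ‖W u‖ ≤ C := by
      calc _ ≤ (u ^ 2)⁻¹ * (C * u ^ 2) :=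
            mul_le_mul h2 (hW.norm_le_sq u hu.le) (norm_nonneg _) (by positivity)
        _ = C := by field_simp
    have h4 : (1 + u) ^ 2 ≤ 4 := by nlinarith
    calc _ ≤ C * 4 := mul_le_mul h3 h4 (by positivity) hC
      _ = _ := by ring
  · have h2 : u ^ (-ε - 1) ≤ 1 := Real.rpow_le_one_of_one_le_of_nonpos h (by linarith)
    have h3 : u ^ (-ε - 1) * ‖W u‖ ≤ C * (u ^ 2)⁻¹ := by
      calc _ ≤ 1 * ‖W u‖ := mul_le_mul_of_nonneg_right h2 (norm_nonneg _)
        _ ≤ _ := by rw [one_mul]; exact hW.norm_le_inv u hu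
    have h4 : (1 + u) ^ 2 ≤ 4 * u ^ 2 := by nlinarith
    calc _ ≤ C * (u ^ 2)⁻¹ * (4 * u ^ 2) := mul_le_mul h3 h4 (by positivity) (by positivity)
      _ = _ := by field_simp

theorem continuousOn (hW : QuadraticDecay W W' C) : ContinuousOn W (Set.Ioi 0) := fun x hx =>
  (hW.hasDerivAt x hx).continuousAt.continuousWithinAt

theorem _root_.SiegelVeech.integrableOn_inv_one_add_sq :
    IntegrableOn (fun u : ℝ => ((1 + u) ^ 2)⁻¹) (Set.Ioi 0) := by
  refine integrable_inv_one_add_sq.integrableOn.mono' ?_ ?_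
  · refine (ContinuousOn.inv₀ (by fun_prop) fun x hx => ?_).aestronglyMeasurable measurableSet_Ioi
    have : (0 : ℝ) < x := hx
    positivity
  · refine (ae_restrict_iff' measurableSet_Ioi).mpr (Eventually.of_forall fun x hx => ?_)
    have hx : (0 : ℝ) < x := hx
    rw [Real.norm_of_nonneg (by positivity)]
    gcongr
    nlinarith

theorem norm_rpow_mul_le (hW : QuadraticDecay W W' C) {ε : ℝ} (h0 : 0 ≤ ε) (h1 : ε ≤ 1) {u : ℝ}
    (hu : 0 < u) : ‖((u ^ (-ε) : ℝ) : ℂ) * W u‖ ≤ 4 * C * ((1 + u) ^ 2)⁻¹ := by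
  rw [norm_mul, Complex.norm_real, Real.norm_of_nonneg (by positivity)]
  exact hW.rpow_mul_norm_le h0 h1 hu

theorem aestronglyMeasurable_rpow_mul (hW : QuadraticDecay W W' C) (ε : ℝ) :
    AEStronglyMeasurable (fun u : ℝ => ((u ^ (-ε) : ℝ) : ℂ) * W u)
      (volume.restrict (Set.Ioi 0)) := by
  refine ContinuousOn.aestronglyMeasurable (ContinuousOn.mul ?_ hW.continuousOn) measurableSet_Ioi
  refine Complex.continuous_ofReal.comp_continuousOn fun x hx => ?_
  exact (Real.continuousAt_rpow_const _ _ (Or.inl (ne_of_gt hx))).continuousWithinAt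

theorem integrableOn_rpow_mul (hW : QuadraticDecay W W' C) {ε : ℝ} (h0 : 0 ≤ ε) (h1 : ε ≤ 1) :
    IntegrableOn (fun u : ℝ => ((u ^ (-ε) : ℝ) : ℂ) * W u) (Set.Ioi 0) := by
  refine (integrableOn_inv_one_add_sq.const_mul (4 * C)).mono'
    (hW.aestronglyMeasurable_rpow_mul ε) ?_
  exact (ae_restrict_iff' measurableSet_Ioi).mpr
    (Eventually.of_forall fun x hx => hW.norm_rpow_mul_le h0 h1 hx)

/-- `∑_{m ≥ 1} H(m/n)` for `H(u) = u^{-ε} W(u)`. -/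
noncomputable def dilatedSum (W : ℝ → ℂ) (ε : ℝ) (n : ℕ) : ℂ :=
  ∑' k : ℕ, ((((k + 1 : ℝ) / n) ^ (-ε) : ℝ) : ℂ) * W ((k + 1 : ℝ) / n)

theorem norm_dilatedSum_term_le (hW : QuadraticDecay W W' C) {ε : ℝ} (h0 : 0 ≤ ε) (h1 : ε ≤ 1)
    {n : ℕ} (hn : n ≠ 0) (k : ℕ) :
    ‖((((k + 1 : ℝ) / n) ^ (-ε) : ℝ) : ℂ) * W ((k + 1 : ℝ) / n)‖ ≤
      4 * C * n ^ 2 * ((k : ℝ) + 1) ^ (-2 : ℝ) := by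
  have hn' : (0 : ℝ) < n := by positivity
  have hC := hW.nonneg
  refine (hW.norm_rpow_mul_le h0 h1 (by positivity)).trans ?_
  rw [Real.rpow_neg (by positivity), mul_assoc (4 * C)]
  refine mul_le_mul_of_nonneg_left ?_ (by positivity)
  rw [show (2 : ℝ) = ((2 : ℕ) : ℝ) by norm_num, Real.rpow_natCast]
  rw [show (1 + ((k : ℝ) + 1) / n) ^ 2 = (n + (k + 1)) ^ 2 / (n : ℝ) ^ 2 by field_simp, inv_div,
    div_eq_mul_inv]
  exact mul_le_mul_of_nonneg_left (inv_anti₀ (by positivity)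
    (pow_le_pow_left₀ (by positivity) (by linarith) 2)) (by positivity)

theorem summable_nat_add_one_rpow {p : ℝ} (hp : p < -1) :
    Summable fun k : ℕ => ((k : ℝ) + 1) ^ p := by
  have := (summable_nat_add_iff 1).mpr (Real.summable_nat_rpow (p := p).mpr hp)
  simpa using this

/-- Sum–integral comparison for x ↦ H(x/n). What matters is that the error exponent in n lies below
1: after weighting by n⁻² it leaves the summable n^{-3/2}, whereas the main term n ∫ H alone would
give the divergent ∑ 1/n. -/
theorem norm_dilatedSum_sub_le (hW : QuadraticDecay W W' C) {ε : ℝ} (h0 : 0 ≤ ε) (h1 : ε ≤ 1)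
    {n : ℕ} (hn : n ≠ 0) :
    ‖dilatedSum W ε n - n * ∫ u in Set.Ioi (0 : ℝ), ((u ^ (-ε) : ℝ) : ℂ) * W u‖ ≤
      8 * C * (n : ℝ) ^ (1 / 2 : ℝ) * ∑' k : ℕ, ((k : ℝ) + 1) ^ (-(3 / 2) : ℝ) := by
  have hn' : (0 : ℝ) < n := by positivity
  have hC := hW.nonneg
  set H : ℝ → ℂ := fun u => ((u ^ (-ε) : ℝ) : ℂ) * W u with hH
  set H' : ℝ → ℂ := fun u => ((-ε * u ^ (-ε - 1) : ℝ) : ℂ) * W u + ((u ^ (-ε) : ℝ) : ℂ) * W' u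
  have hHd : ∀ u, 0 < u → HasDerivAt H (H' u) u := fun u hu =>
    ((Real.hasDerivAt_rpow_const (Or.inl hu.ne')).ofReal_comp).mul (hW.hasDerivAt u hu)
  have hHb : ∀ u, 0 < u → ‖H' u‖ ≤ 8 * C * ((1 + u) ^ 2)⁻¹ := by
    intro u hu
    refine (norm_add_le _ _).trans ?_
    rw [norm_mul, norm_mul, Complex.norm_real, Complex.norm_real,
      Real.norm_of_nonneg (by positivity : 0 ≤ u ^ (-ε)), norm_mul, norm_neg,
      Real.norm_of_nonneg h0, Real.norm_of_nonneg (by positivity : 0 ≤ u ^ (-ε - 1)), mul_assoc]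
    have h2 := hW.rpow_succ_mul_norm_le h0 h1 hu
    have h3 := hW.rpow_mul_norm_deriv_le h0 h1 hu
    have h4 : ε * (u ^ (-ε - 1) * ‖W u‖) ≤ 1 * (u ^ (-ε - 1) * ‖W u‖) :=
      mul_le_mul_of_nonneg_right h1 (by positivity)
    linarith
  have key := norm_tsum_sub_integral_le (h := fun x => H (x / n)) (h' := fun x => H' (x / n) / n)
    (E := 8 * C * (n : ℝ) ^ (1 / 2 : ℝ)) ?_ ?_ ?_ ?_
  · have e1 : ∫ x in Set.Ioi (0 : ℝ), H (x / n) = n * ∫ u in Set.Ioi (0 : ℝ), H u := by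
      have := integral_comp_mul_right_Ioi H 0 (inv_pos.mpr hn')
      simp only [inv_inv, ← div_eq_mul_inv] at this
      rw [zero_div] at this
      rw [this, Complex.real_smul]
      simp
    rw [e1] at key
    exact key
  · intro x hx
    have := (hHd (x / n) (by positivity)).scomp x ((hasDerivAt_id x).div_const (n : ℝ))
    refine this.congr_deriv ?_
    rw [Complex.real_smul]; push_cast; ring
  · intro x hx
    rw [norm_div, Complex.norm_natCast, div_le_iff₀ hn']
    refine (hHb _ (by positivity)).trans ?_
    -- Split (n + x)² as (n + x)^{1/2} (n + x)^{3/2} and bound the factors below by n^{1/2} and (1 +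
    -- x)^{3/2}.
    suffices hs : ((1 + x / n) ^ 2)⁻¹ ≤ (n : ℝ) ^ (1 / 2 : ℝ) * (1 + x) ^ (-(3 / 2) : ℝ) * n from
      (mul_le_mul_of_nonneg_left hs (by positivity : 0 ≤ 8 * C)).trans_eq (by ring)
    rw [show (1 + x / n) ^ 2 = (n + x) ^ 2 / (n : ℝ) ^ 2 by field_simp, inv_div,
      div_le_iff₀ (by positivity)]
    have e1 : (1 : ℝ) ≤ n := by exact_mod_cast Nat.one_le_iff_ne_zero.mpr hn
    have e2 : (n + x) ^ 2 = (n + x) ^ (1 / 2 : ℝ) * (n + x) ^ (3 / 2 : ℝ) := by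
      rw [← Real.rpow_add (by positivity), ← Real.rpow_natCast]
      norm_num
    have e3 : (n : ℝ) ^ (1 / 2 : ℝ) ≤ (n + x) ^ (1 / 2 : ℝ) :=
      Real.rpow_le_rpow hn'.le (by linarith) (by norm_num)
    have e4 : (1 + x) ^ (3 / 2 : ℝ) ≤ (n + x) ^ (3 / 2 : ℝ) :=
      Real.rpow_le_rpow (by positivity) (by linarith) (by norm_num)
    have e5 : (n : ℝ) ^ (1 / 2 : ℝ) * (n : ℝ) ^ (1 / 2 : ℝ) = n := by
      rw [← Real.rpow_add hn']; norm_num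
    rw [e2]
    calc (n : ℝ) ^ 2 = ((n : ℝ) ^ (1 / 2 : ℝ) * (1 + x) ^ (-(3 / 2) : ℝ) * n) *
          ((n : ℝ) ^ (1 / 2 : ℝ) * (1 + x) ^ (3 / 2 : ℝ)) := by
          have : (1 + x) ^ (-(3 / 2) : ℝ) * (1 + x) ^ (3 / 2 : ℝ) = 1 := by
            rw [← Real.rpow_add (by positivity)]; norm_num
          linear_combination (-(n : ℝ)) * e5 - n * (n : ℝ) ^ (1 / 2 : ℝ) * (n : ℝ) ^ (1 / 2 : ℝ) * this
      _ ≤ _ := by gcongr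
  · have := hW.integrableOn_rpow_mul h0 h1
    have h2 := (integrableOn_Ioi_comp_mul_right_iff H 0 (inv_pos.mpr hn')).mpr (by simpa using this)
    simpa only [div_eq_mul_inv] using h2
  · refine Summable.of_norm_bounded
      ((summable_nat_add_one_rpow (p := -2) (by norm_num)).mul_left (4 * C * n ^ 2)) fun k => ?_
    exact hW.norm_dilatedSum_term_le h0 h1 hn k

end QuadraticDecay

end RegularizedLimit

end SiegelVeech

namespace SiegelVeech

/-! ### Letting the regularization parameter tend to 0 -/

section RegularizedLimit

open Filter Topology

namespace QuadraticDecay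

variable {W W' : ℝ → ℂ} {C : ℝ}

theorem tendsto_dilatedSum (hW : QuadraticDecay W W' C) {n : ℕ} (hn : n ≠ 0) :
    Tendsto (fun ε => dilatedSum W ε n) (𝓝[>] 0) (𝓝 (dilatedSum W 0 n)) := by
  have hn' : (0 : ℝ) < n := by positivity
  refine tendsto_tsum_of_dominated_convergence
    (bound := fun k : ℕ => 4 * C * n ^ 2 * ((k : ℝ) + 1) ^ (-2 : ℝ))
    ((summable_nat_add_one_rpow (p := -2) (by norm_num)).mul_left (4 * C * n ^ 2)) (fun k => ?_) ?_
  · refine Tendsto.mul_const _ ((Complex.continuous_ofReal.tendsto _).comp ?_)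
    have : Continuous fun ε : ℝ => ((k + 1 : ℝ) / n) ^ (-ε) :=
      continuous_const.rpow continuous_neg fun x => Or.inl (by positivity)
    exact (this.tendsto 0).mono_left nhdsWithin_le_nhds
  · filter_upwards [self_mem_nhdsWithin, Ioc_mem_nhdsGT zero_lt_one] with ε h0 h1 k
    exact hW.norm_dilatedSum_term_le h0.le h1.2 hn k

theorem tendsto_integral_rpow_mul (hW : QuadraticDecay W W' C) :
    Tendsto (fun ε : ℝ => ∫ u in Set.Ioi (0 : ℝ), ((u ^ (-ε) : ℝ) : ℂ) * W u) (𝓝[>] 0)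
      (𝓝 (∫ u in Set.Ioi (0 : ℝ), W u)) := by
  refine tendsto_integral_filter_of_dominated_convergence
    (fun u => 4 * C * ((1 + u) ^ 2)⁻¹) ?_ ?_ (integrableOn_inv_one_add_sq.const_mul (4 * C)) ?_
  · exact Eventually.of_forall fun ε => hW.aestronglyMeasurable_rpow_mul ε
  · filter_upwards [self_mem_nhdsWithin, Ioc_mem_nhdsGT zero_lt_one] with ε h0 h1
    exact (ae_restrict_iff' measurableSet_Ioi).mpr
      (Eventually.of_forall fun x hx => hW.norm_rpow_mul_le h0.le h1.2 hx)
  · refine (ae_restrict_iff' measurableSet_Ioi).mpr (Eventually.of_forall fun u hu => ?_)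
    have h1 : Continuous fun ε : ℝ => ((u ^ (-ε) : ℝ) : ℂ) * W u :=
      (Complex.continuous_ofReal.comp
        (continuous_const.rpow continuous_neg fun x => Or.inl (ne_of_gt hu))).mul continuous_const
    have h2 := (h1.tendsto 0).mono_left (nhdsWithin_le_nhds (s := Set.Ioi 0))
    simpa using h2

/-- Writing m^{-1-ε}(m/n) as n^{-1-ε}(m/n)^{-ε} puts all dependence on m into the ratio m/n. The
weight m/n in front of `W` is the L² normalization of the dilations. -/
theorem regularized_term_eq (ε : ℝ) {n : ℕ} (hn : n ≠ 0) :
    (((n : ℝ) ^ (-(1 + ε)) : ℝ) : ℂ) * ∑' m : ℕ, (((m : ℝ) ^ (-(1 + ε)) : ℝ) : ℂ) *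
      ((((m : ℝ) / n : ℝ) : ℂ) * W ((m : ℝ) / n)) =
    (((n : ℝ) ^ (-(2 + 2 * ε)) : ℝ) : ℂ) * dilatedSum W ε n := by
  have hn' : (0 : ℝ) < n := by positivity
  rw [← Nat.succ_injective.tsum_eq (f := fun m : ℕ => (((m : ℝ) ^ (-(1 + ε)) : ℝ) : ℂ) *
      ((((m : ℝ) / n : ℝ) : ℂ) * W ((m : ℝ) / n)))]
  · rw [dilatedSum, ← tsum_mul_left, ← tsum_mul_left]
    refine tsum_congr fun k => ?_
    rw [← mul_assoc, ← mul_assoc, ← mul_assoc, Nat.cast_succ]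
    congr 1
    norm_cast
    push_cast
    have hk : (0 : ℝ) < (k : ℝ) + 1 := by positivity
    rw [Real.div_rpow hk.le hn'.le, show -(2 + 2 * ε) = -(1 + ε) + (-1) + (-ε) by ring,
      Real.rpow_add hn', Real.rpow_add hn', show -(1 + ε) = -1 + -ε by ring, Real.rpow_add hk,
      Real.rpow_neg_one, Real.rpow_neg_one]
    field_simp
  · intro m hm
    rcases Nat.exists_eq_succ_of_ne_zero (n := m) (fun h => by
      subst h
      simp at hm) with ⟨k, rfl⟩
    exact ⟨k, rfl⟩

/-- Subtract the main term n I(ε) from each inner sum. The remainders are dominated by n^{-3/2}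
uniformly in ε, so their limit can be taken termwise. What was subtracted adds up to I(ε) ∑ μ(n)
n^{-1-2ε} = I(ε)/ζ(1+2ε), which tends to 0. -/
theorem tendsto_regularized (hW : QuadraticDecay W W' C) :
    Tendsto (fun ε : ℝ => ∑' n : ℕ,
        ((ArithmeticFunction.moebius n : ℝ) * (n : ℝ) ^ (-(1 + ε)) : ℝ) *
          ∑' m : ℕ, (((m : ℝ) ^ (-(1 + ε)) : ℝ) : ℂ) *
            ((((m : ℝ) / n : ℝ) : ℂ) * W ((m : ℝ) / n)))
      (𝓝[>] 0)
      (𝓝 (∑' n : ℕ, (((ArithmeticFunction.moebius n : ℝ) * (n : ℝ) ^ (-2 : ℝ) : ℝ) : ℂ) *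
        (dilatedSum W 0 n - n * ∫ u in Set.Ioi (0 : ℝ), W u))) := by
  have hC := hW.nonneg
  have hμ : ∀ n : ℕ, |(ArithmeticFunction.moebius n : ℝ)| ≤ 1 := fun n => by
    exact_mod_cast ArithmeticFunction.abs_moebius_le_one
  set I : ℝ → ℂ := fun ε => ∫ u in Set.Ioi (0 : ℝ), ((u ^ (-ε) : ℝ) : ℂ) * W u with hI
  set c := ∑' k : ℕ, ((k : ℝ) + 1) ^ (-(3 / 2) : ℝ)
  have hbound : ∀ ε : ℝ, 0 < ε → ε ≤ 1 → ∀ n : ℕ,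
      ‖(((ArithmeticFunction.moebius n : ℝ) * (n : ℝ) ^ (-(2 + 2 * ε)) : ℝ) : ℂ) *
        (dilatedSum W ε n - n * I ε)‖ ≤ 8 * C * c * (n : ℝ) ^ (-(3 / 2) : ℝ) := by
    intro ε h0 h1 n
    rcases eq_or_ne n 0 with rfl | hn
    · simp
    have hn' : (0 : ℝ) < n := by positivity
    have hn1 : (1 : ℝ) ≤ n := by exact_mod_cast Nat.one_le_iff_ne_zero.mpr hn
    rw [norm_mul, Complex.norm_real, norm_mul, Real.norm_of_nonneg (by positivity :
      (0 : ℝ) ≤ (n : ℝ) ^ (-(2 + 2 * ε))), Real.norm_eq_abs]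
    have e1 := hW.norm_dilatedSum_sub_le h0.le h1 hn
    have e2 : (n : ℝ) ^ (-(2 + 2 * ε)) ≤ (n : ℝ) ^ (-2 : ℝ) :=
      Real.rpow_le_rpow_of_exponent_le hn1 (by linarith)
    have e3 : |(ArithmeticFunction.moebius n : ℝ)| * (n : ℝ) ^ (-(2 + 2 * ε)) ≤
        1 * (n : ℝ) ^ (-2 : ℝ) := mul_le_mul (hμ n) e2 (by positivity) zero_le_one
    calc _ ≤ (1 * (n : ℝ) ^ (-2 : ℝ)) * (8 * C * (n : ℝ) ^ (1 / 2 : ℝ) * c) :=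
          mul_le_mul e3 e1 (norm_nonneg _) (by positivity)
      _ = 8 * C * c * ((n : ℝ) ^ (-2 : ℝ) * (n : ℝ) ^ (1 / 2 : ℝ)) := by ring
      _ = _ := by rw [← Real.rpow_add hn']; norm_num
  have hsumb : Summable fun n : ℕ => 8 * C * c * (n : ℝ) ^ (-(3 / 2) : ℝ) :=
    (Real.summable_nat_rpow.mpr (by norm_num)).mul_left _
  have hfirst : Tendsto (fun ε : ℝ => ∑' n : ℕ,
      (((ArithmeticFunction.moebius n : ℝ) * (n : ℝ) ^ (-(2 + 2 * ε)) : ℝ) : ℂ) *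
        (dilatedSum W ε n - n * I ε)) (𝓝[>] 0)
      (𝓝 (∑' n : ℕ, (((ArithmeticFunction.moebius n : ℝ) * (n : ℝ) ^ (-2 : ℝ) : ℝ) : ℂ) *
        (dilatedSum W 0 n - n * ∫ u in Set.Ioi (0 : ℝ), W u))) := by
    refine tendsto_tsum_of_dominated_convergence hsumb (fun n => ?_) ?_
    · rcases eq_or_ne n 0 with rfl | hn
      · simp
      refine Tendsto.mul ((Complex.continuous_ofReal.tendsto _).comp (Tendsto.const_mul _ ?_))
        ((hW.tendsto_dilatedSum hn).sub (Tendsto.const_mul _ hW.tendsto_integral_rpow_mul))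
      have : Continuous fun ε : ℝ => (n : ℝ) ^ (-(2 + 2 * ε)) :=
        continuous_const.rpow (by fun_prop) fun x => Or.inl (by positivity)
      simpa using (this.tendsto 0).mono_left (nhdsWithin_le_nhds (s := Set.Ioi 0))
    · filter_upwards [self_mem_nhdsWithin, Ioc_mem_nhdsGT zero_lt_one] with ε h0 h1 n
      exact hbound ε h0 h1.2 n
  have hsecond : Tendsto (fun ε : ℝ => I ε * ((∑' n : ℕ, (ArithmeticFunction.moebius n : ℝ) *
      (n : ℝ) ^ (-(1 + 2 * ε)) : ℝ) : ℂ)) (𝓝[>] 0) (𝓝 0) := by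
    have h2 : Tendsto (fun ε : ℝ => 2 * ε) (𝓝[>] 0) (𝓝[>] 0) := by
      refine tendsto_nhdsWithin_of_tendsto_nhds_of_eventually_within _ ?_ ?_
      · have : Continuous fun ε : ℝ => 2 * ε := by fun_prop
        simpa using (this.tendsto 0).mono_left (nhdsWithin_le_nhds (s := Set.Ioi 0))
      · filter_upwards [self_mem_nhdsWithin] with δ hδ
        simpa using hδ
    have h3 := (Complex.continuous_ofReal.tendsto _).comp (tendsto_tsum_moebius_mul_rpow.comp h2)
    have h4 := hW.tendsto_integral_rpow_mul.mul h3
    simpa using h4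
  have hsum := hfirst.add hsecond
  rw [add_zero] at hsum
  refine hsum.congr' ?_
  filter_upwards [self_mem_nhdsWithin, Ioc_mem_nhdsGT zero_lt_one] with ε h0 h1
  have h0 : 0 < ε := h0
  have s1 := Summable.of_norm_bounded hsumb (hbound ε h0 h1.2)
  have s2 : Summable fun n : ℕ =>
      (((ArithmeticFunction.moebius n : ℝ) * (n : ℝ) ^ (-(1 + 2 * ε)) : ℝ) : ℂ) := by
    refine Summable.of_norm_bounded (Real.summable_nat_rpow (p := -(1 + 2 * ε)).mpr (by linarith))
      fun n => ?_
    rw [Complex.norm_real, norm_mul, Real.norm_of_nonneg (by positivity :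
      (0 : ℝ) ≤ (n : ℝ) ^ (-(1 + 2 * ε))), Real.norm_eq_abs]
    exact mul_le_of_le_one_left (by positivity) (hμ n)
  rw [Complex.ofReal_tsum, ← tsum_mul_left, ← s1.tsum_add (s2.mul_left _)]
  refine tsum_congr fun n => ?_
  rcases eq_or_ne n 0 with rfl | hn
  · simp
  have hn' : (0 : ℝ) < n := by positivity
  have e1 := regularized_term_eq (W := W) ε hn
  rw [Complex.ofReal_mul _ ((n : ℝ) ^ (-(1 + ε))), mul_assoc ((ArithmeticFunction.moebius n : ℝ) : ℂ)
    (((n : ℝ) ^ (-(1 + ε)) : ℝ) : ℂ), e1, show -(1 + 2 * ε) = 1 + -(2 + 2 * ε) by ring,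
    Real.rpow_add hn', Real.rpow_one]
  push_cast
  ring

end QuadraticDecay

end RegularizedLimit

end SiegelVeech

namespace SiegelVeech

/-! ### Poisson summation and totient weights -/

section RegularizedLimit

open Filter Topology FourierTransform

/-- The Fourier transform of a dilated function. -/
theorem fourier_comp_mul_natCast (w : ℝ → ℂ) {n : ℕ} (hn : n ≠ 0) (ξ : ℝ) :
    𝓕 (fun x => w (n * x)) ξ = (n : ℂ)⁻¹ * 𝓕 w (ξ / n) := by
  have hn' : (0 : ℝ) < n := by positivity
  rw [Real.fourier_eq', Real.fourier_eq']
  have := Measure.integral_comp_mul_left (fun v : ℝ =>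
    Complex.exp (↑(-2 * Real.pi * (inner ℝ v (ξ / n))) * Complex.I) • w v) (n : ℝ)
  rw [abs_of_pos (inv_pos.mpr hn'), Complex.real_smul] at this
  push_cast at this ⊢
  rw [← this]
  refine integral_congr_ae (Eventually.of_forall fun v => ?_)
  simp only [RCLike.inner_apply, conj_trivial]
  push_cast
  congr 3
  have : (n : ℂ) ≠ 0 := by exact_mod_cast hn
  field_simp

theorem tsum_int_eq_of_even {g : ℤ → ℂ} (hs : Summable g) (hg : ∀ n, g (-n) = g n) :
    ∑' n : ℤ, g n = g 0 + 2 * ∑' k : ℕ, g (k + 1) := by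
  have h1 : Summable fun k : ℕ => g k := hs.comp_injective Nat.cast_injective
  have h2 : Summable fun k : ℕ => g (-k) := hs.comp_injective fun a b h => by simpa using h
  have h3 := (HasSum.of_nat_of_neg h1.hasSum h2.hasSum).tsum_eq
  rw [h3]
  simp only [hg]
  rw [h1.tsum_eq_zero_add]
  simp only [Nat.cast_zero, Nat.cast_add, Nat.cast_one]
  ring

/-- Poisson summation and Fourier inversion for the inner sums. -/
theorem QuadraticDecay.dilatedSum_zero_sub {w W W' : ℝ → ℂ} {C : ℝ} (hW : QuadraticDecay W W' C)
    (hw : Continuous w) (hwc : HasCompactSupport w) (hwe : ∀ p, w (-p) = w p) (hWw : 𝓕 w = W)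
    {n : ℕ} (hn : n ≠ 0) :
    QuadraticDecay.dilatedSum W 0 n - n * ∫ u in Set.Ioi (0 : ℝ), W u =
      n * ∑' d : ℕ, w (n * (d + 1)) := by
  have hn' : (0 : ℝ) < n := by positivity
  have hnC : (n : ℂ) ≠ 0 := by exact_mod_cast hn
  have hWe : ∀ a, W (-a) = W a := by
    intro a
    rw [← hWw, Real.fourier_eq', Real.fourier_eq', ← integral_neg_eq_self]
    refine integral_congr_ae (Eventually.of_forall fun v => ?_)
    simp [hwe]
  have hWO : ∀ c : ℝ, 0 < c → (fun x : ℝ => W (x / c)) =O[cocompact ℝ] fun x => |x| ^ (-2 : ℝ) := by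
    intro c hc
    refine Asymptotics.IsBigO.of_bound (C * c ^ 2) ?_
    have : {(0 : ℝ)}ᶜ ∈ cocompact ℝ := isCompact_singleton.compl_mem_cocompact
    filter_upwards [this] with x hx
    have hx : x ≠ 0 := hx
    have hWa : W (x / c) = W (|x| / c) := by
      rcases abs_choice x with h | h
      · rw [h]
      · rw [h, neg_div, hWe]
    have hx' : 0 < |x| := abs_pos.mpr hx
    rw [hWa, Real.norm_of_nonneg (by positivity), Real.rpow_neg hx'.le,
      show (2 : ℝ) = ((2 : ℕ) : ℝ) by norm_num, Real.rpow_natCast]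
    refine (hW.norm_le_inv (|x| / c) (by positivity)).trans_eq ?_
    field_simp
  have hwi : Integrable w := hw.integrable_of_hasCompactSupport hwc
  have hWc : Continuous W := by
    rw [← hWw]; exact VectorFourier.fourierIntegral_continuous Real.continuous_fourierChar
      continuous_inner hwi
  have hWi : Integrable W := by
    refine (integrable_inv_one_add_sq.const_mul (4 * C)).mono' hWc.aestronglyMeasurable
      (Eventually.of_forall fun x => ?_)
    have hC := hW.nonneg
    have hpos : ∀ u : ℝ, 0 ≤ u → ‖W u‖ ≤ 4 * C * (1 + u ^ 2)⁻¹ := by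
      intro u hu
      rcases hu.eq_or_lt with rfl | hu
      · rw [hW.apply_zero, norm_zero]; positivity
      · have h1 := hW.rpow_mul_norm_le le_rfl zero_le_one hu
        rw [neg_zero, Real.rpow_zero, one_mul] at h1
        refine h1.trans (mul_le_mul_of_nonneg_left (inv_anti₀ (by positivity) ?_) (by positivity))
        nlinarith
    rcases abs_choice x with h | h
    · rw [← sq_abs, h]; exact hpos x (h ▸ abs_nonneg x)
    · rw [← hWe, ← sq_abs, h]; exact hpos (-x) (h ▸ abs_nonneg x)
  -- Fourier inversion at 0 and evenness. This is exactly the contribution of the term k = 0 on the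
  -- `w` side of Poisson summation, so subtracting n times the integral cancels it. On the other
  -- side the term at 0 is absent because W 0 = 0.
  have hinv : ∫ u in Set.Ioi (0 : ℝ), W u = w 0 / 2 := by
    have h1 := congrFun (hw.fourierInv_fourier_eq hwi (by rwa [hWw])) 0
    rw [hWw, Real.fourierInv_eq'] at h1
    simp only [inner_zero_right, mul_zero, Complex.ofReal_zero, zero_mul, Complex.exp_zero,
      one_smul] at h1
    have h2 := intervalIntegral.integral_Iic_add_Ioi (hWi.integrableOn (s := Set.Iic 0))
      (hWi.integrableOn (s := Set.Ioi 0))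
    have h3 := integral_comp_neg_Iic (0 : ℝ) W
    simp only [hWe, neg_zero] at h3
    rw [h1, h3] at h2
    rw [← h2]; ring
  have hcomp : HasCompactSupport fun x : ℝ => w (n * x) :=
    hwc.comp_homeomorph (Homeomorph.mulLeft₀ (n : ℝ) hn'.ne')
  have hO1 : (fun x : ℝ => w (n * x)) =O[cocompact ℝ] fun x => |x| ^ (-2 : ℝ) := by
    refine Asymptotics.IsBigO.of_bound 1 ?_
    filter_upwards [hcomp.isCompact.compl_mem_cocompact] with x hx
    rw [image_eq_zero_of_notMem_tsupport hx, norm_zero]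
    positivity
  have hpoisson := Real.tsum_eq_tsum_fourier_of_rpow_decay (f := fun x => w (n * x))
    (hw.comp (by fun_prop)) (b := 2) (by norm_num) hO1 ?_ 0
  · have s1 : Summable fun k : ℤ => W ((k : ℝ) / n) :=
      summable_of_isBigO (Real.summable_abs_int_rpow (b := 2) (by norm_num))
        ((hWO n hn').comp_tendsto Int.tendsto_coe_cofinite)
    have s2 : Summable fun k : ℤ => w (n * (k : ℝ)) :=
      summable_of_isBigO (Real.summable_abs_int_rpow (b := 2) (by norm_num))
        (hO1.comp_tendsto Int.tendsto_coe_cofinite)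
    simp only [zero_add, fourier_comp_mul_natCast w hn, hWw, QuotientAddGroup.mk_zero,
      fourier_eval_zero, mul_one] at hpoisson
    rw [tsum_mul_left, tsum_int_eq_of_even s2 (fun k => by push_cast; rw [mul_neg, hwe]),
      tsum_int_eq_of_even s1 (fun k => by push_cast; rw [neg_div, hWe])] at hpoisson
    simp only [Int.cast_zero, mul_zero, zero_div, hW.apply_zero, zero_add, Int.cast_add,
      Int.cast_natCast, Int.cast_one] at hpoisson
    rw [hinv, QuadraticDecay.dilatedSum]
    simp only [neg_zero, Real.rpow_zero, Complex.ofReal_one, one_mul]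
    field_simp at hpoisson
    linear_combination (-1 / 2 : ℂ) * hpoisson
  · rw [show 𝓕 (fun x : ℝ => w (n * x)) = fun ξ => (n : ℂ)⁻¹ * W (ξ / n) from
      funext fun ξ => by rw [fourier_comp_mul_natCast w hn, hWw]]
    exact (hWO n hn').const_mul_left _

/-- Regrouping by products, `∑_{n ∣ k} μ(n) / n = φ(k) / k`. -/
theorem tsum_moebius_tsum_eq {w : ℝ → ℂ} (hwc : HasCompactSupport w) :
    ∑' n : ℕ, (((ArithmeticFunction.moebius n : ℝ) * (n : ℝ) ^ (-2 : ℝ) : ℝ) : ℂ) *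
      (n * ∑' d : ℕ, w (n * (d + 1))) =
    ∑' k : ℕ, ((Nat.totient (k + 1) : ℂ) / (k + 1 : ℂ)) * w (k + 1) := by
  obtain ⟨R, hR⟩ := hwc.isCompact.isBounded.subset_ball 0
  have hwR : ∀ x : ℝ, R ≤ |x| → w x = 0 := fun x hx => image_eq_zero_of_notMem_tsupport fun h => by
    have := hR h
    rw [mem_ball_zero_iff, Real.norm_eq_abs] at this
    linarith
  -- Pairs with a zero coordinate are switched off, so only finitely many pairs survive the compact
  -- support of `w` and the relevant fibres of the product are divisor pairs.
  let f : ℕ × ℕ → ℂ := fun p => if p.1 * p.2 = 0 then 0 else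
    (ArithmeticFunction.moebius p.1 : ℂ) / p.1 * w ((p.1 * p.2 : ℕ) : ℝ)
  have hsum : Summable f := by
    refine summable_of_ne_finset_zero (s := Finset.range (⌈R⌉₊) ×ˢ Finset.range (⌈R⌉₊))
      fun p hp => ?_
    simp only [f]
    split_ifs with h
    · rfl
    · rw [hwR, mul_zero]
      rw [Finset.mem_product, Finset.mem_range, Finset.mem_range, not_and_or, not_lt, not_lt] at hp
      have hp' : ⌈R⌉₊ ≤ p.1 * p.2 := by
        rcases hp with hp | hp
        · exact hp.trans (Nat.le_mul_of_pos_right _ (Nat.pos_of_ne_zero fun h0 => h (by simp [h0])))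
        · exact hp.trans (Nat.le_mul_of_pos_left _ (Nat.pos_of_ne_zero fun h0 => h (by simp [h0])))
      rw [abs_of_nonneg (Nat.cast_nonneg _)]
      exact (Nat.le_ceil R).trans (by exact_mod_cast hp')
  have hL : ∑' n : ℕ, (((ArithmeticFunction.moebius n : ℝ) * (n : ℝ) ^ (-2 : ℝ) : ℝ) : ℂ) *
      (n * ∑' d : ℕ, w (n * (d + 1))) = ∑' p, f p := by
    rw [hsum.tsum_prod]
    refine tsum_congr fun n => ?_
    rcases eq_or_ne n 0 with rfl | hn
    · simp [f]
    have hn' : (n : ℂ) ≠ 0 := by exact_mod_cast hn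
    rw [(hsum.prod_factor n).tsum_eq_zero_add, ← mul_assoc, ← tsum_mul_left]
    simp only [f, mul_zero, Nat.mul_eq_zero, hn, Nat.add_one_ne_zero, or_self, or_true, if_true, zero_add,
      if_false]
    refine tsum_congr fun d => ?_
    rw [Real.rpow_neg (Nat.cast_nonneg n), show (2 : ℝ) = ((2 : ℕ) : ℝ) by norm_num,
      Real.rpow_natCast]
    push_cast
    field_simp
  have hfib := (hsum.hasSum.tsum_fiberwise (fun p : ℕ × ℕ => p.1 * p.2)).tsum_eq
  rw [hL, ← hfib]
  have hk : ∀ k : ℕ, (∑' b : (fun p : ℕ × ℕ => p.1 * p.2) ⁻¹' {k}, f b) =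
      if k = 0 then 0 else (Nat.totient k : ℂ) / k * w k := by
    intro k
    split_ifs with h
    · subst h
      have : ∀ b : (fun p : ℕ × ℕ => p.1 * p.2) ⁻¹' {0}, f b = 0 := fun b => if_pos b.2
      simp_rw [this, tsum_zero]
    · rw [show (fun p : ℕ × ℕ ↦ p.1 * p.2) ⁻¹' {k} = k.divisorsAntidiagonal by ext; simp [h],
        Finset.tsum_subtype' k.divisorsAntidiagonal f]
      -- Möbius inversion of ∑_{d ∣ k} φ(d) = k.
      have h1 := (ArithmeticFunction.sum_eq_iff_sum_mul_moebius_eq (R := ℂ)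
        (f := fun n => (Nat.totient n : ℂ)) (g := fun n => (n : ℂ))).mp
        (fun n _ => by exact_mod_cast Nat.sum_totient n) k (Nat.pos_of_ne_zero h)
      rw [← h1, Finset.sum_div, Finset.sum_mul]
      refine Finset.sum_congr rfl fun p hp => ?_
      have h2 := Nat.ne_zero_of_mem_divisorsAntidiagonal hp
      obtain ⟨h3, -⟩ := Nat.mem_divisorsAntidiagonal.mp hp
      have h4 : (p.1 : ℂ) ≠ 0 := by exact_mod_cast h2.1
      have h5 : (p.2 : ℂ) ≠ 0 := by exact_mod_cast h2.2
      simp only [f, if_neg (h3 ▸ h), h3]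
      rw [← h3]
      push_cast
      field_simp
  simp only [hk]
  rw [← Nat.succ_injective.tsum_eq]
  · simp
  · intro m hm
    rcases Nat.exists_eq_succ_of_ne_zero (n := m) (fun h => by
      subst h
      simp at hm) with ⟨k, rfl⟩
    exact ⟨k, rfl⟩

/-- The regularized Möbius sums over W converge to a sum over w with the weights φ(k)/k, which are
the weights that unfolding produces in the second moment. -/
theorem QuadraticDecay.tendsto_regularized_totient {w W W' : ℝ → ℂ} {C : ℝ}
    (hW : QuadraticDecay W W' C) (hw : Continuous w) (hwc : HasCompactSupport w)
    (hwe : ∀ p, w (-p) = w p) (hWw : 𝓕 w = W) :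
    Tendsto (fun ε : ℝ => ∑' n : ℕ,
        ((ArithmeticFunction.moebius n : ℝ) * (n : ℝ) ^ (-(1 + ε)) : ℝ) *
          ∑' m : ℕ, (((m : ℝ) ^ (-(1 + ε)) : ℝ) : ℂ) *
            ((((m : ℝ) / n : ℝ) : ℂ) * W ((m : ℝ) / n)))
      (𝓝[>] 0)
      (𝓝 (∑' k : ℕ, ((Nat.totient (k + 1) : ℂ) / (k + 1 : ℂ)) * w (k + 1))) := by
  rw [← tsum_moebius_tsum_eq hwc]
  convert hW.tendsto_regularized using 3
  funext n
  rcases eq_or_ne n 0 with rfl | hn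
  · simp
  · rw [hW.dilatedSum_zero_sub hw hwc hwe hWw hn]

end RegularizedLimit

end SiegelVeech

namespace SiegelVeech

/-! ### Integration over ℍ and the fundamental domain of SL₂(ℤ) -/

section Unfolding

open Filter Topology ENNReal ModularGroup
open scoped Modular

theorem lintegral_upperHalfPlane (F : ℂ → ℝ≥0∞) (hF : Measurable F) :
    ∫⁻ τ : ℍ, F τ = ∫⁻ y in Set.Ioi (0 : ℝ), ∫⁻ x : ℝ,
      ENNReal.ofReal ((y ^ 2)⁻¹) * F (x + y * Complex.I) := by
  have hmp : MeasurePreserving UpperHalfPlane.coe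
      ((volume : Measure ℂ).comap UpperHalfPlane.coe)
      (volume.restrict (.range UpperHalfPlane.coe)) :=
    ⟨UpperHalfPlane.measurable_coe, by rw [UpperHalfPlane.measurableEmbedding_coe.map_comap]⟩
  have hrange : Set.range UpperHalfPlane.coe = {z : ℂ | 0 < z.im} := by
    ext z
    exact ⟨fun ⟨τ, h⟩ => h ▸ τ.im_pos, fun h => ⟨⟨z, h⟩, rfl⟩⟩
  have hmeas : MeasurableSet {z : ℂ | 0 < z.im} :=
    measurableSet_lt measurable_const Complex.measurable_im
  rw [UpperHalfPlane.volume_def, lintegral_withDensity_eq_lintegral_mul₀]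
  · have h1 : ∀ τ : ℍ, ((↑((1 / NNReal.mk τ.im τ.im_pos.le : NNReal) ^ 2) : ℝ≥0∞)) * F τ =
        (fun z : ℂ => ENNReal.ofReal ((z.im ^ 2)⁻¹) * F z) τ := by
      intro τ
      simp only
      congr 1
      rw [ENNReal.ofReal, ENNReal.coe_inj]
      ext
      rw [Real.coe_toNNReal _ (by positivity)]
      simp
    simp only [Pi.mul_apply, h1]
    rw [hmp.lintegral_comp_emb UpperHalfPlane.measurableEmbedding_coe
      (fun z : ℂ => ENNReal.ofReal ((z.im ^ 2)⁻¹) * F z), hrange,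
      ← lintegral_indicator hmeas,
      ← Complex.volume_preserving_equiv_real_prod.symm.lintegral_comp_emb
        Complex.measurableEquivRealProd.symm.measurableEmbedding, Measure.volume_eq_prod,
      lintegral_prod_symm', ← lintegral_indicator measurableSet_Ioi]
    · refine lintegral_congr fun y => ?_
      by_cases hy : 0 < y
      · rw [Set.indicator_of_mem (by exact hy)]
        refine lintegral_congr fun x => ?_
        rw [Set.indicator_of_mem (by simpa [Complex.measurableEquivRealProd] using hy)]
        simp only [Complex.measurableEquivRealProd_symm_apply]
        rw [Complex.mk_eq_add_mul_I]
      · rw [Set.indicator_of_notMem (by exact hy)]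
        refine (lintegral_congr fun x => ?_).trans lintegral_zero
        rw [Set.indicator_of_notMem (by simpa [Complex.measurableEquivRealProd] using hy)]
    · refine (Measurable.indicator ?_ hmeas).comp (MeasurableEquiv.measurable _)
      fun_prop
  · refine Measurable.aemeasurable ?_
    refine measurable_coe_nnreal_ennreal.comp ?_
    refine Measurable.pow_const (Measurable.div measurable_const ?_) _
    exact (UpperHalfPlane.continuous_im.measurable).subtype_mk
  · exact (hF.comp UpperHalfPlane.measurable_coe).aemeasurable

instance : Countable SL(2, ℤ) :=
  inferInstanceAs (Countable {A : Fin 2 → Fin 2 → ℤ // Matrix.det A = 1})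

/-- The boundary lies on the unit circle and the two lines Re = ±1/2. -/
theorem volume_fd_diff_fdo : volume (𝒟 \ 𝒟ᵒ) = 0 := by
  rw [UpperHalfPlane.volume_eq_lintegral]
  refine setLIntegral_measure_zero _ _ ?_
  have hline : ∀ c : ℝ, volume {z : ℂ | z.re = c} = 0 := by
    intro c
    have : {z : ℂ | z.re = c} = Complex.measurableEquivRealProd ⁻¹' ({c} ×ˢ Set.univ) := by
      ext z; simp
    rw [this, Complex.volume_preserving_equiv_real_prod.measure_preimage_equiv,
      Measure.volume_eq_prod, Measure.prod_prod]
    simp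
  refine measure_mono_null (t := Metric.sphere (0 : ℂ) 1 ∪ ({z : ℂ | z.re = 1 / 2} ∪
    {z : ℂ | z.re = -(1 / 2)})) ?_ (measure_union_null (Measure.addHaar_sphere _ _ _)
      (measure_union_null (hline _) (hline _)))
  rintro _ ⟨τ, ⟨⟨h1, h2⟩, h3⟩, rfl⟩
  by_contra hcon
  simp only [Set.mem_union, mem_sphere_zero_iff_norm, Set.mem_ofPred_eq, not_or] at hcon
  refine h3 ⟨lt_of_le_of_ne h1 fun h => hcon.1 ?_, lt_of_le_of_ne h2 fun h => ?_⟩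
  · rw [Complex.normSq_eq_norm_sq] at h
    have := norm_nonneg (τ : ℂ)
    nlinarith
  · rcases (abs_eq (by norm_num)).mp h with h | h
    · exact hcon.2.1 h
    · exact hcon.2.2 h

/-- Off the countably many translates of the boundary, τ is moved into the open domain by some g,
and then only by g and -g. The value is 2 and not 1 because -1 acts trivially on ℍ. -/
theorem tsum_indicator_fd_ae : ∀ᵐ τ : ℍ, ∑' γ : SL(2, ℤ), Set.indicator 𝒟 (1 : ℍ → ℝ≥0∞) (γ⁻¹ • τ) = 2 := by
  have hnull : ∀ γ : SL(2, ℤ), ∀ᵐ τ : ℍ, γ • τ ∉ 𝒟 \ 𝒟ᵒ := by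
    intro γ
    have h := (measurePreserving_smul (γ : GL (Fin 2) ℝ) (volume : Measure ℍ)).quasiMeasurePreserving
    exact h.ae (p := fun τ => τ ∉ 𝒟 \ 𝒟ᵒ) (measure_eq_zero_iff_ae_notMem.mp volume_fd_diff_fdo)
  have : ∀ᵐ τ : ℍ, ∀ γ : SL(2, ℤ), γ • τ ∉ 𝒟 \ 𝒟ᵒ := ae_all_iff.mpr hnull
  filter_upwards [this] with τ hτ
  obtain ⟨g, hg⟩ := exists_smul_mem_fd τ
  have hgo : g • τ ∈ 𝒟ᵒ := by
    by_contra h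
    exact hτ g ⟨hg, h⟩
  have hne : g⁻¹ ≠ (-g)⁻¹ := by
    intro h
    have h1 : g = -g := inv_injective h
    have h2 : (g : Matrix (Fin 2) (Fin 2) ℤ) = -g := congrArg Subtype.val h1
    have h3 := g.2
    have h4 : (g : Matrix (Fin 2) (Fin 2) ℤ) = 0 := by
      ext i j
      have := congrFun (congrFun h2 i) j
      simp only [Matrix.neg_apply] at this
      simp only [Matrix.zero_apply]
      omega
    rw [h4] at h3
    simp at h3
  rw [tsum_eq_sum (s := {g⁻¹, (-g)⁻¹})]
  · rw [Finset.sum_pair hne, inv_inv, inv_inv, Set.indicator_of_mem hg, Set.indicator_of_mem]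
    · simp only [Pi.one_apply]; norm_num
    · rwa [ModularGroup.SL_neg_smul]
  · intro γ hγ
    refine Set.indicator_of_notMem (fun hmem => hγ ?_) _
    have h1 : (γ⁻¹ * g⁻¹) • (g • τ) ∈ 𝒟 := by
      rwa [mul_smul, inv_smul_smul]
    rcases eq_one_or_neg_one_of_mem_fdo_mem_fd hgo h1 with h | h
    · have : γ⁻¹ = g := by rw [← mul_inv_eq_one, h]
      simp [← this]
    · have : γ⁻¹ = -g := by
        have := congrArg (· * g) h
        simpa using this
      simp [← this]

/-- Almost every point of `ℍ` is covered twice by the `SL₂(ℤ)`-translates of `𝒟`. -/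
theorem setLIntegral_fd_tsum (F : ℍ → ℝ≥0∞) (hF : Measurable F) :
    ∫⁻ τ in 𝒟, ∑' γ : SL(2, ℤ), F (γ • τ) = 2 * ∫⁻ τ, F τ := by
  have hmeasD : MeasurableSet 𝒟 := isClosed_fd.measurableSet
  have hsm : ∀ γ : SL(2, ℤ), MeasurePreserving (fun τ : ℍ => γ • τ) := fun γ =>
    measurePreserving_smul (γ : GL (Fin 2) ℝ) (volume : Measure ℍ)
  have hmF : ∀ γ : SL(2, ℤ), Measurable fun τ : ℍ =>
      Set.indicator 𝒟 (1 : ℍ → ℝ≥0∞) (γ⁻¹ • τ) * F τ := fun γ =>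
    ((measurable_one.indicator hmeasD).comp (hsm γ⁻¹).measurable).mul hF
  rw [lintegral_tsum (f := fun (γ : SL(2, ℤ)) τ => F (γ • τ)) fun γ => (hF.comp (hsm γ).measurable).aemeasurable]
  have h1 : ∀ γ : SL(2, ℤ), ∫⁻ τ in 𝒟, F (γ • τ) =
      ∫⁻ τ, Set.indicator 𝒟 (1 : ℍ → ℝ≥0∞) (γ⁻¹ • τ) * F τ := by
    intro γ
    rw [← lintegral_indicator hmeasD, ← (hsm γ).lintegral_comp (hmF γ)]
    refine lintegral_congr fun τ => ?_
    rw [inv_smul_smul]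
    by_cases h : τ ∈ 𝒟 <;> simp [h]
  simp only [h1]
  rw [← lintegral_tsum fun γ => (hmF γ).aemeasurable, ← lintegral_const_mul _ hF]
  refine lintegral_congr_ae ?_
  filter_upwards [tsum_indicator_fd_ae] with τ hτ
  rw [ENNReal.tsum_mul_right, hτ]

end Unfolding

end SiegelVeech

namespace SiegelVeech

/-! ### Coprime pairs as cosets, and lattice vectors -/

section Unfolding

open Filter Topology ENNReal ModularGroup
open scoped Modular

/-- Coprime pairs of integers. -/
abbrev CoprimePair : Type := {p : ℤ × ℤ // IsCoprime p.1 p.2}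

/-- The bottom row of an element of `SL₂(ℤ)`. -/
def bottomRow (γ : SL(2, ℤ)) : CoprimePair := ⟨(γ 1 0, γ 1 1), bottom_row_coprime γ⟩

/-- The strip `0 ≤ Re τ < 1`. -/
def strip : Set ℍ := {τ | τ.re ∈ Set.Ico (0 : ℝ) 1}

theorem bottomRow_T_zpow_mul (k : ℤ) (γ : SL(2, ℤ)) : bottomRow (T ^ k * γ) = bottomRow γ := by
  apply Subtype.ext
  simp [bottomRow]

theorem exists_eq_T_zpow_mul {γ γ' : SL(2, ℤ)} (h : bottomRow γ' = bottomRow γ) :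
    ∃ k : ℤ, γ' = T ^ k * γ := by
  have h0 : γ' 1 0 = γ 1 0 := congrArg (fun p : CoprimePair => p.1.1) h
  have h1 : γ' 1 1 = γ 1 1 := congrArg (fun p : CoprimePair => p.1.2) h
  have hd : γ 0 0 * γ 1 1 - γ 0 1 * γ 1 0 = 1 := by rw [← Matrix.det_fin_two]; exact γ.2
  have hd' : γ' 0 0 * γ 1 1 - γ' 0 1 * γ 1 0 = 1 := by
    rw [← h0, ← h1, ← Matrix.det_fin_two]; exact γ'.2
  -- The upper right entry of γ' γ⁻¹.
  refine ⟨γ' 0 1 * γ 0 0 - γ' 0 0 * γ 0 1, ?_⟩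
  ext i j
  fin_cases i <;> fin_cases j <;>
    simp only [Matrix.SpecialLinearGroup.coe_mul, coe_T_zpow, Matrix.mul_apply, Fin.sum_univ_two,
      Fin.zero_eta, Fin.mk_one, Matrix.of_apply, Matrix.cons_val', Matrix.cons_val_zero,
      Matrix.cons_val_one, Matrix.cons_val_fin_one, h0, h1, one_mul, zero_mul, zero_add]
  · linear_combination (-γ' 0 0) * hd + γ 0 0 * hd'
  · linear_combination (-γ' 0 1) * hd + γ 0 1 * hd'

/-- The γ with a given bottom row form one coset of the powers of T, and T translates by 1, so
exactly one of them moves τ into the strip. Opposite rows count separately, since the quotient is by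
T alone and not by ±T. -/
theorem tsum_indicator_strip (τ : ℍ) (Ψ : CoprimePair → ℝ≥0∞) :
    ∑' γ : SL(2, ℤ), Set.indicator strip (fun _ => Ψ (bottomRow γ)) (γ • τ) =
      ∑' p : CoprimePair, Ψ p := by
  have hbij : Function.Bijective
      (fun γ : {γ : SL(2, ℤ) // γ • τ ∈ strip} => bottomRow γ.1) := by
    constructor
    · rintro ⟨γ, hγ⟩ ⟨γ', hγ'⟩ h
      obtain ⟨k, hk⟩ := exists_eq_T_zpow_mul (γ := γ') (γ' := γ) h
      have h1 : (γ • τ).re = (γ' • τ).re + k := by rw [hk, mul_smul, re_T_zpow_smul]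
      have h2 : (0 : ℝ) ≤ (γ • τ).re ∧ (γ • τ).re < 1 := hγ
      have h3 : (0 : ℝ) ≤ (γ' • τ).re ∧ (γ' • τ).re < 1 := hγ'
      have h4 : (k : ℝ) < 1 := by linarith
      have h5 : (-1 : ℝ) < k := by linarith
      have h6 : k = 0 := by
        have : k < 1 := by exact_mod_cast h4
        have : -1 < k := by exact_mod_cast h5
        omega
      apply Subtype.ext
      change γ = γ'
      rw [hk, h6, zpow_zero, one_mul]
    · rintro ⟨⟨c, d⟩, hcd⟩
      obtain ⟨g, -, hg⟩ := bottom_row_surj (R := ℤ) (show ![c, d] ∈ {cd : Fin 2 → ℤ | IsCoprime (cd 0) (cd 1)} from hcd)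
      refine ⟨⟨T ^ (-⌊(g • τ).re⌋) * g, ?_⟩, ?_⟩
      · change (0 : ℝ) ≤ _ ∧ _ < (1 : ℝ)
        rw [mul_smul, re_T_zpow_smul]
        push_cast
        constructor
        · linarith [Int.floor_le (g • τ).re]
        · linarith [Int.lt_floor_add_one (g • τ).re]
      · simp only [bottomRow_T_zpow_mul]
        apply Subtype.ext
        have h0 : g 1 0 = c := congrFun hg 0
        have h1 : g 1 1 = d := congrFun hg 1
        simp [bottomRow, h0, h1]
  rw [← (Equiv.ofBijective _ hbij).tsum_eq]
  refine Eq.trans ?_ (tsum_subtype {γ : SL(2, ℤ) | γ • τ ∈ strip}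
    (fun γ => Ψ (bottomRow γ))).symm
  refine tsum_congr fun γ => ?_
  by_cases h : γ • τ ∈ strip
  · rw [Set.indicator_of_mem h, Set.indicator_of_mem (by exact h)]
  · rw [Set.indicator_of_notMem h, Set.indicator_of_notMem (by exact h)]

/-- The row vector `(m, n) g` for `g = n(x) a(√y) k(θ)`, as a complex number. -/
noncomputable def latticeVec (p : ℤ × ℤ) (τ : ℍ) (θ : ℝ) : ℂ :=
  (p.1 * τ + p.2) * (Complex.exp (-(θ * Complex.I)) / √τ.im)

theorem latticeVec_neg (p : ℤ × ℤ) (τ : ℍ) (θ : ℝ) :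
    latticeVec (-p) τ θ = -latticeVec p τ θ := by
  simp [latticeVec]; ring

theorem latticeVec_add_pi (p : ℤ × ℤ) (τ : ℍ) (θ : ℝ) :
    latticeVec p τ (θ + Real.pi) = latticeVec (-p) τ θ := by
  rw [latticeVec_neg, latticeVec, latticeVec]
  rw [Complex.ofReal_add, add_mul (θ : ℂ), neg_add, Complex.exp_add, Complex.exp_neg (Real.pi * Complex.I), Complex.exp_pi_mul_I]
  norm_num
  ring

theorem latticeVec_periodic (p : ℤ × ℤ) (τ : ℍ) (θ : ℝ) :
    latticeVec p τ (θ + 2 * Real.pi) = latticeVec p τ θ := by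
  rw [two_mul, ← add_assoc, latticeVec_add_pi, latticeVec_add_pi, neg_neg]

/-- Right multiplication of a row by `γ`. -/
def rowMul (p : ℤ × ℤ) (γ : SL(2, ℤ)) : ℤ × ℤ :=
  (p.1 * γ 0 0 + p.2 * γ 1 0, p.1 * γ 0 1 + p.2 * γ 1 1)

/-- The automorphy factor j = cτ + d is split in polar form: its modulus is absorbed by the change
of √Im τ, and its argument by a shift of the angle. This is left invariance under SL₂(ℤ) in Iwasawa
coordinates. -/
theorem latticeVec_smul (p : ℤ × ℤ) (γ : SL(2, ℤ)) (τ : ℍ) (θ : ℝ) :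
    latticeVec p (γ • τ) θ =
      latticeVec (rowMul p γ) τ (θ + (UpperHalfPlane.denom γ τ).arg) := by
  have hden : UpperHalfPlane.denom γ τ ≠ 0 := UpperHalfPlane.denom_ne_zero _ _
  set j := UpperHalfPlane.denom γ τ with hj
  have hj' : j = γ 1 0 * τ + γ 1 1 := by rw [hj, denom_apply]
  have hsm : ((γ • τ : ℍ) : ℂ) * j = γ 0 0 * τ + γ 0 1 := by
    rw [UpperHalfPlane.coe_specialLinearGroup_apply]
    simp only [algebraMap_int_eq, eq_intCast, Complex.ofReal_intCast]
    rw [hj', div_mul_cancel₀ _ (hj' ▸ hden)]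
  have him : √(γ • τ).im = √τ.im / ‖j‖ := by
    rw [ModularGroup.im_smul_eq_div_normSq, Complex.normSq_eq_norm_sq, Real.sqrt_div τ.im_pos.le,
      Real.sqrt_sq (norm_nonneg _)]
  have hnorm : (‖j‖ : ℂ) ≠ 0 := by exact_mod_cast norm_ne_zero_iff.mpr hden
  have hexp : Complex.exp (-((θ + j.arg : ℝ) * Complex.I)) * j =
      Complex.exp (-(θ * Complex.I)) * ‖j‖ := by
    conv_lhs => rw [← Complex.norm_mul_exp_arg_mul_I j]
    rw [mul_left_comm, ← Complex.exp_add, mul_comm]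
    congr 2
    push_cast
    rw [Complex.norm_mul_exp_arg_mul_I j]
    ring
  have hs : (√τ.im : ℂ) ≠ 0 := by exact_mod_cast (Real.sqrt_pos.mpr τ.im_pos).ne'
  have hrow : ((rowMul p γ).1 : ℂ) * τ + (rowMul p γ).2 = (p.1 * ((γ • τ : ℍ) : ℂ) + p.2) * j := by
    rw [add_mul, mul_assoc, hsm, hj']
    simp only [rowMul]
    push_cast
    ring
  rw [latticeVec, latticeVec, hrow, him, mul_assoc (_ + _) j, mul_comm j, div_mul_eq_mul_div, hexp]
  push_cast
  field_simp

end Unfolding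

end SiegelVeech

namespace SiegelVeech

/-! ### Unfolding the double sum onto the strip -/

section Unfolding

open Filter Topology ENNReal ModularGroup
open scoped Modular

theorem isCoprime_rowMul {p : ℤ × ℤ} (hp : IsCoprime p.1 p.2) (γ : SL(2, ℤ)) :
    IsCoprime (rowMul p γ).1 (rowMul p γ).2 := by
  obtain ⟨a, b, hab⟩ := hp
  have hdet : γ.1 0 0 * γ.1 1 1 - γ.1 0 1 * γ.1 1 0 = 1 := by
    rw [← Matrix.det_fin_two]; exact γ.2
  refine ⟨a * γ.1 1 1 - b * γ.1 0 1, b * γ.1 0 0 - a * γ.1 1 0, ?_⟩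
  simp only [rowMul]
  linear_combination hab + (a * p.1 + b * p.2) * hdet

theorem rowMul_rowMul_inv (p : ℤ × ℤ) (γ : SL(2, ℤ)) : rowMul (rowMul p γ) γ⁻¹ = p := by
  have hdet : γ.1 0 0 * γ.1 1 1 - γ.1 0 1 * γ.1 1 0 = 1 := by
    rw [← Matrix.det_fin_two]; exact γ.2
  rw [Matrix.SpecialLinearGroup.SL2_inv_expl]
  ext
  · simp [rowMul]
    linear_combination p.1 * hdet
  · simp [rowMul]
    linear_combination p.2 * hdet

/-- Right multiplication by `γ` permutes the coprime pairs. -/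
def rowMulEquiv (γ : SL(2, ℤ)) : CoprimePair ≃ CoprimePair where
  toFun p := ⟨rowMul p.1 γ, isCoprime_rowMul p.2 γ⟩
  invFun p := ⟨rowMul p.1 γ⁻¹, isCoprime_rowMul p.2 γ⁻¹⟩
  left_inv p := Subtype.ext (rowMul_rowMul_inv p.1 γ)
  right_inv p := Subtype.ext (by simpa using rowMul_rowMul_inv p.1 γ⁻¹)

/-- `p ↦ -p` on coprime pairs. -/
def negEquiv : CoprimePair ≃ CoprimePair where
  toFun p := ⟨-p.1, by simpa using p.2.neg_left.neg_right⟩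
  invFun p := ⟨-p.1, by simpa using p.2.neg_left.neg_right⟩
  left_inv p := Subtype.ext (neg_neg _)
  right_inv p := Subtype.ext (neg_neg _)

theorem setLIntegral_add_of_periodic {g : ℝ → ℝ≥0∞} {T : ℝ} (hT : 0 < T)
    (hg : ∀ θ, g (θ + T) = g θ) (a b : ℝ) :
    ∫⁻ θ in Set.Ioc a (a + T), g θ = ∫⁻ θ in Set.Ioc b (b + T), g θ := by
  refine (isAddFundamentalDomain_Ioc hT a).setLIntegral_eq (isAddFundamentalDomain_Ioc hT b) g ?_
  rintro ⟨_, n, rfl⟩ x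
  have := (show Function.Periodic g T from hg).zsmul n x
  rw [add_comm] at this
  exact this

theorem setLIntegral_comp_add_right (g : ℝ → ℝ≥0∞) (T c : ℝ) :
    ∫⁻ θ in Set.Ioc 0 T, g (θ + c) = ∫⁻ θ in Set.Ioc c (c + T), g θ := by
  have h := (measurePreserving_add_right (volume : Measure ℝ) c).setLIntegral_comp_preimage_emb
    (MeasurableEquiv.addRight c).measurableEmbedding g (Set.Ioc c (c + T))
  rw [← h]
  congr 2
  ext x
  simp [add_comm c]

theorem continuous_latticeVec (p : ℤ × ℤ) :
    Continuous fun z : ℍ × ℝ => latticeVec p z.1 z.2 := by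
  refine Continuous.mul ?_ (Continuous.div ?_ ?_ fun z => ?_)
  · have : Continuous fun z : ℍ × ℝ => (z.1 : ℂ) := UpperHalfPlane.continuous_coe.comp continuous_fst
    fun_prop
  · fun_prop
  · exact Complex.continuous_ofReal.comp (UpperHalfPlane.continuous_im.comp continuous_fst).sqrt
  · exact_mod_cast (Real.sqrt_pos.mpr z.1.im_pos).ne'

variable {K : ℂ × ℂ → ℝ≥0∞}

/-- The integral of `∑_q K(v_p, v_q)` over a full circle. -/
noncomputable def circleIntegral (K : ℂ × ℂ → ℝ≥0∞) (p : ℤ × ℤ) (τ : ℍ) : ℝ≥0∞ :=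
  ∫⁻ θ in Set.Ioc 0 (2 * Real.pi),
    ∑' q : CoprimePair, K (latticeVec p τ θ, latticeVec q.1 τ θ)

theorem measurable_kernel_latticeVec (hK : Measurable K) (p : ℤ × ℤ) :
    Measurable fun z : ℍ × ℝ =>
      ∑' q : CoprimePair, K (latticeVec p z.1 z.2, latticeVec q.1 z.1 z.2) :=
  Measurable.tsum fun q => hK.comp
    ((continuous_latticeVec p).prodMk (continuous_latticeVec q.1)).measurable

theorem measurable_circleIntegral (hK : Measurable K) (p : ℤ × ℤ) :
    Measurable (circleIntegral K p) :=
  (measurable_kernel_latticeVec hK p).lintegral_prod_right'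

/-- The angle shift by arg j is invisible on a full circle, and γ only permutes the inner sum. This
is the reason for passing from (0, π] to a full period. -/
theorem circleIntegral_smul (γ : SL(2, ℤ)) (p : ℤ × ℤ) (τ : ℍ) :
    circleIntegral K p (γ • τ) = circleIntegral K (rowMul p γ) τ := by
  set c := (UpperHalfPlane.denom γ τ).arg with hc
  set g : ℝ → ℝ≥0∞ := fun θ =>
    ∑' q : CoprimePair, K (latticeVec (rowMul p γ) τ θ, latticeVec q.1 τ θ) with hg
  have h1 : ∀ θ, ∑' q : CoprimePair, K (latticeVec p (γ • τ) θ, latticeVec q.1 (γ • τ) θ) =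
      g (θ + c) := by
    intro θ
    rw [hg]
    simp only [latticeVec_smul, ← hc]
    exact (rowMulEquiv γ).tsum_eq
      (fun q : CoprimePair => K (latticeVec (rowMul p γ) τ (θ + c), latticeVec q.1 τ (θ + c)))
  have hper : ∀ θ, g (θ + 2 * Real.pi) = g θ := fun θ => by
    simp only [hg, latticeVec_periodic]
  rw [circleIntegral, lintegral_congr h1, setLIntegral_comp_add_right,
    setLIntegral_add_of_periodic Real.two_pi_pos hper c 0, zero_add]
  rfl

/-- Unfolding of the double sum over primitive vectors. -/
theorem lintegral_tsum_tsum_eq_strip (hK : Measurable K) :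
    ∫⁻ τ in 𝒟, ∫⁻ θ in Set.Ioc 0 Real.pi, ∑' p : CoprimePair, ∑' q : CoprimePair,
      K (latticeVec p.1 τ θ, latticeVec q.1 τ θ) = ∫⁻ τ in strip, circleIntegral K (0, 1) τ := by
  have hstrip : MeasurableSet strip := UpperHalfPlane.continuous_re.measurable measurableSet_Ico
  have hsmeas : ∀ (p : ℤ × ℤ) (τ : ℍ), Measurable fun θ : ℝ =>
      ∑' q : CoprimePair, K (latticeVec p τ θ, latticeVec q.1 τ θ) := fun p τ =>
    (measurable_kernel_latticeVec hK p).comp measurable_prodMk_left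
  -- Rotation by π replaces every lattice vector by its negative, which permutes both sums, so the
  -- half circle carries half of the full integral.
  have hhalf : ∀ τ : ℍ, 2 * ∫⁻ θ in Set.Ioc 0 Real.pi, ∑' p : CoprimePair, ∑' q : CoprimePair,
      K (latticeVec p.1 τ θ, latticeVec q.1 τ θ) = ∑' p : CoprimePair, circleIntegral K p.1 τ := by
    intro τ
    set g : ℝ → ℝ≥0∞ := fun θ => ∑' p : CoprimePair, ∑' q : CoprimePair,
      K (latticeVec p.1 τ θ, latticeVec q.1 τ θ) with hg
    have hper : ∀ θ, g (θ + Real.pi) = g θ := by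
      intro θ
      simp only [hg, latticeVec_add_pi]
      rw [← negEquiv.tsum_eq fun p : CoprimePair => ∑' q : CoprimePair,
        K (latticeVec p.1 τ θ, latticeVec q.1 τ θ)]
      refine tsum_congr fun p => ?_
      exact negEquiv.tsum_eq fun q : CoprimePair =>
        K (latticeVec (negEquiv p).1 τ θ, latticeVec q.1 τ θ)
    have h1 := setLIntegral_add_of_periodic Real.pi_pos hper Real.pi 0
    rw [zero_add, ← two_mul] at h1
    have hu : Set.Ioc 0 (2 * Real.pi) = Set.Ioc 0 Real.pi ∪ Set.Ioc Real.pi (2 * Real.pi) :=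
      (Set.Ioc_union_Ioc_eq_Ioc Real.pi_pos.le (by linarith [Real.pi_pos])).symm
    simp only [circleIntegral]
    rw [← lintegral_tsum fun p : CoprimePair => (hsmeas p.1 τ).aemeasurable,
      hu, lintegral_union measurableSet_Ioc (Set.Ioc_disjoint_Ioc_of_le le_rfl), two_mul (lintegral _ _)]
    exact congrArg _ h1.symm
  -- The factor 2 from completing the circle meets the factor 2 from the double covering by
  -- translates of 𝒟. The pair (0, 1) appears because (0, 1)γ is the bottom row of γ.
  have h2 : 2 * ∫⁻ τ in 𝒟, ∫⁻ θ in Set.Ioc 0 Real.pi, ∑' p : CoprimePair, ∑' q : CoprimePair,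
      K (latticeVec p.1 τ θ, latticeVec q.1 τ θ) = 2 * ∫⁻ τ in strip, circleIntegral K (0, 1) τ := by
    rw [← lintegral_const_mul']
    · simp only [hhalf]
      rw [← lintegral_indicator hstrip,
        ← setLIntegral_fd_tsum _ ((measurable_circleIntegral hK _).indicator hstrip)]
      refine lintegral_congr fun τ => ?_
      rw [← tsum_indicator_strip τ]
      refine tsum_congr fun γ => ?_
      by_cases h : γ • τ ∈ strip
      · rw [Set.indicator_of_mem h, Set.indicator_of_mem h, circleIntegral_smul]
        simp [rowMul, bottomRow]
      · rw [Set.indicator_of_notMem h, Set.indicator_of_notMem h]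
    · simp
  exact (ENNReal.mul_right_inj two_ne_zero ofNat_ne_top).mp h2

end Unfolding

end SiegelVeech

namespace SiegelVeech

/-! ### The constant term along a horocycle -/

section Unfolding

open Filter Topology ENNReal ModularGroup
open scoped Modular

theorem lintegral_eq_tsum_Ico (g : ℝ → ℝ≥0∞) :
    ∫⁻ x, g x = ∑' q : ℤ, ∫⁻ x in Set.Ico (0 : ℝ) 1, g (x + q) := by
  rw [← setLIntegral_univ, ← iUnion_Ico_intCast ℝ,
    lintegral_iUnion (fun _ => measurableSet_Ico) (Set.pairwise_disjoint_Ico_intCast ℝ)]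
  refine tsum_congr fun q => ?_
  have h := (measurePreserving_add_right (volume : Measure ℝ) (q : ℝ)).setLIntegral_comp_preimage_emb
    (MeasurableEquiv.addRight (q : ℝ)).measurableEmbedding g (Set.Ico (q : ℝ) (q + 1))
  rw [← h]
  congr 2
  ext x
  simp [add_comm (q : ℝ)]

theorem lintegral_comp_mul_add {g : ℝ → ℝ≥0∞} (hg : Measurable g) {a : ℝ} (ha : a ≠ 0) (b : ℝ) :
    ∫⁻ x, g (a * x + b) = ENNReal.ofReal |a⁻¹| * ∫⁻ x, g x := by
  have h1 := lintegral_map (μ := volume) (f := fun x => g (x + b)) (g := fun x : ℝ => a * x)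
    (hg.comp (measurable_add_const b)) (measurable_const_mul a)
  rw [← h1, Real.map_volume_mul_left ha, lintegral_smul_measure, smul_eq_mul,
    lintegral_add_right_eq_self]

/-- Write n = qm + r. For each of the φ(m) residues r prime to m, the sum over q glues the unit
intervals to the whole line, and the scaling x ↦ mx + r contributes 1/m. This is the source of the
weights φ(m)/m. -/
theorem tsum_coprime_lintegral {g : ℝ → ℝ≥0∞} (hg : Measurable g) (m : ℕ) [NeZero m] :
    ∑' n : ℤ, (if IsCoprime (m : ℤ) n then ∫⁻ x in Set.Ico (0 : ℝ) 1, g (m * x + n) else 0) =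
      (Nat.totient m : ℝ≥0∞) * (ENNReal.ofReal (m : ℝ)⁻¹ * ∫⁻ x, g x) := by
  have hm : (m : ℝ) ≠ 0 := by exact_mod_cast NeZero.ne m
  rw [← (Int.divModEquiv m).symm.tsum_eq, ENNReal.tsum_prod', ENNReal.tsum_comm]
  have h1 : ∀ r : Fin m, ∑' q : ℤ, (if IsCoprime (m : ℤ) ((Int.divModEquiv m).symm (q, r)) then
      ∫⁻ x in Set.Ico (0 : ℝ) 1, g (m * x + ((Int.divModEquiv m).symm (q, r) : ℤ)) else 0) =
      if Nat.Coprime m r then ENNReal.ofReal (m : ℝ)⁻¹ * ∫⁻ x, g x else 0 := by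
    intro r
    have hc : ∀ q : ℤ, IsCoprime (m : ℤ) ((Int.divModEquiv m).symm (q, r)) ↔ Nat.Coprime m r := by
      intro q
      rw [Int.divModEquiv_symm_apply, ← Nat.isCoprime_iff_coprime, add_comm]
      exact IsCoprime.add_mul_right_right_iff
    simp only [hc]
    split_ifs with h
    · have := lintegral_comp_mul_add hg hm (r : ℝ)
      rw [abs_of_nonneg (by positivity)] at this
      rw [← this, lintegral_eq_tsum_Ico]
      refine tsum_congr fun q => lintegral_congr fun x => ?_
      rw [Int.divModEquiv_symm_apply]
      push_cast
      congr 1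
      ring
    · simp
  rw [tsum_congr h1, tsum_fintype, ← Finset.sum_filter, Finset.sum_const, nsmul_eq_mul]
  congr 2
  rw [Nat.totient_eq_card_coprime]
  refine Finset.card_bij (fun a _ => a.1) (fun a ha => ?_) (fun a _ b _ h => Fin.ext h)
    fun b hb => ?_
  · simpa using ha
  · simp only [Finset.mem_filter, Finset.mem_range] at hb
    exact ⟨⟨b, hb.1⟩, by simpa using hb.2, rfl⟩

/-- `k` summed over `1` and `-1`. -/
def symmSum (k : ℂ → ℝ≥0∞) (z : ℂ) : ℝ≥0∞ := k z + k (-z)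

theorem tsum_coprimePair_eq (F : ℤ × ℤ → ℝ≥0∞) :
    ∑' q : CoprimePair, F q.1 = (F (0, 1) + F (0, -1)) +
      ∑' m : ℕ, ∑' n : ℤ, (if IsCoprime ((m + 1 : ℕ) : ℤ) n then
        F ((m + 1 : ℕ), n) + F (-((m + 1 : ℕ) : ℤ), -n) else 0) := by
  classical
  set G : ℤ → ℝ≥0∞ := fun m => ∑' n : ℤ, if IsCoprime m n then F (m, n) else 0 with hG
  have h1 : ∑' q : CoprimePair, F q.1 = ∑' m : ℤ, G m := by
    rw [hG, ← ENNReal.tsum_prod (f := fun m n => if IsCoprime m n then F (m, n) else 0)]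
    refine (tsum_subtype {p : ℤ × ℤ | IsCoprime p.1 p.2} F).trans ?_
    refine tsum_congr fun p => ?_
    by_cases h : IsCoprime p.1 p.2
    · rw [Set.indicator_of_mem (by exact h), if_pos h]
    · rw [Set.indicator_of_notMem (by exact h), if_neg h]
  have h2 : ∑' m : ℤ, G m = G 0 + (∑' m : ℕ, G (m + 1 : ℕ) + ∑' m : ℕ, G (-((m + 1 : ℕ) : ℤ))) := by
    rw [tsum_of_nat_of_neg_add_one (f := G) ENNReal.summable ENNReal.summable,
      tsum_eq_zero_add' ENNReal.summable]
    simp only [Nat.cast_zero, Nat.cast_add, Nat.cast_one, add_assoc]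
  have h3 : G 0 = F (0, 1) + F (0, -1) := by
    rw [hG]
    simp only [isCoprime_zero_left, Int.isUnit_iff]
    rw [tsum_eq_sum (s := {1, -1})]
    · rw [Finset.sum_pair (by norm_num)]
      simp
    · intro n hn
      rw [if_neg]
      simpa using hn
  rw [h1, h2, h3, ← ENNReal.tsum_add]
  congr 1
  refine tsum_congr fun m => ?_
  have h4 : G (-((m + 1 : ℕ) : ℤ)) = ∑' n : ℤ, if IsCoprime ((m + 1 : ℕ) : ℤ) n then
      F (-((m + 1 : ℕ) : ℤ), -n) else 0 := by
    rw [hG, ← (Equiv.neg ℤ).tsum_eq]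
    refine tsum_congr fun n => ?_
    simp only [Equiv.neg_apply, IsCoprime.neg_left_iff, IsCoprime.neg_right_iff, neg_neg]
  rw [h4, hG, ← ENNReal.tsum_add]
  refine tsum_congr fun n => ?_
  split_ifs <;> simp

/-- The constant term along a closed horocycle. -/
theorem lintegral_horocycle {k : ℂ → ℝ≥0∞} (hk : Measurable k) (y : ℝ) :
    ∫⁻ x in Set.Ico (0 : ℝ) 1, ∑' q : CoprimePair, k (q.1.1 * (x + y * Complex.I) + q.1.2) =
      symmSum k 1 + ∑' m : ℕ, (Nat.totient (m + 1) : ℝ≥0∞) * (ENNReal.ofReal ((m + 1 : ℕ) : ℝ)⁻¹ *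
        ∫⁻ s : ℝ, symmSum k (s + (m + 1 : ℕ) * y * Complex.I)) := by
  have hks : Measurable (symmSum k) := hk.add (hk.comp measurable_neg)
  have hvol : ∫⁻ _ in Set.Ico (0 : ℝ) 1, (symmSum k 1) = symmSum k 1 := by simp
  have hterm : ∀ m : ℕ, ∀ n : ℤ, Measurable fun x : ℝ =>
      if IsCoprime ((m + 1 : ℕ) : ℤ) n then
        symmSum k ((((m + 1 : ℕ) : ℝ) * x + n : ℝ) + (m + 1 : ℕ) * y * Complex.I) else 0 := by
    intro m n
    split_ifs
    · exact hks.comp (by fun_prop)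
    · fun_prop
  have e1 : ∀ x : ℝ, ∑' q : CoprimePair, k (q.1.1 * (x + y * Complex.I) + q.1.2) =
      symmSum k 1 + ∑' m : ℕ, ∑' n : ℤ, (if IsCoprime ((m + 1 : ℕ) : ℤ) n then
        symmSum k ((((m + 1 : ℕ) : ℝ) * x + n : ℝ) + (m + 1 : ℕ) * y * Complex.I) else 0) := by
    intro x
    rw [tsum_coprimePair_eq fun q : ℤ × ℤ => k (q.1 * (x + y * Complex.I) + q.2)]
    congr 1
    · simp [symmSum]
    · refine tsum_congr fun m => tsum_congr fun n => ?_
      congr 1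
      simp only [symmSum]
      congr 2
      · push_cast; ring
      · push_cast; ring
  simp only [e1]
  rw [lintegral_add_left measurable_const, hvol, lintegral_tsum fun m =>
    (Measurable.tsum fun n => hterm m n).aemeasurable]
  congr 1
  refine tsum_congr fun m => ?_
  rw [lintegral_tsum fun n => (hterm m n).aemeasurable]
  have : Measurable fun s : ℝ => symmSum k (s + (m + 1 : ℕ) * y * Complex.I) :=
    hks.comp (by fun_prop)
  rw [← tsum_coprime_lintegral this (m + 1)]
  refine tsum_congr fun n => ?_
  split_ifs
  · rfl
  · simp

end Unfolding

end SiegelVeech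

namespace SiegelVeech

/-! ### From the strip to the plane: the second moment formula -/

section Unfolding

open Filter Topology ENNReal ModularGroup
open scoped Modular

/-- Substitution y = r⁻², where r = 1/√y is the length of the lattice vector of (0, 1); dy/y²
becomes 2r dr. -/
theorem lintegral_Ioi_inv_sq (h : ℝ → ℝ≥0∞) :
    ∫⁻ y in Set.Ioi (0 : ℝ), ENNReal.ofReal ((y ^ 2)⁻¹) * h y =
      ∫⁻ r in Set.Ioi (0 : ℝ), 2 * (ENNReal.ofReal r * h ((r ^ 2)⁻¹)) := by
  have himg : (fun r : ℝ => (r ^ 2)⁻¹) '' Set.Ioi 0 = Set.Ioi 0 := by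
    ext y
    constructor
    · rintro ⟨r, hr, rfl⟩
      have : (0 : ℝ) < r := hr
      change (0 : ℝ) < (r ^ 2)⁻¹
      positivity
    · intro hy
      have hy' : (0 : ℝ) < y := hy
      refine ⟨√(y⁻¹), Real.sqrt_pos.mpr (by positivity), ?_⟩
      beta_reduce
      rw [Real.sq_sqrt (by positivity), inv_inv]
  conv_lhs => rw [← himg]
  rw [lintegral_image_eq_lintegral_abs_deriv_mul measurableSet_Ioi
    (f' := fun r => -(2 * r) / (r ^ 2) ^ 2)]
  · refine setLIntegral_congr_fun measurableSet_Ioi fun r hr => ?_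
    have hr' : (0 : ℝ) < r := hr
    rw [← mul_assoc, ← mul_assoc, ← ENNReal.ofReal_mul (abs_nonneg _),
      ← ENNReal.ofReal_ofNat, ← ENNReal.ofReal_mul (by norm_num)]
    congr 2
    rw [abs_div, abs_neg, abs_of_pos (by positivity), abs_of_pos (by positivity)]
    field_simp
  · intro r hr
    have hr' : (0 : ℝ) < r := hr
    have := (hasDerivAt_pow 2 r).inv (by positivity)
    refine (this.congr_deriv ?_).hasDerivWithinAt
    simp
  · intro a ha b hb hab
    have ha' : (0 : ℝ) < a := ha
    have hb' : (0 : ℝ) < b := hb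
    simp only [inv_inj] at hab
    exact (pow_left_inj₀ ha'.le hb'.le two_ne_zero).mp hab

theorem setLIntegral_Ioo_neg_pi_pi {g : ℝ → ℝ≥0∞} (hg : ∀ θ, g (θ + 2 * Real.pi) = g θ) :
    ∫⁻ θ in Set.Ioo (-Real.pi) Real.pi, g θ = ∫⁻ θ in Set.Ioc 0 (2 * Real.pi), g (-θ) := by
  have h1 : ∫⁻ θ in Set.Ioo (-Real.pi) Real.pi, g θ =
      ∫⁻ θ in Set.Ioo (-Real.pi) Real.pi, g (-θ) := by
    rw [← lintegral_indicator measurableSet_Ioo, ← lintegral_indicator measurableSet_Ioo,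
      ← lintegral_neg_eq_self]
    refine lintegral_congr fun θ => ?_
    by_cases h : θ ∈ Set.Ioo (-Real.pi) Real.pi
    · rw [Set.indicator_of_mem h, Set.indicator_of_mem]
      exact ⟨by linarith [h.2], by linarith [h.1]⟩
    · rw [Set.indicator_of_notMem h, Set.indicator_of_notMem]
      exact fun h' => h ⟨by linarith [h'.2], by linarith [h'.1]⟩
  have hper : ∀ θ, g (-(θ + 2 * Real.pi)) = g (-θ) := fun θ => by
    rw [← hg (-(θ + 2 * Real.pi))]; congr 1; ring
  have h2 := setLIntegral_add_of_periodic (g := fun θ => g (-θ)) Real.two_pi_pos hper (-Real.pi) 0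
  rw [h1, setLIntegral_congr Ioo_ae_eq_Ioc]
  rw [zero_add, show -Real.pi + 2 * Real.pi = Real.pi by ring] at h2
  exact h2

/-- As y and θ vary, the vector e^{-iθ}/√y of the pair (0, 1) sweeps the punctured plane once, and
dy dθ / y² is twice Lebesgue measure. -/
theorem lintegral_polar {R : ℂ → ℝ≥0∞} (hR : Measurable R) :
    ∫⁻ y in Set.Ioi (0 : ℝ), ENNReal.ofReal ((y ^ 2)⁻¹) *
      ∫⁻ θ in Set.Ioc 0 (2 * Real.pi), R (Complex.exp (-(θ * Complex.I)) / √y) =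
      2 * ∫⁻ u : ℂ, R u := by
  rw [lintegral_Ioi_inv_sq, lintegral_const_mul' _ _ (by simp), ← Complex.lintegral_comp_polarCoord_symm,
    polarCoord_target, Measure.volume_eq_prod, ← Measure.prod_restrict, lintegral_prod]
  · congr 1
    refine setLIntegral_congr_fun measurableSet_Ioi fun r hr => ?_
    have hr' : (0 : ℝ) < r := hr
    simp only [smul_eq_mul]
    rw [lintegral_const_mul' _ _ (by simp)]
    congr 1
    rw [setLIntegral_Ioo_neg_pi_pi]
    · refine lintegral_congr fun θ => ?_
      congr 1
      rw [Complex.polarCoord_symm_apply, Real.sqrt_inv, Real.sqrt_sq hr'.le]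
      simp only [Complex.ofReal_inv, div_inv_eq_mul]
      rw [Complex.ofReal_cos, Complex.ofReal_sin, ← Complex.exp_mul_I, Complex.ofReal_neg, neg_mul,
        mul_comm]
    · intro θ
      simp [Complex.polarCoord_symm_apply]
  · refine Measurable.aemeasurable ?_
    simp only [Complex.polarCoord_symm_apply]
    have h1 : Measurable fun p : ℝ × ℝ => (p.1 : ℂ) * (Real.cos p.2 + Real.sin p.2 * Complex.I) := by
      fun_prop
    exact Measurable.smul (ENNReal.measurable_ofReal.comp measurable_fst) (hR.comp h1)

variable {K : ℂ × ℂ → ℝ≥0∞}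

/-- The inner integral in the second moment formula. -/
noncomputable def rogersDensity (K : ℂ × ℂ → ℝ≥0∞) (u : ℂ) : ℝ≥0∞ :=
  symmSum (fun z => K (u, z * u)) 1 + ∑' m : ℕ, (Nat.totient (m + 1) : ℝ≥0∞) *
    (ENNReal.ofReal ((m + 1 : ℕ) : ℝ)⁻¹ *
      ∫⁻ s : ℝ, symmSum (fun z => K (u, z * u))
        (s + (m + 1 : ℕ) * ((‖u‖ ^ 2)⁻¹ : ℝ) * Complex.I))

theorem measurable_rogersDensity (hK : Measurable K) : Measurable (rogersDensity K) := by
  refine Measurable.add ?_ (Measurable.tsum fun m => Measurable.const_mul (Measurable.const_mul ?_ _) _)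
  · exact Measurable.add (hK.comp (by fun_prop)) (hK.comp (by fun_prop))
  · have : Measurable fun z : ℂ × ℝ => symmSum (fun w => K (z.1, w * z.1))
        (z.2 + (m + 1 : ℕ) * ((‖z.1‖ ^ 2)⁻¹ : ℝ) * Complex.I) :=
      Measurable.add (hK.comp (by fun_prop)) (hK.comp (by fun_prop))
    exact this.lintegral_prod_right'

/-- The second moment of the Siegel--Veech transform. -/
theorem lintegral_tsum_tsum (hK : Measurable K) :
    ∫⁻ τ in 𝒟, ∫⁻ θ in Set.Ioc 0 Real.pi, ∑' p : CoprimePair, ∑' q : CoprimePair,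
      K (latticeVec p.1 τ θ, latticeVec q.1 τ θ) = 2 * ∫⁻ u : ℂ, rogersDensity K u := by
  have hstrip : MeasurableSet strip := UpperHalfPlane.continuous_re.measurable measurableSet_Ico
  set u : ℝ → ℝ → ℂ := fun y θ => Complex.exp (-(θ * Complex.I)) / √y with hu
  have hum : Measurable fun z : ℝ × ℝ => u z.1 z.2 := by
    simp only [hu]
    fun_prop
  set k : ℝ × ℝ × ℝ → ℝ≥0∞ := fun z => ∑' q : CoprimePair,
    K (u z.1 z.2.2, (q.1.1 * (z.2.1 + z.1 * Complex.I) + q.1.2) * u z.1 z.2.2) with hk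
  have hkm : Measurable k := by
    have h1 : Measurable fun z : ℝ × ℝ × ℝ => u z.1 z.2.2 :=
      hum.comp (f := fun z : ℝ × ℝ × ℝ => (z.1, z.2.2)) (by fun_prop)
    refine Measurable.tsum fun q => hK.comp (h1.prodMk (Measurable.mul (by fun_prop) h1))
  set F : ℂ → ℝ≥0∞ := Set.indicator {z | z.re ∈ Set.Ico (0 : ℝ) 1}
    (fun z => ∫⁻ θ in Set.Ioc 0 (2 * Real.pi), k (z.im, z.re, θ)) with hF
  have hreset : MeasurableSet {z : ℂ | z.re ∈ Set.Ico (0 : ℝ) 1} :=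
    Complex.measurable_re measurableSet_Ico
  have hFm : Measurable F := by
    refine Measurable.indicator ?_ hreset
    have : Measurable fun z : ℂ × ℝ => k (z.1.im, z.1.re, z.2) := hkm.comp (by fun_prop)
    exact this.lintegral_prod_right'
  rw [lintegral_tsum_tsum_eq_strip hK, ← lintegral_indicator hstrip]
  have h1 : ∀ τ : ℍ, Set.indicator strip (circleIntegral K (0, 1)) τ = F τ := by
    intro τ
    by_cases h : τ ∈ strip
    · rw [Set.indicator_of_mem h, hF, Set.indicator_of_mem (by exact h)]
      refine lintegral_congr fun θ => ?_
      rw [hk]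
      refine tsum_congr fun q => ?_
      have e : ((τ : ℂ).re : ℂ) + ((τ : ℂ).im : ℂ) * Complex.I = τ := Complex.re_add_im _
      simp only [latticeVec, e, hu]
      simp
    · rw [Set.indicator_of_notMem h, hF, Set.indicator_of_notMem (by exact h)]
  rw [lintegral_congr h1, lintegral_upperHalfPlane F hFm, ← lintegral_polar (measurable_rogersDensity hK)]
  refine setLIntegral_congr_fun measurableSet_Ioi fun y hy => ?_
  have hy' : (0 : ℝ) < y := hy
  rw [lintegral_const_mul' _ _ (by simp)]
  congr 1
  have h2 : ∫⁻ x : ℝ, F (x + y * Complex.I) = ∫⁻ x in Set.Ico (0 : ℝ) 1,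
      ∫⁻ θ in Set.Ioc 0 (2 * Real.pi), k (y, x, θ) := by
    rw [← lintegral_indicator measurableSet_Ico]
    refine lintegral_congr fun x => ?_
    by_cases h : x ∈ Set.Ico (0 : ℝ) 1
    · rw [Set.indicator_of_mem h, hF, Set.indicator_of_mem (by simpa using h)]
      simp
    · rw [Set.indicator_of_notMem h, hF, Set.indicator_of_notMem (by simpa using h)]
  rw [h2, lintegral_lintegral_swap]
  · refine lintegral_congr fun θ => ?_
    simp only [hk]
    -- The height is recovered from u alone, so after integrating over the horocycle the integrand
    -- is a function on the plane.
    have hn : (‖u y θ‖ ^ 2)⁻¹ = y := by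
      simp only [hu]
      rw [norm_div, ← neg_mul, ← Complex.ofReal_neg, Complex.norm_exp_ofReal_mul_I, Complex.norm_real,
        Real.norm_of_nonneg (Real.sqrt_nonneg _), div_pow, Real.sq_sqrt hy'.le]
      simp
    rw [lintegral_horocycle (k := fun z => K (u y θ, z * u y θ)) (hK.comp (by fun_prop))]
    rw [rogersDensity]
    simp only [show Complex.exp (-(θ * Complex.I)) / √y = u y θ from rfl, hn]
  · exact (hkm.comp (f := fun z : ℝ × ℝ => (y, z.1, z.2)) (by fun_prop)).aemeasurable

end Unfolding

end SiegelVeech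

namespace SiegelVeech

/-! ### The second moment as a measure on pairs of vectors -/

section Unfolding

open Filter Topology ENNReal ModularGroup
open scoped Modular

/-- The measure on `ℍ × ℝ` whose image in `H(0)` is the Masur--Veech measure. -/
noncomputable def fdMeasure : Measure (ℍ × ℝ) :=
  ((volume : Measure ℍ).restrict ModularGroup.fd).prod
      ((volume : Measure ℝ).restrict (Set.Ioc 0 Real.pi))

/-- The second vector of a pair spanning a lattice of covolume `m + 1` with `u`. -/
noncomputable def pairMap (m : ℕ) (z : ℂ × ℝ) : ℂ × ℂ :=
  (z.1, (z.2 + (m + 1 : ℕ) * ((‖z.1‖ ^ 2)⁻¹ : ℝ) * Complex.I) * z.1)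

theorem measurable_pairMap (m : ℕ) : Measurable (pairMap m) := by
  unfold pairMap
  fun_prop

/-- The measure of pairs of primitive vectors, up to the sign of the second. -/
noncomputable def pairMeasure : Measure (ℂ × ℂ) :=
  (volume : Measure ℂ).map (fun u => (u, u)) + Measure.sum fun m : ℕ =>
    ((Nat.totient (m + 1) : ℝ≥0∞) * ENNReal.ofReal ((m + 1 : ℕ) : ℝ)⁻¹) •
      (volume : Measure (ℂ × ℝ)).map (pairMap m)

theorem lintegral_pairMeasure {K : ℂ × ℂ → ℝ≥0∞} (hK : Measurable K) :
    ∫⁻ z, K z ∂pairMeasure = (∫⁻ u, K (u, u)) + ∑' m : ℕ,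
      ((Nat.totient (m + 1) : ℝ≥0∞) * ENNReal.ofReal ((m + 1 : ℕ) : ℝ)⁻¹) *
        ∫⁻ z : ℂ × ℝ, K (pairMap m z) := by
  rw [pairMeasure, lintegral_add_measure, lintegral_sum_measure,
    lintegral_map hK (by fun_prop)]
  congr 1
  refine tsum_congr fun m => ?_
  rw [lintegral_smul_measure, lintegral_map hK (measurable_pairMap m), smul_eq_mul]

theorem lintegral_rogersDensity {K : ℂ × ℂ → ℝ≥0∞} (hK : Measurable K) :
    ∫⁻ u, rogersDensity K u = ∫⁻ z, K z ∂pairMeasure + ∫⁻ z, K (z.1, -z.2) ∂pairMeasure := by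
  have hK' : Measurable fun z : ℂ × ℂ => K (z.1, -z.2) := hK.comp (by fun_prop)
  have hm : ∀ m, Measurable fun z : ℂ × ℝ => symmSum (fun w => K (z.1, w * z.1))
        (z.2 + (m + 1 : ℕ) * ((‖z.1‖ ^ 2)⁻¹ : ℝ) * Complex.I) := fun m =>
      Measurable.add (hK.comp (by fun_prop)) (hK.comp (by fun_prop))
  rw [lintegral_pairMeasure hK, lintegral_pairMeasure hK', add_add_add_comm, ← ENNReal.tsum_add]
  unfold rogersDensity
  have hterm : ∀ m : ℕ, Measurable fun u : ℂ => (Nat.totient (m + 1) : ℝ≥0∞) *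
    (ENNReal.ofReal ((m + 1 : ℕ) : ℝ)⁻¹ *
      ∫⁻ s : ℝ, symmSum (fun z => K (u, z * u))
        (s + (m + 1 : ℕ) * ((‖u‖ ^ 2)⁻¹ : ℝ) * Complex.I)) := fun m =>
    Measurable.const_mul (Measurable.const_mul (hm m).lintegral_prod_right' _) _
  rw [lintegral_add_right _ (Measurable.tsum hterm), lintegral_tsum fun m => (hterm m).aemeasurable]
  congr 1
  · simp only [symmSum]
    have h1 : Measurable fun u : ℂ => K (u, u) := hK.comp (by fun_prop)
    simp only [one_mul, neg_mul]
    rw [lintegral_add_left h1]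
  · refine tsum_congr fun m => ?_
    have h1 : Measurable fun z => K (pairMap m z) := hK.comp (measurable_pairMap m)
    rw [← mul_add, ← lintegral_add_left h1]
    rw [Measure.volume_eq_prod, lintegral_prod]
    · rw [lintegral_const_mul' _ _ (by simp), lintegral_const_mul' _ _ (by simp), mul_assoc]
      simp only [symmSum, pairMap, neg_mul]
    · exact (Measurable.add (hK.comp (measurable_pairMap m))
        (hK'.comp (measurable_pairMap m))).aemeasurable

theorem lintegral_fdMeasure_tsum {K : ℂ × ℂ → ℝ≥0∞} (hK : Measurable K) :
    ∫⁻ z, ∑' pq : CoprimePair × CoprimePair,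
      K (latticeVec pq.1.1 z.1 z.2, latticeVec pq.2.1 z.1 z.2) ∂fdMeasure =
      2 * (∫⁻ z, K z ∂pairMeasure + ∫⁻ z, K (z.1, -z.2) ∂pairMeasure) := by
  rw [← lintegral_rogersDensity hK, ← lintegral_tsum_tsum hK, fdMeasure, lintegral_prod]
  · refine lintegral_congr fun τ => lintegral_congr fun θ => ?_
    rw [ENNReal.tsum_prod']
  · exact (Measurable.tsum fun pq : CoprimePair × CoprimePair => hK.comp
      ((continuous_latticeVec pq.1.1).prodMk (continuous_latticeVec pq.2.1)).measurable).aemeasurable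

/-- Stating the second moment as an equality of measures transfers it from nonnegative kernels to
integrable complex ones without splitting into parts. -/
theorem sum_map_latticeVec_eq :
    (Measure.sum fun pq : CoprimePair × CoprimePair =>
      fdMeasure.map fun z => (latticeVec pq.1.1 z.1 z.2, latticeVec pq.2.1 z.1 z.2)) =
      (2 : ℝ≥0∞) • (pairMeasure + pairMeasure.map fun z => (z.1, -z.2)) := by
  refine Measure.ext_of_lintegral _ fun K hK => ?_
  rw [lintegral_sum_measure, lintegral_smul_measure, lintegral_add_measure,
    lintegral_map hK (by fun_prop), smul_eq_mul, ← lintegral_fdMeasure_tsum hK, lintegral_tsum]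
  · refine tsum_congr fun pq => ?_
    exact lintegral_map hK
      ((continuous_latticeVec pq.1.1).prodMk (continuous_latticeVec pq.2.1)).measurable
  · exact fun pq => (hK.comp
      ((continuous_latticeVec pq.1.1).prodMk (continuous_latticeVec pq.2.1)).measurable).aemeasurable

/-- The second moment formula for a kernel that is even in the second variable. -/
theorem integral_fdMeasure_tsum {h : ℂ × ℂ → ℂ} (hh : Measurable h)
    (heven : ∀ z, h (z.1, -z.2) = h z) (hi : Integrable h pairMeasure) :
    ∫ z, ∑' pq : CoprimePair × CoprimePair,
      h (latticeVec pq.1.1 z.1 z.2, latticeVec pq.2.1 z.1 z.2) ∂fdMeasure =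
      4 * ((∫ u, h (u, u)) + ∑' m : ℕ, ((Nat.totient (m + 1) : ℂ) / (m + 1 : ℂ)) *
        ∫ z : ℂ × ℝ, h (pairMap m z)) := by
  have hneg : Measurable fun z : ℂ × ℂ => (z.1, -z.2) := by fun_prop
  have hlat : ∀ pq : CoprimePair × CoprimePair, Measurable fun z : ℍ × ℝ =>
      (latticeVec pq.1.1 z.1 z.2, latticeVec pq.2.1 z.1 z.2) := fun pq =>
    ((continuous_latticeVec pq.1.1).prodMk (continuous_latticeVec pq.2.1)).measurable
  have hi2 : Integrable h (pairMeasure.map fun z => (z.1, -z.2)) := by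
    rw [integrable_map_measure hh.aestronglyMeasurable hneg.aemeasurable]
    exact hi.congr (ae_of_all _ fun z => (heven z).symm)
  have hN : Integrable h (Measure.sum fun pq : CoprimePair × CoprimePair =>
      fdMeasure.map fun z => (latticeVec pq.1.1 z.1 z.2, latticeVec pq.2.1 z.1 z.2)) := by
    rw [sum_map_latticeVec_eq]
    exact (hi.add_measure hi2).smul_measure (by simp)
  have e1 : ∫ z, h z ∂pairMeasure = (∫ u, h (u, u)) + ∑' m : ℕ,
      ((Nat.totient (m + 1) : ℂ) / (m + 1 : ℂ)) * ∫ z : ℂ × ℝ, h (pairMap m z) := by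
    have hi' := hi
    unfold pairMeasure at hi'
    obtain ⟨ha, hb⟩ := integrable_add_measure.mp hi'
    rw [pairMeasure, integral_add_measure ha hb, integral_sum_measure hb,
      integral_map (by fun_prop) hh.aestronglyMeasurable]
    congr 1
    refine tsum_congr fun m => ?_
    rw [integral_smul_measure, integral_map (measurable_pairMap m).aemeasurable
      hh.aestronglyMeasurable, ENNReal.toReal_mul, ENNReal.toReal_natCast,
      ENNReal.toReal_ofReal (by positivity), Complex.real_smul]
    push_cast
    rw [div_eq_mul_inv]
  have e2 : ∫ z, h z ∂(pairMeasure.map fun z => (z.1, -z.2)) = ∫ z, h z ∂pairMeasure := by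
    rw [integral_map hneg.aemeasurable hh.aestronglyMeasurable]
    exact integral_congr_ae (ae_of_all _ heven)
  -- The 4 is the 2 of polar coordinates times the two signs of the second vector, which agree by
  -- evenness.
  have e3 : ∫ z, h z ∂(Measure.sum fun pq : CoprimePair × CoprimePair =>
      fdMeasure.map fun z => (latticeVec pq.1.1 z.1 z.2, latticeVec pq.2.1 z.1 z.2)) =
      4 * ∫ z, h z ∂pairMeasure := by
    rw [sum_map_latticeVec_eq, integral_smul_measure, integral_add_measure hi hi2, e2]
    simp only [toReal_ofNat, Complex.real_smul, Complex.ofReal_ofNat]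
    ring
  rw [← e1, ← e3, integral_sum_measure hN, integral_tsum]
  · refine tsum_congr fun pq => ?_
    exact (integral_map (hlat pq).aemeasurable hh.aestronglyMeasurable).symm
  · exact fun pq => (hh.comp (hlat pq)).aestronglyMeasurable
  · have := hN.2.ne
    rw [lintegral_sum_measure] at this
    refine ne_of_eq_of_ne (tsum_congr fun pq => ?_) this
    exact (lintegral_map hh.enorm (hlat pq)).symm

end Unfolding

end SiegelVeech

namespace SiegelVeech

/-! ### The transform in Iwasawa coordinates -/

section Transform

open Filter Topology ENNReal

/-- The identification `(v₀, v₁) ↦ v₁ + i v₀` of the plane with `ℂ`. -/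
noncomputable def planeToComplex : Plane ≃ₗᵢ[ℝ] ℂ :=
  (Complex.orthonormalBasisOneI.reindex (Equiv.swap 0 1)).repr.symm

theorem planeToComplex_apply (v : Plane) : planeToComplex v = v 1 + v 0 * Complex.I := by
  simp [planeToComplex, ← OrthonormalBasis.sum_repr_symm,
    Fin.sum_univ_two, add_comm]

/-- Before rotation the row vector is (m√y, (mx + n)/√y). Exchanging the coordinates turns it into
(mτ + n)/√y, which explains the swap in `planeToComplex`. -/
theorem planeToComplex_rowVec_iwasawa (τ : ℍ) (θ : ℝ) (p : ℤ × ℤ) :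
    planeToComplex (rowVec (iwasawa τ θ) p.1 p.2) = latticeVec p τ θ := by
  have hy : (√τ.im : ℂ) ≠ 0 := by exact_mod_cast (Real.sqrt_pos.mpr τ.im_pos).ne'
  have hyy : (τ : ℂ) = τ.re + √τ.im * √τ.im * Complex.I := by
    rw [← Complex.ofReal_mul, Real.mul_self_sqrt τ.im_pos.le]
    exact (Complex.re_add_im _).symm
  have hexp : Complex.exp (-(θ * Complex.I)) = Complex.cos θ - Complex.sin θ * Complex.I := by
    rw [← neg_mul, Complex.exp_mul_I, Complex.cos_neg, Complex.sin_neg]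
    ring
  rw [planeToComplex_apply, latticeVec, hexp]
  have hI := Complex.I_mul_I
  have hM : (iwasawa τ θ).1 = !![1, τ.re; 0, 1] * !![√τ.im, 0; 0, (√τ.im)⁻¹] *
      !![Real.cos θ, Real.sin θ; -Real.sin θ, Real.cos θ] := rfl
  simp only [rowVec, hM, Matrix.mul_apply, Fin.sum_univ_two, Matrix.of_apply, Matrix.cons_val',
    Matrix.cons_val_zero, Matrix.cons_val_one, Matrix.cons_val_fin_one, PiLp.toLp_apply]
  rw [hyy]
  push_cast
  field_simp
  linear_combination ((p.1 : ℂ) * √τ.im ^ 2 * Complex.sin θ) * hI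

theorem rowVec_injective (g : SL(2, ℝ)) :
    Function.Injective fun p : ℤ × ℤ => rowVec g p.1 p.2 := by
  have hd : g 0 0 * g 1 1 - g 0 1 * g 1 0 = 1 := by rw [← Matrix.det_fin_two]; exact g.2
  intro p q h
  have h0 := congrFun (congrArg (fun v : Plane => (v : Fin 2 → ℝ)) h) 0
  have h1 := congrFun (congrArg (fun v : Plane => (v : Fin 2 → ℝ)) h) 1
  simp [rowVec] at h0 h1
  have e1 : (p.1 : ℝ) = q.1 := by
    linear_combination g 1 1 * h0 - g 1 0 * h1 - ((p.1 : ℝ) - q.1) * hd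
  have e2 : (p.2 : ℝ) = q.2 := by
    linear_combination -g 0 1 * h0 + g 0 0 * h1 - ((p.2 : ℝ) - q.2) * hd
  exact Prod.ext (by exact_mod_cast e1) (by exact_mod_cast e2)

theorem transform_mk (f : Plane → ℂ) (g : SL(2, ℝ)) :
    transform f (H0.mk g) = ∑' p : CoprimePair, f (rowVec g p.1.1 p.1.2) := by
  have hinj : Function.Injective fun p : CoprimePair => rowVec g p.1.1 p.1.2 :=
    (rowVec_injective g).comp Subtype.val_injective
  have hr : primitiveVectors (H0.mk g) = Set.range fun p : CoprimePair => rowVec g p.1.1 p.1.2 := by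
    ext v
    constructor
    · rintro ⟨m, n, h, rfl⟩
      exact ⟨⟨(m, n), h⟩, rfl⟩
    · rintro ⟨⟨⟨m, n⟩, h⟩, rfl⟩
      exact ⟨m, n, h, rfl⟩
  rw [transform, hr, tsum_range f hinj]

/-- The integer row is v g⁻¹, and the entries of g⁻¹ are up to sign those of g because det g = 1.
Uniformity in g yields local finiteness of the sum, hence continuity of the transform. -/
theorem finite_setOf_norm_rowVec_le (c R : ℝ) :
    {p : ℤ × ℤ | ∃ g : SL(2, ℝ), (∀ i j, |g i j| ≤ c) ∧ ‖rowVec g p.1 p.2‖ ≤ R}.Finite := by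
  refine ((Set.finite_Icc (-⌈2 * R * c⌉) ⌈2 * R * c⌉).prod
    (Set.finite_Icc (-⌈2 * R * c⌉) ⌈2 * R * c⌉)).subset ?_
  rintro p ⟨g, hg, hR⟩
  have hd : g 0 0 * g 1 1 - g 0 1 * g 1 0 = 1 := by rw [← Matrix.det_fin_two]; exact g.2
  have hc : 0 ≤ c := (abs_nonneg _).trans (hg 0 0)
  set v := rowVec g p.1 p.2 with hv
  have hv0 : v 0 = p.1 * g 0 0 + p.2 * g 1 0 := by simp [hv, rowVec]
  have hv1 : v 1 = p.1 * g 0 1 + p.2 * g 1 1 := by simp [hv, rowVec]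
  have h0 : |v 0| ≤ R := (PiLp.norm_apply_le v 0).trans hR
  have h1 : |v 1| ≤ R := (PiLp.norm_apply_le v 1).trans hR
  have key : ∀ (x : ℤ) (a b : ℝ), |a| ≤ c → |b| ≤ c → (x : ℝ) = v 0 * a + v 1 * b →
      x ∈ Set.Icc (-⌈2 * R * c⌉) ⌈2 * R * c⌉ := by
    intro x a b ha hb hx
    have h2 : |(x : ℝ)| ≤ 2 * R * c := by
      rw [hx]
      calc |v 0 * a + v 1 * b| ≤ |v 0| * |a| + |v 1| * |b| := by
            rw [← abs_mul, ← abs_mul]; exact abs_add_le _ _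
        _ ≤ R * c + R * c := by gcongr <;> exact (abs_nonneg _).trans h0
        _ = 2 * R * c := by ring
    have h3 : |x| ≤ ⌈2 * R * c⌉ := by
      have := h2.trans (Int.le_ceil _)
      exact_mod_cast this
    exact abs_le.mp h3
  refine ⟨key p.1 (g 1 1) (-g 1 0) (hg _ _) (by rw [abs_neg]; exact hg _ _) ?_,
    key p.2 (-g 0 1) (g 0 0) (by rw [abs_neg]; exact hg _ _) (hg _ _) ?_⟩
  · rw [hv0, hv1]; linear_combination -(p.1 : ℝ) * hd
  · rw [hv0, hv1]; linear_combination -(p.2 : ℝ) * hd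

theorem continuous_entry (i j : Fin 2) : Continuous fun g : SL(2, ℝ) => g i j :=
  (continuous_apply_apply i j).comp continuous_subtype_val

theorem continuous_rowVec (m n : ℤ) : Continuous fun g : SL(2, ℝ) => rowVec g m n := by
  refine (PiLp.continuous_toLp 2 _).comp (continuous_pi fun i => ?_)
  have := continuous_entry
  fin_cases i
  · exact (continuous_const.mul (continuous_entry 0 0)).add
      (continuous_const.mul (continuous_entry 1 0))
  · exact (continuous_const.mul (continuous_entry 0 1)).add
      (continuous_const.mul (continuous_entry 1 1))

theorem locallyFinite_support_rowVec {f : Plane → ℂ} (hs : HasCompactSupport f) :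
    LocallyFinite fun p : CoprimePair =>
      Function.support fun g : SL(2, ℝ) => f (rowVec g p.1.1 p.1.2) := by
  obtain ⟨R, hR⟩ := hs.isBounded.exists_norm_le
  intro g₀
  refine ⟨{g | ∀ i j, |g i j| < (∑ i, ∑ j, |g₀ i j|) + 1}, ?_, ?_⟩
  · simp only [Set.ofPred_forall]
    refine (isOpen_iInter_of_finite fun i => isOpen_iInter_of_finite fun j =>
      isOpen_lt (continuous_entry i j).abs continuous_const).mem_nhds ?_
    simp only [Set.mem_iInter, Set.mem_ofPred_eq]
    intro i j
    have h1 : |g₀ i j| ≤ ∑ j, |g₀ i j| :=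
      Finset.single_le_sum (f := fun j => |g₀ i j|) (fun _ _ => abs_nonneg _) (Finset.mem_univ j)
    have h2 : ∑ j, |g₀ i j| ≤ ∑ i, ∑ j, |g₀ i j| :=
      Finset.single_le_sum (f := fun i => ∑ j, |g₀ i j|)
        (fun _ _ => Finset.sum_nonneg fun _ _ => abs_nonneg _) (Finset.mem_univ i)
    linarith
  · refine ((finite_setOf_norm_rowVec_le ((∑ i, ∑ j, |g₀ i j|) + 1) R).preimage
      Subtype.val_injective.injOn).subset ?_
    rintro p ⟨g, hg, hg'⟩
    exact ⟨g, fun i j => (hg' i j).le, hR _ (subset_tsupport f hg)⟩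

theorem finite_support_rowVec {f : Plane → ℂ} (hs : HasCompactSupport f) (g : SL(2, ℝ)) :
    (Function.support fun p : CoprimePair => f (rowVec g p.1.1 p.1.2)).Finite :=
  (locallyFinite_support_rowVec hs).point_finite g

theorem continuous_transform {f : Plane → ℂ} (hf : Continuous f) (hs : HasCompactSupport f) :
    Continuous (transform f) := by
  refine continuous_coinduced_dom.mpr ?_
  have h1 : transform f ∘ H0.mk = fun g => ∑ᶠ p : CoprimePair, f (rowVec g p.1.1 p.1.2) := by
    funext g
    rw [Function.comp_apply, transform_mk, tsum_eq_finsum (finite_support_rowVec hs g)]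
  change Continuous (transform f ∘ H0.mk)
  rw [h1]
  exact continuous_finsum (fun p => hf.comp (continuous_rowVec _ _)) (locallyFinite_support_rowVec hs)

theorem transform_mk_iwasawa (f : ℂ → ℂ) (τ : ℍ) (θ : ℝ) :
    transform (f ∘ planeToComplex) (H0.mk (iwasawa τ θ)) =
      ∑' p : CoprimePair, f (latticeVec p.1 τ θ) := by
  rw [transform_mk]
  simp only [Function.comp_apply, planeToComplex_rowVec_iwasawa]

theorem finite_support_latticeVec {f : ℂ → ℂ} (hs : HasCompactSupport f) (τ : ℍ) (θ : ℝ) :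
    (Function.support fun p : CoprimePair => f (latticeVec p.1 τ θ)).Finite := by
  have := finite_support_rowVec (f := f ∘ planeToComplex)
    (hs.comp_homeomorph planeToComplex.toHomeomorph) (iwasawa τ θ)
  simpa only [Function.comp_apply, planeToComplex_rowVec_iwasawa] using this

end Transform

end SiegelVeech

namespace SiegelVeech

/-! ### Test functions and the pair correlation -/

section TestFunctions

open Filter Topology ENNReal
open scoped ComplexConjugate

/-- Even test functions of mean zero that are supported away from the origin. -/
structure IsTestFunction (f : ℂ → ℂ) : Prop where
  contDiff : ContDiff ℝ ∞ f
  hasCompactSupport : HasCompactSupport f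
  zero_notMem : (0 : ℂ) ∉ tsupport f
  even : ∀ v, f (-v) = f v
  integral_eq_zero : ∫ v, f v = 0

variable {f : ℂ → ℂ}

theorem IsTestFunction.continuous (hf : IsTestFunction f) : Continuous f := hf.contDiff.continuous

theorem IsTestFunction.exists_bounds (hf : IsTestFunction f) :
    ∃ δ > 0, ∃ R > 0, ∀ v, f v ≠ 0 → δ ≤ ‖v‖ ∧ ‖v‖ ≤ R := by
  obtain ⟨R, hR0, hR⟩ := hf.hasCompactSupport.isBounded.exists_pos_norm_le
  obtain ⟨δ, hδ, hball⟩ := Metric.isOpen_iff.mp (isClosed_tsupport f).isOpen_compl 0 hf.zero_notMem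
  refine ⟨δ, hδ, R, hR0, fun v hv => ⟨?_, hR v (subset_tsupport f hv)⟩⟩
  by_contra! h
  exact hball (by simpa using h) (subset_tsupport f hv)

/-- The integrand of the pair correlation function. -/
noncomputable def corrKernel (f : ℂ → ℂ) (p : ℝ) (z : ℂ × ℝ) : ℂ :=
  conj (f z.1) * f ((z.2 + p * ((‖z.1‖ ^ 2)⁻¹ : ℝ) * Complex.I) * z.1)

/-- The correlation of `f` over pairs of vectors spanning a parallelogram of signed area `p`. -/
noncomputable def pairCorrelation (f : ℂ → ℂ) (p : ℝ) : ℂ := ∫ z, corrKernel f p z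

/-- With u bounded away from 0 and both vectors bounded, these inequalities confine s and the area
p, so the correlation kernel has compact support. -/
theorem norm_pair_bounds {u : ℂ} (hu : u ≠ 0) (s p : ℝ) :
    |s| * ‖u‖ ≤ ‖(s + p * ((‖u‖ ^ 2)⁻¹ : ℝ) * Complex.I) * u‖ ∧
      |p| ≤ ‖(s + p * ((‖u‖ ^ 2)⁻¹ : ℝ) * Complex.I) * u‖ * ‖u‖ := by
  have hu' : 0 < ‖u‖ := norm_pos_iff.mpr hu
  set w : ℂ := s + p * ((‖u‖ ^ 2)⁻¹ : ℝ) * Complex.I with hw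
  have hre : w.re = s := by simp [hw, ← Complex.ofReal_mul, -Complex.ofReal_inv, -Complex.ofReal_pow]
  have him : w.im = p * (‖u‖ ^ 2)⁻¹ := by
    simp [hw, ← Complex.ofReal_mul, -Complex.ofReal_inv, -Complex.ofReal_pow]
  rw [norm_mul]
  constructor
  · rw [← hre]
    gcongr
    exact Complex.abs_re_le_norm w
  · have h1 := Complex.abs_im_le_norm w
    rw [him, abs_mul, abs_of_pos (by positivity : (0 : ℝ) < (‖u‖ ^ 2)⁻¹)] at h1
    calc |p| = |p| * (‖u‖ ^ 2)⁻¹ * ‖u‖ * ‖u‖ := by field_simp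
      _ ≤ ‖w‖ * ‖u‖ * ‖u‖ := by gcongr

/-- The only singularity, ‖u‖⁻² at u = 0, is harmless because `f` vanishes near the origin. -/
theorem IsTestFunction.continuous_corrKernel (hf : IsTestFunction f) :
    Continuous fun z : ℝ × ℂ × ℝ => corrKernel f z.1 z.2 := by
  obtain ⟨δ, hδ, R, hR, hb⟩ := hf.exists_bounds
  have hfc := hf.continuous
  refine continuous_iff_continuousAt.mpr fun z => ?_
  by_cases h : z.2.1 = 0
  · have : (fun z : ℝ × ℂ × ℝ => corrKernel f z.1 z.2) =ᶠ[𝓝 z] fun _ => 0 := by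
      have h1 : ∀ᶠ y : ℝ × ℂ × ℝ in 𝓝 z, ‖y.2.1‖ < δ := by
        have hc : Continuous fun y : ℝ × ℂ × ℝ => ‖y.2.1‖ := by fun_prop
        exact hc.continuousAt.eventually_lt continuousAt_const (by simpa [h] using hδ)
      filter_upwards [h1] with y hy
      have : f y.2.1 = 0 := by
        by_contra h2
        exact absurd (hb _ h2).1 (not_le.mpr hy)
      simp [corrKernel, this]
    exact continuousAt_const.congr this.symm
  · unfold corrKernel
    have h2 : ContinuousAt (fun y : ℝ × ℂ × ℝ => ((‖y.2.1‖ ^ 2)⁻¹ : ℝ)) z :=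
      ContinuousAt.inv₀ (by fun_prop) (by simpa using h)
    have h3 : ContinuousAt (fun y : ℝ × ℂ × ℝ => (((‖y.2.1‖ ^ 2)⁻¹ : ℝ) : ℂ)) z :=
      Complex.continuous_ofReal.continuousAt.comp h2
    have h4 : Continuous fun y : ℝ × ℂ × ℝ => conj (f y.2.1) :=
      Complex.continuous_conj.comp (hfc.comp (by fun_prop))
    refine h4.continuousAt.mul (hfc.continuousAt.comp ?_)
    refine ContinuousAt.mul (ContinuousAt.add (by fun_prop) (ContinuousAt.mul (ContinuousAt.mul (by fun_prop) h3) (by fun_prop))) (by fun_prop)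

/-- The kernel is supported in a fixed compact set. -/
theorem IsTestFunction.exists_corrKernel_support (hf : IsTestFunction f) :
    ∃ A > 0, ∀ p z, corrKernel f p z ≠ 0 → |p| ≤ A ∧ z ∈ Metric.closedBall (0 : ℂ) A ×ˢ
      Metric.closedBall (0 : ℝ) A := by
  obtain ⟨δ, hδ, R, hR, hb⟩ := hf.exists_bounds
  -- R bounds |u|, R * R bounds the area |p|, and R / δ bounds |s|.
  refine ⟨R + R * R + R / δ, by positivity, fun p z hz => ?_⟩
  rw [corrKernel] at hz
  have h1 := hb _ ((map_ne_zero_iff _ (starRingEnd ℂ).injective).mp (left_ne_zero_of_mul hz))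
  have h2 := hb _ (right_ne_zero_of_mul hz)
  have hz1 : z.1 ≠ 0 := norm_pos_iff.mp (hδ.trans_le h1.1)
  obtain ⟨h3, h4⟩ := norm_pair_bounds hz1 z.2 p
  have e1 : |p| ≤ R * R := h4.trans (mul_le_mul h2.2 h1.2 (norm_nonneg _) hR.le)
  have e2 : |z.2| ≤ R / δ := by
    rw [le_div_iff₀ hδ]
    exact (mul_le_mul_of_nonneg_left h1.1 (abs_nonneg _)).trans (h3.trans h2.2)
  have p1 : 0 < R * R := by positivity
  have p2 : 0 < R / δ := by positivity
  refine ⟨by linarith, ?_, ?_⟩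
  · simp only [mem_closedBall_zero_iff]
    linarith [h1.2]
  · simp only [mem_closedBall_zero_iff, Real.norm_eq_abs]
    linarith

theorem IsTestFunction.continuous_pairCorrelation (hf : IsTestFunction f) :
    Continuous (pairCorrelation f) := by
  obtain ⟨A, hA, hs⟩ := hf.exists_corrKernel_support
  have hK : IsCompact (Metric.closedBall (0 : ℂ) A ×ˢ Metric.closedBall (0 : ℝ) A) :=
    (isCompact_closedBall 0 A).prod (isCompact_closedBall 0 A)
  have h1 : pairCorrelation f = fun p => ∫ z in Metric.closedBall (0 : ℂ) A ×ˢ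
      Metric.closedBall (0 : ℝ) A, corrKernel f p z := by
    funext p
    refine (setIntegral_eq_integral_of_forall_compl_eq_zero fun z hz => ?_).symm
    by_contra h
    exact hz (hs p z h).2
  rw [h1]
  exact continuous_parametric_integral_of_continuous hf.continuous_corrKernel hK

theorem IsTestFunction.pairCorrelation_eq_zero (hf : IsTestFunction f) :
    ∃ A > 0, ∀ p, A < |p| → pairCorrelation f p = 0 := by
  obtain ⟨A, hA, hs⟩ := hf.exists_corrKernel_support
  refine ⟨A, hA, fun p hp => ?_⟩
  have : ∀ z, corrKernel f p z = 0 := fun z => by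
    by_contra h
    exact absurd (hs p z h).1 (not_le.mpr hp)
  simp [pairCorrelation, this]

theorem IsTestFunction.hasCompactSupport_pairCorrelation (hf : IsTestFunction f) :
    HasCompactSupport (pairCorrelation f) := by
  obtain ⟨A, hA, hs⟩ := hf.pairCorrelation_eq_zero
  refine HasCompactSupport.intro (isCompact_closedBall (0 : ℝ) A) fun p hp => hs p ?_
  simpa using hp

/-- Substitute s ↦ -s; reversing both s and p negates the second vector, and `f` is even. -/
theorem IsTestFunction.pairCorrelation_neg (hf : IsTestFunction f) (p : ℝ) :
    pairCorrelation f (-p) = pairCorrelation f p := by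
  have hmp : MeasurePreserving (fun z : ℂ × ℝ => (z.1, -z.2)) :=
    (MeasurePreserving.id _).prod (Measure.measurePreserving_neg volume)
  have hemb : MeasurableEmbedding (fun z : ℂ × ℝ => (z.1, -z.2)) :=
    ((MeasurableEquiv.refl ℂ).prodCongr (MeasurableEquiv.neg ℝ)).measurableEmbedding
  unfold pairCorrelation
  rw [← hmp.integral_comp hemb]
  refine integral_congr_ae (ae_of_all _ fun z => ?_)
  simp only [corrKernel]
  rw [← hf.even ((_ + _) * z.1)]
  congr 2
  push_cast
  ring

theorem IsTestFunction.hasCompactSupport_corrKernel (hf : IsTestFunction f) (p : ℝ) :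
    HasCompactSupport (corrKernel f p) := by
  obtain ⟨A, hA, hs⟩ := hf.exists_corrKernel_support
  refine HasCompactSupport.intro ((isCompact_closedBall (0 : ℂ) A).prod
    (isCompact_closedBall (0 : ℝ) A)) fun z hz => ?_
  by_contra h
  exact hz (hs p z h).2

theorem IsTestFunction.integrable_corrKernel (hf : IsTestFunction f) (p : ℝ) :
    Integrable (corrKernel f p) :=
  (hf.continuous_corrKernel.comp (by fun_prop : Continuous fun z : ℂ × ℝ => (p, z)))
    |>.integrable_of_hasCompactSupport (hf.hasCompactSupport_corrKernel p)

/-- Pairs of vectors from a bounded set span bounded areas, so only finitely many of the components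
of area m + 1 contribute. -/
theorem IsTestFunction.integrable_pairMeasure (hf : IsTestFunction f) :
    Integrable (fun z : ℂ × ℂ => conj (f z.1) * f z.2) pairMeasure := by
  have hfc := hf.continuous
  have hc : Continuous fun z : ℂ × ℂ => conj (f z.1) * f z.2 :=
    (Complex.continuous_conj.comp (hfc.comp continuous_fst)).mul (hfc.comp continuous_snd)
  refine ⟨hc.aestronglyMeasurable, ?_⟩
  have hk : ∀ (m : ℕ) (z : ℂ × ℝ), conj (f (pairMap m z).1) * f (pairMap m z).2 =
      corrKernel f ((m + 1 : ℕ) : ℝ) z := fun m z => by simp [pairMap, corrKernel]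
  rw [HasFiniteIntegral, lintegral_pairMeasure hc.enorm.measurable]
  simp only [hk]
  refine ENNReal.add_lt_top.mpr ⟨?_, ?_⟩
  · have h1 : Continuous fun u : ℂ => conj (f u) * f u :=
      (Complex.continuous_conj.comp hfc).mul hfc
    exact (h1.integrable_of_hasCompactSupport (HasCompactSupport.mul_left hf.hasCompactSupport)).2
  · obtain ⟨A, hA, hs⟩ := hf.exists_corrKernel_support
    rw [tsum_eq_sum (s := Finset.range ⌈A⌉₊)]
    · refine ENNReal.sum_lt_top.mpr fun m _ => ENNReal.mul_lt_top ?_ ?_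
      · exact ENNReal.mul_lt_top (by simp) (by simp)
      · exact (hf.integrable_corrKernel _).2
    · intro m hm
      have hm' : A < ((m + 1 : ℕ) : ℝ) := by
        rw [Finset.mem_range, not_lt] at hm
        have := (Nat.le_ceil A).trans (Nat.cast_le.mpr hm)
        push_cast
        linarith
      have h0 : ∀ z, corrKernel f ((m + 1 : ℕ) : ℝ) z = 0 := fun z => by
        by_contra h
        have := (hs _ z h).1
        rw [abs_of_pos (hA.trans hm')] at this
        linarith
      simp only [h0]
      simp

/-- The Siegel--Veech transform in Iwasawa coordinates. -/
noncomputable def latticeSum (f : ℂ → ℂ) (z : ℍ × ℝ) : ℂ :=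
  ∑' p : CoprimePair, f (latticeVec p.1 z.1 z.2)

theorem continuous_latticeSum (hf : Continuous f) (hs : HasCompactSupport f) :
    Continuous (latticeSum f) := by
  have h1 : latticeSum f = fun z : ℍ × ℝ =>
      transform (f ∘ planeToComplex) (H0.mk (iwasawa z.1 z.2)) := by
    funext z
    rw [transform_mk_iwasawa, latticeSum]
  rw [h1]
  exact (continuous_transform (hf.comp planeToComplex.continuous)
    (hs.comp_homeomorph planeToComplex.toHomeomorph)).comp continuous_mk_iwasawa

theorem conj_latticeSum_mul_latticeSum (hs : HasCompactSupport f) (z : ℍ × ℝ) :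
    ∑' pq : CoprimePair × CoprimePair, conj (f (latticeVec pq.1.1 z.1 z.2)) *
      f (latticeVec pq.2.1 z.1 z.2) = ((‖latticeSum f z‖ ^ 2 : ℝ) : ℂ) := by
  have hfin := finite_support_latticeVec hs z.1 z.2
  have h1 : Summable fun p : CoprimePair => ‖f (latticeVec p.1 z.1 z.2)‖ :=
    summable_of_hasFiniteSupport (hfin.subset fun p hp => by simpa using hp)
  have h2 : Summable fun p : CoprimePair => ‖conj (f (latticeVec p.1 z.1 z.2))‖ := by
    simpa using h1
  rw [← tsum_mul_tsum_of_summable_norm h2 h1, ← Complex.conj_tsum, Complex.conj_mul']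
  simp [latticeSum]

theorem IsTestFunction.lintegral_latticeSum_lt_top (hf : IsTestFunction f) :
    ∫⁻ z, ‖latticeSum f z‖ₑ ^ 2 ∂fdMeasure < ⊤ := by
  have hfc := hf.continuous
  have hc : Continuous fun z : ℂ × ℂ => conj (f z.1) * f z.2 :=
    (Complex.continuous_conj.comp (hfc.comp continuous_fst)).mul (hfc.comp continuous_snd)
  have h1 := lintegral_fdMeasure_tsum hc.enorm.measurable
  simp only [hf.even, ← two_mul] at h1
  have h2 := hf.integrable_pairMeasure.2
  rw [HasFiniteIntegral] at h2
  refine lt_of_le_of_lt (lintegral_mono fun z => ?_) (h1.trans_lt ?_)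
  · have := enorm_tsum_le_tsum_enorm (f := fun pq : CoprimePair × CoprimePair =>
      conj (f (latticeVec pq.1.1 z.1 z.2)) * f (latticeVec pq.2.1 z.1 z.2))
    rw [conj_latticeSum_mul_latticeSum hf.hasCompactSupport] at this
    refine le_trans (le_of_eq ?_) this
    rw [Complex.ofReal_pow, enorm_pow]
    simp [enorm_eq_nnnorm]
  · exact ENNReal.mul_lt_top (by simp) (ENNReal.mul_lt_top (by simp) h2)

/-- The second moment formula for test functions. -/
theorem IsTestFunction.integral_latticeSum (hf : IsTestFunction f) :
    ((∫ z, ‖latticeSum f z‖ ^ 2 ∂fdMeasure : ℝ) : ℂ) =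
      4 * (((∫ u, ‖f u‖ ^ 2 : ℝ) : ℂ) + ∑' m : ℕ,
        ((Nat.totient (m + 1) : ℂ) / (m + 1 : ℂ)) * pairCorrelation f (m + 1)) := by
  have hfc := hf.continuous
  have hc : Continuous fun z : ℂ × ℂ => conj (f z.1) * f z.2 :=
    (Complex.continuous_conj.comp (hfc.comp continuous_fst)).mul (hfc.comp continuous_snd)
  have h1 := integral_fdMeasure_tsum hc.measurable (fun z => by simp [hf.even])
    hf.integrable_pairMeasure
  simp only [conj_latticeSum_mul_latticeSum hf.hasCompactSupport, Complex.conj_mul'] at h1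
  rw [integral_complex_ofReal] at h1
  rw [h1, ← integral_complex_ofReal]
  simp [pairCorrelation, corrKernel, pairMap]

end TestFunctions

end SiegelVeech

namespace SiegelVeech

/-! ### Dilations and the symplectic Fourier transform on L²(ℂ) -/

section Dilation

open Filter Topology ENNReal
open scoped ComplexConjugate FourierTransform SchwartzMap

/-- `L²(ℂ)`. -/
abbrev L2C : Type := Lp ℂ 2 (volume : Measure ℂ)

theorem norm_sq_eq_integral {α : Type*} [MeasurableSpace α] {μ : Measure α} (f : Lp ℂ 2 μ) :
    ‖f‖ ^ 2 = ∫ v, ‖f v‖ ^ 2 ∂μ := by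
  have h := inner_self_eq_norm_sq_to_K (𝕜 := ℂ) f
  rw [L2.inner_def] at h
  have h2 : ∫ a, inner ℂ (f a) (f a) ∂μ = ((∫ v, ‖f v‖ ^ 2 ∂μ : ℝ) : ℂ) := by
    rw [← integral_complex_ofReal]
    refine integral_congr_ae (ae_of_all _ fun v => ?_)
    simp
  rw [h2] at h
  have h3 : ((∫ v, ‖f v‖ ^ 2 ∂μ : ℝ) : ℂ) = ((‖f‖ ^ 2 : ℝ) : ℂ) := by
    rw [h]; simp
  exact (Complex.ofReal_injective h3).symm

theorem quasiMeasurePreserving_smul_complex {a : ℝ} (ha : a ≠ 0) :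
    Measure.QuasiMeasurePreserving (fun v : ℂ => a • v) := 
  Measure.quasiMeasurePreserving_smul volume ha

theorem memLp_dilation {a : ℝ} (ha : a ≠ 0) {f : ℂ → ℂ} (hf : MemLp f 2) :
    MemLp (fun v : ℂ => (a : ℂ) * f (a • v)) 2 := by
  have h1 : MemLp f 2 (Measure.map (a • ·) (volume : Measure ℂ)) := by
    rw [Measure.map_addHaar_smul volume ha]
    exact hf.smul_measure (by simp)
  exact (h1.comp_of_map (measurable_const_smul a).aemeasurable).const_mul _

theorem integral_norm_sq_dilation {a : ℝ} (ha : a ≠ 0) (f : ℂ → ℂ) :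
    ∫ v : ℂ, ‖(a : ℂ) * f (a • v)‖ ^ 2 = ∫ v, ‖f v‖ ^ 2 := by
  simp only [norm_mul, mul_pow, Complex.norm_real, Real.norm_eq_abs, sq_abs]
  rw [integral_const_mul, Measure.integral_comp_smul volume (fun v : ℂ => ‖f v‖ ^ 2),
    Complex.finrank_real_complex, smul_eq_mul, abs_of_pos (by positivity)]
  field_simp

/-- The dilation `f ↦ a f(a ·)` of `L²(ℂ)`, as a function. -/
noncomputable def dilationFun {a : ℝ} (ha : a ≠ 0) (f : L2C) : L2C :=
  (memLp_dilation ha (Lp.memLp f)).toLp _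

theorem coeFn_dilationFun {a : ℝ} (ha : a ≠ 0) (f : L2C) :
    dilationFun ha f =ᵐ[volume] fun v : ℂ => (a : ℂ) * f (a • v) :=
  MemLp.coeFn_toLp _

theorem dilationFun_dilationFun {a b c : ℝ} (ha : a ≠ 0) (hb : b ≠ 0) (hc : c ≠ 0) (h : a * b = c)
    (f : L2C) : dilationFun ha (dilationFun hb f) = dilationFun hc f := by
  refine Lp.ext ?_
  filter_upwards [coeFn_dilationFun ha (dilationFun hb f), coeFn_dilationFun hc f,
    (quasiMeasurePreserving_smul_complex ha).ae (coeFn_dilationFun hb f)] with v h1 h2 h3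
  rw [h1, h2, h3, smul_smul, ← h, mul_comm b a]
  push_cast
  ring

theorem dilationFun_one (f : L2C) : dilationFun one_ne_zero f = f := by
  refine Lp.ext ?_
  filter_upwards [coeFn_dilationFun one_ne_zero f] with v h1
  rw [h1]
  simp

/-- The dilation `f ↦ a f(a ·)` of `L²(ℂ)`. -/
noncomputable def dilation {a : ℝ} (ha : a ≠ 0) : L2C ≃ₗᵢ[ℂ] L2C where
  toFun := dilationFun ha
  invFun := dilationFun (inv_ne_zero ha)
  left_inv f := by
    rw [dilationFun_dilationFun _ _ one_ne_zero (inv_mul_cancel₀ ha), dilationFun_one]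
  right_inv f := by
    rw [dilationFun_dilationFun _ _ one_ne_zero (mul_inv_cancel₀ ha), dilationFun_one]
  map_add' f g := by
    refine Lp.ext ?_
    filter_upwards [coeFn_dilationFun ha (f + g), coeFn_dilationFun ha f, coeFn_dilationFun ha g,
      Lp.coeFn_add (dilationFun ha f) (dilationFun ha g),
      (quasiMeasurePreserving_smul_complex ha).ae (Lp.coeFn_add f g)] with v h1 h2 h3 h4 h5
    rw [h1, h4, h5, Pi.add_apply, Pi.add_apply, h2, h3, mul_add]
  map_smul' c f := by
    refine Lp.ext ?_
    filter_upwards [coeFn_dilationFun ha (c • f), coeFn_dilationFun ha f,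
      Lp.coeFn_smul c (dilationFun ha f),
      (quasiMeasurePreserving_smul_complex ha).ae (Lp.coeFn_smul c f)] with v h1 h2 h4 h5
    rw [RingHom.id_apply, h1, h4, h5, Pi.smul_apply, Pi.smul_apply, h2, smul_eq_mul, smul_eq_mul]
    ring
  norm_map' f := by
    have h1 : ‖dilationFun ha f‖ ^ 2 = ‖f‖ ^ 2 := by
      rw [norm_sq_eq_integral, norm_sq_eq_integral, ← integral_norm_sq_dilation ha f]
      refine integral_congr_ae ?_
      filter_upwards [coeFn_dilationFun ha f] with v h1
      rw [h1]
    exact (pow_left_inj₀ (norm_nonneg _) (norm_nonneg _) two_ne_zero).mp h1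

theorem coeFn_dilation {a : ℝ} (ha : a ≠ 0) (f : L2C) :
    dilation ha f =ᵐ[volume] fun v : ℂ => (a : ℂ) * f (a • v) :=
  coeFn_dilationFun ha f

theorem dilation_symm {a : ℝ} (ha : a ≠ 0) : (dilation ha).symm = dilation (inv_ne_zero ha) :=
  LinearIsometryEquiv.ext fun _ => rfl

theorem dilation_dilation {a b c : ℝ} (ha : a ≠ 0) (hb : b ≠ 0) (hc : c ≠ 0) (h : a * b = c)
    (f : L2C) : dilation ha (dilation hb f) = dilation hc f :=
  dilationFun_dilationFun ha hb hc h f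

theorem dilation_one (f : L2C) : dilation one_ne_zero f = f := dilationFun_one f

/-- Multiplication by `i` preserves the measure. -/
theorem measurePreserving_I_mul : MeasurePreserving (fun v : ℂ => Complex.I * v) := by
  have h := (_root_.rotation (⟨Complex.I, by simp [Submonoid.unitSphere]⟩ : Circle)).measurePreserving
  exact h

/-- The Fourier transform on `L²(ℂ)` composed with multiplication by `i`. -/
noncomputable def symplecticFourier : L2C →ₗᵢ[ℂ] L2C :=
  (Lp.compMeasurePreservingₗᵢ ℂ _ measurePreserving_I_mul).comp
    (Lp.fourierTransformₗᵢ ℂ ℂ).toLinearIsometry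

theorem coeFn_symplecticFourier (f : 𝓢(ℂ, ℂ)) :
    symplecticFourier (f.toLp 2) =ᵐ[volume] fun v => 𝓕 (f : ℂ → ℂ) (Complex.I * v) := by
  have h1 : symplecticFourier (f.toLp 2) =ᵐ[volume]
      fun v => (𝓕 (f.toLp 2 volume) : L2C) (Complex.I * v) :=
    Lp.coeFn_compMeasurePreserving _ measurePreserving_I_mul
  rw [SchwartzMap.toLp_fourier_eq] at h1
  filter_upwards [h1, measurePreserving_I_mul.quasiMeasurePreserving.ae
    ((𝓕 f).coeFn_toLp 2 volume)] with v h1 h2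
  rw [h1, h2, SchwartzMap.fourier_coe]

/-- The Fourier transform carries the unitary dilation by a to the one by a⁻¹. This is computed on
Schwartz functions, where it is a change of variables, and extended by density. -/
theorem dilation_symplecticFourier_dilation {a : ℝ} (ha : a ≠ 0) (f : L2C) :
    dilation ha (symplecticFourier (dilation ha f)) = symplecticFourier f := by
  have hd : DenseRange (SchwartzMap.toLpCLM ℝ (E := ℂ) ℂ 2 volume) :=
    SchwartzMap.denseRange_toLpCLM ENNReal.ofNat_ne_top
  refine hd.induction_on (p := fun f : L2C =>
    dilation ha (symplecticFourier (dilation ha f)) = symplecticFourier f) f ?_ ?_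
  · have h1 : Continuous fun f : L2C => dilation ha f := (dilation ha).continuous
    have h2 : Continuous fun f : L2C => symplecticFourier f := symplecticFourier.continuous
    exact isClosed_eq (h1.comp (h2.comp h1)) h2
  · intro f
    set g : 𝓢(ℂ, ℂ) := (a : ℂ) • SchwartzMap.compCLMOfContinuousLinearEquiv ℂ
      (ContinuousLinearEquiv.smulLeft (M₁ := ℂ) (Units.mk0 a ha)) f with hg
    have hgv : ∀ v, g v = a * f (a • v) := fun v => by
      simp [hg, Units.smul_def]
    have h1 : dilation ha (f.toLp 2) = g.toLp 2 := by
      refine Lp.ext ?_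
      filter_upwards [coeFn_dilation ha (f.toLp 2), g.coeFn_toLp 2 volume,
        (quasiMeasurePreserving_smul_complex ha).ae (f.coeFn_toLp 2 volume)] with v h1 h2 h3
      rw [h1, h2, h3, hgv]
    simp only [SchwartzMap.toLpCLM_apply]
    rw [h1]
    refine Lp.ext ?_
    filter_upwards [coeFn_dilation ha (symplecticFourier (g.toLp 2)), coeFn_symplecticFourier f,
      (quasiMeasurePreserving_smul_complex ha).ae (coeFn_symplecticFourier g)] with v h1 h2 h3
    rw [h1, h2, h3, Real.fourier_eq, Real.fourier_eq]
    have h4 := Measure.integral_comp_smul (volume : Measure ℂ)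
      (fun w : ℂ => Real.fourierChar (-inner ℝ w (Complex.I * v)) • f w) a
    have h5 : ∀ w : ℂ, Real.fourierChar (-inner ℝ w (Complex.I * (a • v))) • g w =
        (a : ℂ) * (Real.fourierChar (-inner ℝ (a • w) (Complex.I * v)) • f (a • w)) := by
      intro w
      rw [hgv, mul_smul_comm, inner_smul_left, inner_smul_right, conj_trivial]
      exact (mul_smul_comm _ _ _).symm
    simp only [h5]
    rw [integral_const_mul, h4, Complex.finrank_real_complex, abs_of_pos (by positivity),
      Complex.real_smul]
    have : (a : ℂ) ≠ 0 := by exact_mod_cast ha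
    push_cast
    field_simp

/-- Dilation by a natural number; by convention the identity for `n = 0`. -/
noncomputable def natDilation (n : ℕ) : L2C ≃ₗᵢ[ℂ] L2C :=
  if h : n = 0 then LinearIsometryEquiv.refl ℂ L2C else dilation (a := n) (Nat.cast_ne_zero.mpr h)

theorem natDilation_of_ne {n : ℕ} (h : n ≠ 0) :
    natDilation n = dilation (a := n) (Nat.cast_ne_zero.mpr h) := dif_neg h

theorem natDilation_zero : natDilation 0 = LinearIsometryEquiv.refl ℂ L2C := dif_pos rfl

theorem natDilation_one (f : L2C) : natDilation 1 f = f := by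
  rw [natDilation_of_ne one_ne_zero]
  have := dilation_one f
  simpa using this

theorem natDilation_mul (m n : ℕ) (hm : m ≠ 0) (hn : n ≠ 0) (f : L2C) :
    natDilation (m * n) f = natDilation m (natDilation n f) := by
  rw [natDilation_of_ne hm, natDilation_of_ne hn, natDilation_of_ne (mul_ne_zero hm hn)]
  exact (dilation_dilation _ _ _ (by push_cast; rfl) f).symm

theorem natDilation_comm (m n : ℕ) (f : L2C) :
    natDilation m (natDilation n f) = natDilation n (natDilation m f) := by
  rcases eq_or_ne m 0 with rfl | hm
  · simp [natDilation_zero]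
  rcases eq_or_ne n 0 with rfl | hn
  · simp [natDilation_zero]
  rw [← natDilation_mul m n hm hn, ← natDilation_mul n m hn hm, mul_comm]

theorem natDilation_symplecticFourier (n : ℕ) (f : L2C) :
    natDilation n (symplecticFourier (natDilation n f)) = symplecticFourier f := by
  rcases eq_or_ne n 0 with rfl | hn
  · simp [natDilation_zero]
  rw [natDilation_of_ne hn]
  exact dilation_symplecticFourier_dilation _ f

theorem natDilation_natDilation_symm {m n : ℕ} (hm : m ≠ 0) (hn : n ≠ 0) (f : L2C) :
    natDilation m ((natDilation n).symm f) = dilation (a := (m : ℝ) / n)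
      (div_ne_zero (Nat.cast_ne_zero.mpr hm) (Nat.cast_ne_zero.mpr hn)) f := by
  rw [natDilation_of_ne hm, natDilation_of_ne hn, dilation_symm]
  exact dilation_dilation _ _ _ (div_eq_mul_inv _ _).symm f

end Dilation

end SiegelVeech

namespace SiegelVeech

/-! ### Decay of the dilate correlation, and area coordinates -/

section Correlation

open Filter Topology
open scoped ComplexConjugate FourierTransform SchwartzMap

/-- An even function has vanishing derivative at 0; with g 0 = 0 this gives quadratic vanishing of g
and linear vanishing of its derivative. The application is to g = 𝓕 f, where g 0 = 0 expresses that
f has mean zero. -/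
theorem exists_schwartz_bounds (g : 𝓢(ℂ, ℂ)) (hg : ∀ x, g (-x) = g x) (hg0 : g 0 = 0) :
    ∃ A ≥ 0, ∀ x, ‖g x‖ ≤ A * ‖x‖ ^ 2 ∧ ‖x‖ ^ 2 * ‖g x‖ ≤ A ∧ ‖fderiv ℝ g x‖ ≤ A * ‖x‖ ∧
      ‖x‖ ^ 2 * ‖fderiv ℝ g x‖ ≤ A ∧ ‖fderiv ℝ g x‖ ≤ A := by
  set g' := SchwartzMap.fderivCLM ℝ ℂ ℂ g with hg'
  set g'' := SchwartzMap.fderivCLM ℝ ℂ (ℂ →L[ℝ] ℂ) g' with hg''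
  obtain ⟨C1, hC1, h1⟩ := g.decay 2 0
  obtain ⟨C2, hC2, h2⟩ := g'.decay 2 0
  obtain ⟨C3, hC3, h3⟩ := g''.decay 0 0
  obtain ⟨C4, hC4, h4⟩ := g'.decay 0 0
  simp only [norm_iteratedFDeriv_zero, pow_zero, one_mul] at h1 h2 h3 h4
  have h0 : g' 0 = 0 := by
    have e1 : HasFDerivAt g (g' 0) (-0 : ℂ) := by rw [neg_zero]; exact g.hasFDerivAt 0
    have e2 := e1.comp (0 : ℂ) ((hasFDerivAt_id (𝕜 := ℝ) (0 : ℂ)).neg)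
    have e3 : (fun x => g (-x)) = g := funext hg
    have e4 : HasFDerivAt g ((g' 0).comp (-ContinuousLinearMap.id ℝ ℂ)) 0 := by
      rw [← e3]; exact e2
    have e5 := e4.unique (g.hasFDerivAt 0)
    have e6 : -(g' 0) = g' 0 := by
      rw [← ContinuousLinearMap.comp_id (g' 0), ← ContinuousLinearMap.comp_neg]
      exact e5.trans (ContinuousLinearMap.comp_id _).symm
    ext v
    have e7 := congrArg (fun T : ℂ →L[ℝ] ℂ => T v) e6
    simpa using self_eq_neg.mp e7.symm
  have h5 : ∀ x, ‖g' x‖ ≤ C3 * ‖x‖ := by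
    intro x
    have := convex_univ.norm_image_sub_le_of_norm_fderiv_le (𝕜 := ℝ) (f := g') (C := C3)
      (fun x _ => g'.differentiableAt) (fun x _ => h3 x) (Set.mem_univ 0) (Set.mem_univ x)
    simpa [h0] using this
  have h6 : ∀ x, ‖g x‖ ≤ C3 * ‖x‖ ^ 2 := by
    intro x
    have := (convex_closedBall (0 : ℂ) ‖x‖).norm_image_sub_le_of_norm_fderiv_le (𝕜 := ℝ) (f := g)
      (C := C3 * ‖x‖) (fun x _ => g.differentiableAt)
      (fun y hy => (h5 y).trans (mul_le_mul_of_nonneg_left (by simpa using hy) hC3.le))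
      (Metric.mem_closedBall_self (norm_nonneg x)) (y := x) (by simp)
    rw [hg0, sub_zero, sub_zero] at this
    linarith
  refine ⟨C1 + C2 + C3 + C4, by positivity, fun x => ⟨?_, ?_, ?_, ?_, ?_⟩⟩
  · exact (h6 x).trans (mul_le_mul_of_nonneg_right (by linarith) (by positivity))
  · exact (h1 x).trans (by linarith)
  · exact (h5 x).trans (mul_le_mul_of_nonneg_right (by linarith) (by positivity))
  · exact (h2 x).trans (by linarith)
  · exact (h4 x).trans (by linarith)

/-- The correlation of `f` with the dilates of a function `g`. -/
noncomputable def dilateCorrelation (f g : ℂ → ℂ) (a : ℝ) : ℂ :=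
  ∫ u, conj (f u) * g (Complex.I * (a • u))

/-- The derivative of `dilateCorrelation`. -/
noncomputable def dilateCorrelationDeriv (f g : ℂ → ℂ) (a : ℝ) : ℂ :=
  ∫ u, conj (f u) * fderiv ℝ g (Complex.I * (a • u)) (Complex.I * u)

variable {f : ℂ → ℂ}

/-- On the support of f, |u| lies between two positive constants, so |iau| is comparable with a. The
behaviour of g at 0 and at infinity passes to the correlation as a function of a. -/
theorem IsTestFunction.exists_quadraticDecay (hf : IsTestFunction f) (g : 𝓢(ℂ, ℂ))
    (hg : ∀ x, g (-x) = g x) (hg0 : g 0 = 0) :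
    ∃ C, QuadraticDecay (dilateCorrelation f g) (dilateCorrelationDeriv f g) C := by
  obtain ⟨A, hA, hb⟩ := exists_schwartz_bounds g hg hg0
  obtain ⟨δ, hδ, R, hR, hfb⟩ := hf.exists_bounds
  have hfc := hf.continuous
  have hfi : Integrable fun u => ‖f u‖ :=
    (hfc.integrable_of_hasCompactSupport hf.hasCompactSupport).norm
  set L := ∫ u, ‖f u‖ with hL
  have hL0 : 0 ≤ L := integral_nonneg fun _ => norm_nonneg _
  have hnorm : ∀ (a : ℝ) (u : ℂ), ‖Complex.I * (a • u)‖ = |a| * ‖u‖ := fun a u => by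
    simp
  have key : ∀ (φ : ℂ → ℂ) (c : ℝ), (∀ u, f u ≠ 0 → ‖φ u‖ ≤ c) →
      ‖∫ u, conj (f u) * φ u‖ ≤ c * L := by
    intro φ c hc
    rw [hL, ← integral_const_mul]
    refine norm_integral_le_of_norm_le (hfi.const_mul c) (ae_of_all _ fun u => ?_)
    rw [norm_mul, RCLike.norm_conj, mul_comm c]
    by_cases h : f u = 0
    · simp [h]
    · exact mul_le_mul_of_nonneg_left (hc u h) (norm_nonneg _)
  have hgc : Continuous (fderiv ℝ g) := (SchwartzMap.fderivCLM ℝ ℂ ℂ g).continuous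
  set C := A * (R ^ 2 + (δ ^ 2)⁻¹ + (δ ^ 2)⁻¹ * R) * L with hC
  have hle : ∀ {x : ℝ}, x ≤ R ^ 2 + (δ ^ 2)⁻¹ + (δ ^ 2)⁻¹ * R → A * x * L ≤ C := fun h => by
    rw [hC]; gcongr
  have p1 : 0 ≤ R ^ 2 := by positivity
  have p2 : 0 ≤ (δ ^ 2)⁻¹ := by positivity
  have p3 : 0 ≤ (δ ^ 2)⁻¹ * R := by positivity
  refine ⟨C, ⟨fun a ha => ?_, fun a ha => ?_, fun a ha => ?_, fun a ha => ?_, fun a ha => ?_⟩⟩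
  · have h1 := hasDerivAt_integral_of_dominated_loc_of_deriv_le (μ := (volume : Measure ℂ))
      (F := fun (a : ℝ) u => conj (f u) * g (Complex.I * (a • u)))
      (F' := fun (a : ℝ) u => conj (f u) * fderiv ℝ g (Complex.I * (a • u)) (Complex.I * u))
      (bound := fun u => ‖f u‖ * (A * R)) (s := Set.univ) (x₀ := a) Filter.univ_mem ?_ ?_ ?_ ?_ ?_ ?_
    · exact h1.2
    · refine Eventually.of_forall fun b => Continuous.aestronglyMeasurable ?_
      exact (Complex.continuous_conj.comp hfc).mul (g.continuous.comp (by fun_prop))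
    · refine Continuous.integrable_of_hasCompactSupport ?_ ?_
      · exact (Complex.continuous_conj.comp hfc).mul (g.continuous.comp (by fun_prop))
      · exact HasCompactSupport.mul_right (hf.hasCompactSupport.comp_left (map_zero _))
    · refine Continuous.aestronglyMeasurable ?_
      refine (Complex.continuous_conj.comp hfc).mul ?_
      exact (hgc.comp (by fun_prop)).clm_apply (by fun_prop)
    · refine ae_of_all _ fun u b _ => ?_
      rw [norm_mul, RCLike.norm_conj]
      by_cases h : f u = 0
      · simp [h]
      · refine mul_le_mul_of_nonneg_left ?_ (norm_nonneg _)
        refine (ContinuousLinearMap.le_opNorm _ _).trans ?_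
        have : ‖Complex.I * u‖ ≤ R := by simpa using (hfb u h).2
        exact mul_le_mul (hb _).2.2.2.2 this (norm_nonneg _) hA
    · exact hfi.mul_const _
    · refine ae_of_all _ fun u b _ => ?_
      have h2 : HasDerivAt (fun b : ℝ => Complex.I * (b • u)) (Complex.I * u) b := by
        have := ((hasDerivAt_id b).smul_const u).const_mul Complex.I
        simpa using this
      exact ((g.hasFDerivAt _).comp_hasDerivAt b h2).const_mul _
  · refine (key (fun u => g (Complex.I * (a • u))) (A * (a ^ 2 * R ^ 2)) fun u hu => ?_).trans ?_
    · refine (hb _).1.trans ?_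
      rw [hnorm, mul_pow, sq_abs]
      have := (hfb u hu).2
      gcongr
    · calc A * (a ^ 2 * R ^ 2) * L = A * R ^ 2 * L * a ^ 2 := by ring
        _ ≤ C * a ^ 2 := by gcongr; exact hle (by linarith)
  · refine (key (fun u => g (Complex.I * (a • u))) (A * ((a ^ 2)⁻¹ * (δ ^ 2)⁻¹)) fun u hu => ?_).trans ?_
    · have h1 := (hb (Complex.I * (a • u))).2.1
      rw [hnorm, mul_pow, sq_abs] at h1
      have h2 := (hfb u hu).1
      have h3 : a ^ 2 * δ ^ 2 * ‖g (Complex.I * (a • u))‖ ≤ A := le_trans (by gcongr) h1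
      rw [← mul_inv, ← div_eq_mul_inv, le_div_iff₀ (by positivity)]
      linarith
    · calc A * ((a ^ 2)⁻¹ * (δ ^ 2)⁻¹) * L = A * (δ ^ 2)⁻¹ * L * (a ^ 2)⁻¹ := by ring
        _ ≤ C * (a ^ 2)⁻¹ := by gcongr; exact hle (by linarith)
  · refine (key (fun u => fderiv ℝ g (Complex.I * (a • u)) (Complex.I * u)) (A * (a * R ^ 2))
      fun u hu => ?_).trans ?_
    · refine (ContinuousLinearMap.le_opNorm _ _).trans ?_
      have h1 := (hb (Complex.I * (a • u))).2.2.1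
      rw [hnorm, abs_of_nonneg ha] at h1
      have h2 := (hfb u hu).2
      have : ‖Complex.I * u‖ ≤ R := by simpa using h2
      calc _ ≤ A * (a * ‖u‖) * R := mul_le_mul h1 this (norm_nonneg _) (by positivity)
        _ ≤ A * (a * R) * R := by gcongr
        _ = A * (a * R ^ 2) := by ring
    · calc A * (a * R ^ 2) * L = A * R ^ 2 * L * a := by ring
        _ ≤ C * a := by gcongr; exact hle (by linarith)
  · refine (key (fun u => fderiv ℝ g (Complex.I * (a • u)) (Complex.I * u))
      (A * ((a ^ 2)⁻¹ * (δ ^ 2)⁻¹ * R)) fun u hu => ?_).trans ?_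
    · refine (ContinuousLinearMap.le_opNorm _ _).trans ?_
      have h1 := (hb (Complex.I * (a • u))).2.2.2.1
      rw [hnorm, mul_pow, sq_abs] at h1
      have h2 := (hfb u hu).1
      have h3 : a ^ 2 * δ ^ 2 * ‖fderiv ℝ g (Complex.I * (a • u))‖ ≤ A := le_trans (by gcongr) h1
      have h4 : ‖fderiv ℝ g (Complex.I * (a • u))‖ ≤ A * ((a ^ 2)⁻¹ * (δ ^ 2)⁻¹) := by
        rw [← mul_inv, ← div_eq_mul_inv, le_div_iff₀ (by positivity)]
        linarith
      have : ‖Complex.I * u‖ ≤ R := by simpa using (hfb u hu).2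
      calc _ ≤ A * ((a ^ 2)⁻¹ * (δ ^ 2)⁻¹) * R := mul_le_mul h4 this (norm_nonneg _) (by positivity)
        _ = _ := by ring
    · calc A * ((a ^ 2)⁻¹ * (δ ^ 2)⁻¹ * R) * L = A * ((δ ^ 2)⁻¹ * R) * L * (a ^ 2)⁻¹ := by ring
        _ ≤ C * (a ^ 2)⁻¹ := by gcongr; exact hle (by linarith)

/-- For fixed u, write v = (s + i p/‖u‖²)u. Multiplication by u scales area by ‖u‖², which cancels
the factor ‖u‖⁻² in the imaginary direction, so dv = ds dp; p is the signed area spanned with u. -/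
theorem integral_parallelogram {H : ℂ → ℂ} (hH : Continuous H) (hs : HasCompactSupport H) {u : ℂ}
    (hu : u ≠ 0) :
    ∫ v, H v = ∫ s : ℝ, ∫ p : ℝ, H ((s + p * ((‖u‖ ^ 2)⁻¹ : ℝ) * Complex.I) * u) := by
  have hu' : 0 < ‖u‖ := norm_pos_iff.mpr hu
  set c : ℝ := (‖u‖ ^ 2)⁻¹ with hc
  have hc0 : 0 < c := by positivity
  have h1 : ∫ v, H v = c⁻¹ * ∫ z, H (z * u) := by
    set ρ : Circle := ⟨u / ‖u‖, by simp [Submonoid.unitSphere, hu]⟩ with hρ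
    have e1 : ∫ v, H v = ∫ v, H (_root_.rotation ρ v) :=
      ((_root_.rotation ρ).measurePreserving.integral_comp
        (_root_.rotation ρ).toHomeomorph.measurableEmbedding H).symm
    have e2 := Measure.integral_comp_smul (volume : Measure ℂ)
      (fun v => H (_root_.rotation ρ v)) ‖u‖
    have e3 : ∀ z : ℂ, H (_root_.rotation ρ (‖u‖ • z)) = H (z * u) := fun z => by
      congr 1
      rw [rotation_apply, hρ, Complex.real_smul]
      have : (‖u‖ : ℂ) ≠ 0 := by exact_mod_cast hu'.ne'
      simp only
      field_simp
    simp only [e3] at e2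
    rw [e1, e2, Complex.finrank_real_complex, abs_of_pos (by positivity), Complex.real_smul, ← hc,
      ← mul_assoc, ← Complex.ofReal_mul, inv_mul_cancel₀ hc0.ne', Complex.ofReal_one, one_mul]
  have hH' : Continuous fun z : ℝ × ℝ => H ((z.1 + z.2 * Complex.I) * u) := by fun_prop
  have hs' : HasCompactSupport fun z : ℝ × ℝ => H ((z.1 + z.2 * Complex.I) * u) := by
    have := hs.comp_homeomorph ((Complex.equivRealProdCLM.symm.toHomeomorph).trans
      (Homeomorph.mulRight₀ u hu))
    convert this using 1
    funext z
    have : Complex.equivRealProdCLM.symm z = z.1 + z.2 * Complex.I :=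
      Complex.equivRealProd_symm_apply z
    simp [this]
  have h2 : ∫ z, H (z * u) = ∫ s : ℝ, ∫ t : ℝ, H ((s + t * Complex.I) * u) := by
    rw [← Complex.volume_preserving_equiv_real_prod.symm.integral_comp
      Complex.measurableEquivRealProd.symm.measurableEmbedding, Measure.volume_eq_prod,
      integral_prod]
    · refine integral_congr_ae (ae_of_all _ fun s => integral_congr_ae (ae_of_all _ fun t => ?_))
      simp only [Complex.measurableEquivRealProd_symm_apply, Complex.mk_eq_add_mul_I]
    · rw [← Measure.volume_eq_prod]
      refine (hH'.integrable_of_hasCompactSupport hs').congr (ae_of_all _ fun z => ?_)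
      simp [Complex.measurableEquivRealProd_symm_apply, Complex.mk_eq_add_mul_I]
  rw [h1, h2, ← integral_const_mul]
  refine integral_congr_ae (ae_of_all _ fun s => ?_)
  have h3 := Measure.integral_comp_mul_right (fun t : ℝ => H ((s + t * Complex.I) * u)) c
  rw [abs_of_pos (by positivity), Complex.real_smul] at h3
  push_cast at h3 ⊢
  exact h3.symm

end Correlation

end SiegelVeech

namespace SiegelVeech

/-! ### The second moment as a limit of isometries -/

section SecondMoment

open Filter Topology
open scoped ComplexConjugate FourierTransform SchwartzMap

variable {f : ℂ → ℂ}

/-- Pairing with iu sees only the area coordinate p. Hence the planar Fourier transform at iau is a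
one-dimensional Fourier transform in p. -/
theorem inner_pair_I_mul {u : ℂ} (hu : u ≠ 0) (s p a : ℝ) :
    inner ℝ ((s + p * ((‖u‖ ^ 2)⁻¹ : ℝ) * Complex.I) * u) (Complex.I * (a • u)) = a * p := by
  have h1 : Complex.normSq u ≠ 0 := Complex.normSq_eq_zero.not.mpr hu
  rw [← Complex.normSq_eq_norm_sq, Complex.inner]
  have h2 : u.re * u.re + u.im * u.im = Complex.normSq u := (Complex.normSq_apply u).symm
  simp only [Complex.mul_re, Complex.mul_im, Complex.add_re, Complex.add_im, Complex.ofReal_re,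
    Complex.ofReal_im, Complex.I_re, Complex.I_im, Complex.conj_re, Complex.conj_im,
    Complex.real_smul, Complex.mul_re, map_mul]
  field_simp
  linear_combination (a * p) * h2

theorem fourier_eq_parallelogram (hf : Continuous f) (hs : HasCompactSupport f) {u : ℂ}
    (hu : u ≠ 0) (a : ℝ) :
    𝓕 f (Complex.I * (a • u)) = ∫ s : ℝ, ∫ p : ℝ, Complex.exp (↑(-2 * Real.pi * p * a) * Complex.I) *
      f ((s + p * ((‖u‖ ^ 2)⁻¹ : ℝ) * Complex.I) * u) := by
  set w := Complex.I * (a • u) with hw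
  have hc : Continuous fun v : ℂ => Complex.exp (↑(-2 * Real.pi * inner ℝ v w) * Complex.I) := by
    fun_prop
  have h1 := integral_parallelogram (hc.mul hf) (HasCompactSupport.mul_left hs) hu
  have h2 : 𝓕 f w = ∫ v, Complex.exp (↑(-2 * Real.pi * inner ℝ v w) * Complex.I) * f v :=
    Real.fourier_eq' f w
  rw [h2]
  refine h1.trans (integral_congr_ae (ae_of_all _ fun s => integral_congr_ae (ae_of_all _ fun p => ?_)))
  simp only [Pi.mul_apply, hw, inner_pair_I_mul hu]
  rw [show -2 * Real.pi * (a * p) = -2 * Real.pi * p * a by ring]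

/-- Fubini: for fixed u, integrating over p and s together is integrating over the second vector v,
and the character in p becomes the planar character at iau. -/
theorem IsTestFunction.fourier_pairCorrelation (hf : IsTestFunction f) :
    𝓕 (pairCorrelation f) = dilateCorrelation f (𝓕 f) := by
  have hfc := hf.continuous
  funext a
  set Φ : ℝ × ℂ × ℝ → ℂ := fun z => Complex.exp (↑(-2 * Real.pi * z.1 * a) * Complex.I) *
    corrKernel f z.1 z.2 with hΦ
  have hΦc : Continuous Φ := by
    refine Continuous.mul (by fun_prop) hf.continuous_corrKernel
  have hΦs : HasCompactSupport Φ := by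
    obtain ⟨A, hA, hs⟩ := hf.exists_corrKernel_support
    refine HasCompactSupport.intro ((isCompact_closedBall (0 : ℝ) A).prod
      ((isCompact_closedBall (0 : ℂ) A).prod (isCompact_closedBall (0 : ℝ) A))) fun z hz => ?_
    by_contra h
    obtain ⟨h1, h2⟩ := hs _ _ (right_ne_zero_of_mul h)
    exact hz ⟨by simpa using h1, h2⟩
  have hΦi : Integrable Φ ((volume : Measure ℝ).prod volume) :=
    hΦc.integrable_of_hasCompactSupport hΦs
  have hΦi' : Integrable (fun z : ℂ × ℝ => ∫ p, Φ (p, z)) ((volume : Measure ℂ).prod volume) :=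
    hΦi.integral_prod_right
  have h1 : 𝓕 (pairCorrelation f) a = ∫ p, ∫ z, Φ (p, z) := by
    rw [Real.fourier_eq']
    refine integral_congr_ae (ae_of_all _ fun p => ?_)
    simp only [smul_eq_mul, pairCorrelation, hΦ]
    rw [integral_const_mul]
    congr 4
    simp [mul_comm, mul_left_comm, mul_assoc]
  have h2 : ∫ p, ∫ z, Φ (p, z) = ∫ z, ∫ p, Φ (p, z) :=
    integral_integral_swap (f := fun p z => Φ (p, z)) hΦi
  have h3 : ∫ z, ∫ p, Φ (p, z) = ∫ u : ℂ, ∫ s : ℝ, ∫ p, Φ (p, u, s) :=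
    integral_prod _ hΦi'
  rw [h1, h2, h3, dilateCorrelation]
  refine integral_congr_ae (ae_of_all _ fun u => ?_)
  by_cases hfu : f u = 0
  · simp [hΦ, corrKernel, hfu]
  have hu : u ≠ 0 := by
    rintro rfl
    exact hf.zero_notMem (subset_tsupport f hfu)
  change ∫ s, ∫ p, Φ (p, u, s) = conj (f u) * 𝓕 f (Complex.I * (a • u))
  rw [fourier_eq_parallelogram hfc hf.hasCompactSupport hu, ← integral_const_mul]
  refine integral_congr_ae (ae_of_all _ fun s => ?_)
  change ∫ p, Φ (p, u, s) = conj (f u) * ∫ p : ℝ, _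
  rw [← integral_const_mul]
  refine integral_congr_ae (ae_of_all _ fun p => ?_)
  simp only [hΦ, corrKernel]
  ring

theorem fourier_even (hf : ∀ v, f (-v) = f v) (x : ℂ) : 𝓕 f (-x) = 𝓕 f x := by
  rw [Real.fourier_eq, Real.fourier_eq, ← integral_neg_eq_self]
  simp [hf]

/-- A unitary operator `M` with `⟪x, M y⟫ = ∑ μ(n) (mn)^{-1-ε} ⟪x, U_m U_n⁻¹ F y⟫`. -/
theorem exists_regularizedOperator (ε : ℝ) : ∃ M : L2C →L[ℂ] L2C, (∀ x, ‖M x‖ = ‖x‖) ∧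
    (0 < ε → ∀ x y : L2C, inner ℂ x (M y) =
      ∑' n : ℕ, ((ArithmeticFunction.moebius n : ℝ) * (n : ℝ) ^ (-(1 + ε)) : ℝ) *
        ∑' m : ℕ, (((m : ℝ) ^ (-(1 + ε)) : ℝ) : ℂ) *
          inner ℂ x (natDilation m ((natDilation n).symm (symplecticFourier y)))) := by
  by_cases hε : 0 < ε
  · obtain ⟨M, hM, h⟩ := exists_hasSum_inner_regularized natDilation symplecticFourier
      natDilation_one natDilation_mul natDilation_comm natDilation_symplecticFourier hε
    exact ⟨M, hM, fun _ => h⟩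
  -- For ε ≤ 0 the defining series is not available; the identity keeps the isometry property
  -- unconditional.
  · exact ⟨ContinuousLinearMap.id ℂ L2C, fun _ => rfl, fun h => absurd h hε⟩

/-- The regularized scattering operator. -/
noncomputable def regularizedOperator (ε : ℝ) : L2C →L[ℂ] L2C :=
  (exists_regularizedOperator ε).choose

theorem norm_regularizedOperator (ε : ℝ) (x : L2C) : ‖regularizedOperator ε x‖ = ‖x‖ :=
  (exists_regularizedOperator ε).choose_spec.1 x

theorem inner_regularizedOperator {ε : ℝ} (hε : 0 < ε) (x y : L2C) :
    inner ℂ x (regularizedOperator ε y) =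
      ∑' n : ℕ, ((ArithmeticFunction.moebius n : ℝ) * (n : ℝ) ^ (-(1 + ε)) : ℝ) *
        ∑' m : ℕ, (((m : ℝ) ^ (-(1 + ε)) : ℝ) : ℂ) *
          inner ℂ x (natDilation m ((natDilation n).symm (symplecticFourier y))) :=
  (exists_regularizedOperator ε).choose_spec.2 hε x y

/-- The matrix coefficients of the regularized operator only involve dilations of positive ratio. -/
theorem inner_regularizedOperator_eq {ε : ℝ} (hε : 0 < ε) {x y : L2C} {G : ℝ → ℂ}
    (hG : ∀ (a : ℝ) (ha : a ≠ 0), 0 < a → inner ℂ x (dilation ha (symplecticFourier y)) = G a) :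
    inner ℂ x (regularizedOperator ε y) =
      ∑' n : ℕ, ((ArithmeticFunction.moebius n : ℝ) * (n : ℝ) ^ (-(1 + ε)) : ℝ) *
        ∑' m : ℕ, (((m : ℝ) ^ (-(1 + ε)) : ℝ) : ℂ) * G ((m : ℝ) / n) := by
  rw [inner_regularizedOperator hε]
  refine tsum_congr fun n => ?_
  -- Index 0 has weight 0 in both sums, so the conventional values of `natDilation 0` and of m / 0
  -- play no role.
  rcases eq_or_ne n 0 with rfl | hn
  · simp
  congr 1
  refine tsum_congr fun m => ?_
  rcases eq_or_ne m 0 with rfl | hm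
  · rw [Nat.cast_zero, Real.zero_rpow (by linarith)]
    simp
  rw [natDilation_natDilation_symm hm hn, hG]
  have := Nat.pos_of_ne_zero hm
  have := Nat.pos_of_ne_zero hn
  positivity

/-- A test function as an element of `L²`. -/
theorem IsTestFunction.memLp (hf : IsTestFunction f) : MemLp f 2 :=
  hf.continuous.memLp_of_hasCompactSupport hf.hasCompactSupport

/-- The factor a is the L² normalization of the dilation; it gives the shape a W(a) required by the
regularized sums. -/
theorem IsTestFunction.inner_dilation_symplecticFourier (hf : IsTestFunction f) {a : ℝ}
    (ha : a ≠ 0) :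
    inner ℂ (hf.memLp.toLp f) (dilation ha (symplecticFourier (hf.memLp.toLp f))) =
      (a : ℂ) * dilateCorrelation f (𝓕 f) a := by
  set g : 𝓢(ℂ, ℂ) := hf.hasCompactSupport.toSchwartzMap hf.contDiff with hg
  have hgf : (g : ℂ → ℂ) = f := rfl
  have h1 : hf.memLp.toLp f = g.toLp 2 := rfl
  rw [L2.inner_def, dilateCorrelation, ← integral_const_mul]
  refine integral_congr_ae ?_
  have h2 := coeFn_symplecticFourier g
  rw [← h1, hgf] at h2
  filter_upwards [hf.memLp.coeFn_toLp, coeFn_dilation ha (symplecticFourier (hf.memLp.toLp f)),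
    (quasiMeasurePreserving_smul_complex ha).ae h2] with v h3 h4 h5
  rw [h3, h4, h5, RCLike.inner_apply]
  ring

/-- The off-diagonal part of the second moment is the limit of matrix coefficients of isometries:
apply the totient limit to w the pair correlation and W its Fourier transform. -/
theorem IsTestFunction.tendsto_inner_regularizedOperator (hf : IsTestFunction f) :
    Tendsto (fun ε => inner ℂ (hf.memLp.toLp f) (regularizedOperator ε (hf.memLp.toLp f)))
      (𝓝[>] 0) (𝓝 (∑' k : ℕ, ((Nat.totient (k + 1) : ℂ) / (k + 1 : ℂ)) *
        pairCorrelation f (k + 1))) := by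
  set g : 𝓢(ℂ, ℂ) := hf.hasCompactSupport.toSchwartzMap hf.contDiff with hg
  have hgf : ((𝓕 g : 𝓢(ℂ, ℂ)) : ℂ → ℂ) = 𝓕 f := SchwartzMap.fourier_coe g
  obtain ⟨C, hC⟩ := hf.exists_quadraticDecay (𝓕 g) (fun x => by rw [hgf, fourier_even hf.even]) (by
    rw [hgf, Real.fourier_eq]
    simpa using hf.integral_eq_zero)
  rw [hgf] at hC
  have h1 := hC.tendsto_regularized_totient hf.continuous_pairCorrelation
    hf.hasCompactSupport_pairCorrelation hf.pairCorrelation_neg hf.fourier_pairCorrelation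
  refine h1.congr' ?_
  filter_upwards [self_mem_nhdsWithin] with ε hε
  rw [inner_regularizedOperator_eq (G := fun a => (a : ℂ) * dilateCorrelation f (𝓕 f) a) hε
    fun a ha _ => hf.inner_dilation_symplecticFourier ha]

/-- The second moment of the Siegel--Veech transform in terms of the regularized operators. -/
theorem IsTestFunction.tendsto_second_moment (hf : IsTestFunction f) :
    Tendsto (fun ε => 4 * (((‖hf.memLp.toLp f‖ ^ 2 : ℝ) : ℂ) +
        inner ℂ (hf.memLp.toLp f) (regularizedOperator ε (hf.memLp.toLp f))))
      (𝓝[>] 0) (𝓝 ((∫ z, ‖latticeSum f z‖ ^ 2 ∂fdMeasure : ℝ) : ℂ)) := by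
  have h1 : ‖hf.memLp.toLp f‖ ^ 2 = ∫ u, ‖f u‖ ^ 2 := by
    rw [norm_sq_eq_integral]
    refine integral_congr_ae ?_
    filter_upwards [hf.memLp.coeFn_toLp] with v hv
    rw [hv]
  rw [h1, hf.integral_latticeSum]
  exact (hf.tendsto_inner_regularizedOperator.const_add _).const_mul _

/-- Cauchy–Schwarz and isometry bound the regularized coefficient by ‖f‖² for every ε, so the
constant is 4(1 + 1). -/
theorem IsTestFunction.integral_latticeSum_le (hf : IsTestFunction f) :
    ∫ z, ‖latticeSum f z‖ ^ 2 ∂fdMeasure ≤ 8 * ‖hf.memLp.toLp f‖ ^ 2 := by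
  have h1 := hf.tendsto_second_moment.norm
  rw [Complex.norm_real, Real.norm_of_nonneg (integral_nonneg fun _ => by positivity)] at h1
  refine le_of_tendsto h1 (Eventually.of_forall fun ε => ?_)
  rw [norm_mul]
  have h2 : ‖inner ℂ (hf.memLp.toLp f) (regularizedOperator ε (hf.memLp.toLp f))‖ ≤
      ‖hf.memLp.toLp f‖ ^ 2 := by
    refine (norm_inner_le_norm _ _).trans (le_of_eq ?_)
    rw [norm_regularizedOperator, sq]
  have h3 := norm_add_le (((‖hf.memLp.toLp f‖ ^ 2 : ℝ) : ℂ))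
    (inner ℂ (hf.memLp.toLp f) (regularizedOperator ε (hf.memLp.toLp f)))
  rw [Complex.norm_real, Real.norm_of_nonneg (sq_nonneg _)] at h3
  have h4 : ‖(4 : ℂ)‖ = 4 := by norm_num
  rw [h4]
  linarith

end SecondMoment

end SiegelVeech

namespace SiegelVeech

/-! ### Approximation by test functions -/

section Approximation

open Filter Topology
open scoped ComplexConjugate

variable {f : ℂ → ℂ}

theorem contDiffBump_neg (b : ContDiffBump (0 : ℂ)) (v : ℂ) : b (-v) = b v := by
  simpa using b.neg v

/-- A smooth even function supported in an annulus with integral one. -/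
theorem exists_annulus_bump : ∃ β : ℂ → ℂ, ContDiff ℝ ∞ β ∧ (∀ v, β v ≠ 0 → 1 ≤ ‖v‖ ∧ ‖v‖ ≤ 4) ∧
    (∀ v, β (-v) = β v) ∧ ∫ v, β v = 1 := by
  let b₁ : ContDiffBump (0 : ℂ) := ⟨1, 2, by norm_num, by norm_num⟩
  let b₂ : ContDiffBump (0 : ℂ) := ⟨3, 4, by norm_num, by norm_num⟩
  set φ : ℂ → ℝ := fun v => b₂ v * (1 - b₁ v) with hφ
  have hφc : ContDiff ℝ ∞ φ := b₂.contDiff.mul (contDiff_const.sub b₁.contDiff)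
  have hsupp : ∀ v, φ v ≠ 0 → 1 ≤ ‖v‖ ∧ ‖v‖ ≤ 4 := by
    intro v hv
    constructor
    · by_contra! h
      refine right_ne_zero_of_mul hv ?_
      rw [b₁.one_of_mem_closedBall (by simpa [b₁] using h.le), sub_self]
    · by_contra! h
      exact left_ne_zero_of_mul hv (b₂.zero_of_le_dist (by simpa [b₂] using h.le))
  have hcs : HasCompactSupport φ :=
    HasCompactSupport.intro (isCompact_closedBall (0 : ℂ) 4) fun v hv => by
      by_contra h
      exact hv (by simpa using (hsupp v h).2)
  have hpos : 0 < ∫ v, φ v := by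
    refine hφc.continuous.integral_pos_of_hasCompactSupport_nonneg_nonzero hcs
      (fun v => mul_nonneg b₂.nonneg (sub_nonneg.mpr b₁.le_one)) (x := (5 / 2 : ℝ)) ?_
    have h1 : b₁ ((5 / 2 : ℝ) : ℂ) = 0 := b₁.zero_of_le_dist (by
      simp only [dist_zero_right, Complex.norm_real]; norm_num [b₁])
    have h2 : b₂ ((5 / 2 : ℝ) : ℂ) = 1 := b₂.one_of_mem_closedBall (by
      simp only [mem_closedBall_zero_iff, Complex.norm_real]; norm_num [b₂])
    simp only [hφ, h1, h2]
    norm_num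
  refine ⟨fun v => ((∫ v, φ v : ℝ)⁻¹ * φ v : ℝ), ?_, fun v hv => hsupp v ?_, fun v => ?_, ?_⟩
  · exact Complex.ofRealCLM.contDiff.comp (contDiff_const.mul hφc)
  · intro h
    simp [h] at hv
  · simp only [hφ, contDiffBump_neg]
  · rw [integral_complex_ofReal, integral_const_mul, inv_mul_cancel₀ hpos.ne', Complex.ofReal_one]

/-- Even continuous compactly supported functions of mean zero are boundedly approximated by test
functions. -/
theorem exists_testFunction_seq (hf : Continuous f) (hs : HasCompactSupport f)
    (he : ∀ v, f (-v) = f v) (h0 : ∫ v, f v = 0) :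
    ∃ F : ℕ → ℂ → ℂ, (∀ n, IsTestFunction (F n)) ∧
      (∀ v, v ≠ 0 → Tendsto (fun n => F n v) atTop (𝓝 (f v))) ∧
      ∃ B R, ∀ n v, ‖F n v‖ ≤ Set.indicator (Metric.closedBall 0 R) (fun _ => B) v := by
  obtain ⟨β, hβ, hβs, hβe, hβi⟩ := exists_annulus_bump
  obtain ⟨R, hR0, hR⟩ := hs.isBounded.exists_pos_norm_le
  obtain ⟨B, hB⟩ := hs.exists_bound_of_continuous hf
  have hRs : ∀ v, R < ‖v‖ → f v = 0 := fun v hv => by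
    by_contra h
    exact absurd (hR v (subset_tsupport f h)) (not_le.mpr hv)
  have hβcs : HasCompactSupport β :=
    HasCompactSupport.intro (isCompact_closedBall (0 : ℂ) 4) fun v hv => by
      by_contra h
      exact hv (by simpa using (hβs v h).2)
  obtain ⟨B', hB'⟩ := hβcs.exists_bound_of_continuous hβ.continuous
  have hB0 : 0 ≤ B := (norm_nonneg _).trans (hB 0)
  have hB0' : 0 ≤ B' := (norm_nonneg _).trans (hB' 0)
  choose g hgc hgd hgs using fun n : ℕ => hf.exists_contDiff_approx ⊤ (ε := fun _ => 1 / ((n : ℝ) + 1))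
    (by fun_prop) (fun _ => by positivity)
  let b : ∀ n : ℕ, ContDiffBump (0 : ℂ) := fun n =>
    ⟨1 / (2 * ((n : ℝ) + 1)), 1 / ((n : ℝ) + 1), by positivity, by
      apply one_div_lt_one_div_of_lt <;> nlinarith [(Nat.cast_nonneg n : (0 : ℝ) ≤ n)]⟩
  -- Symmetrize the smooth approximation of f, and cut it off on a shrinking ball around the origin.
  -- Pointwise convergence is therefore kept only away from 0.
  set h : ℕ → ℂ → ℂ := fun n v => ((1 - b n v : ℝ) : ℂ) * ((g n v + g n (-v)) / 2) with hh
  have hg0 : ∀ n v, R < ‖v‖ → g n v = 0 := fun n v hv => by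
    by_contra h
    exact hgs n h (hRs v hv)
  have hgB : ∀ n v, ‖g n v‖ ≤ B + 1 := fun n v => by
    have h1 := (hgd n v).le
    have h2 : 1 / ((n : ℝ) + 1) ≤ 1 := by
      rw [div_le_one (by positivity)]; linarith [(Nat.cast_nonneg n : (0 : ℝ) ≤ n)]
    rw [dist_eq_norm] at h1
    calc ‖g n v‖ = ‖f v + (g n v - f v)‖ := by congr 1; ring
      _ ≤ ‖f v‖ + ‖g n v - f v‖ := norm_add_le _ _
      _ ≤ B + 1 := add_le_add (hB v) (h1.trans h2)
  have hhB : ∀ n v, ‖h n v‖ ≤ Set.indicator (Metric.closedBall 0 R) (fun _ => B + 1) v := by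
    intro n v
    by_cases hv : v ∈ Metric.closedBall (0 : ℂ) R
    · rw [Set.indicator_of_mem hv, hh]
      simp only
      rw [norm_mul, norm_div, Complex.norm_real, Real.norm_of_nonneg (sub_nonneg.mpr (b n).le_one)]
      have h1 : ‖g n v + g n (-v)‖ ≤ (B + 1) + (B + 1) :=
        (norm_add_le _ _).trans (add_le_add (hgB n v) (hgB n _))
      have h2 : ‖(2 : ℂ)‖ = 2 := by norm_num
      rw [h2]
      calc (1 - b n v) * (‖g n v + g n (-v)‖ / 2) ≤ 1 * (((B + 1) + (B + 1)) / 2) := by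
            gcongr
            linarith [(b n).nonneg (x := v)]
        _ = B + 1 := by ring
    · rw [Set.indicator_of_notMem hv]
      have hv' : R < ‖v‖ := by simpa using hv
      simp [hh, hg0 n v hv', hg0 n (-v) (by simpa using hv')]
  have hhc : ∀ n, ContDiff ℝ ∞ (h n) := fun n => by
    refine ContDiff.mul (Complex.ofRealCLM.contDiff.comp (contDiff_const.sub (b n).contDiff)) ?_
    exact (((hgc n).add ((hgc n).comp contDiff_neg)).div_const 2)
  have hind : Integrable (Set.indicator (Metric.closedBall (0 : ℂ) R) (fun _ => B + 1)) :=
    (integrableOn_const (by exact (measure_closedBall_lt_top).ne)).integrable_indicator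
      measurableSet_closedBall
  have hht : ∀ v, v ≠ 0 → Tendsto (fun n => h n v) atTop (𝓝 (f v)) := by
    intro v hv
    have hone : Tendsto (fun n : ℕ => 1 / ((n : ℝ) + 1)) atTop (𝓝 0) :=
      tendsto_one_div_add_atTop_nhds_zero_nat
    have hg1 : ∀ w, Tendsto (fun n => g n w) atTop (𝓝 (f w)) := fun w =>
      tendsto_iff_dist_tendsto_zero.mpr (squeeze_zero (fun _ => dist_nonneg)
        (fun n => (hgd n w).le) hone)
    have hsum := ((hg1 v).add (hg1 (-v))).div_const 2
    rw [he, add_self_div_two] at hsum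
    refine hsum.congr' ?_
    filter_upwards [hone.eventually (gt_mem_nhds (norm_pos_iff.mpr hv))] with n hn
    have : b n v = 0 := (b n).zero_of_le_dist (by simpa [b] using hn.le)
    simp [hh, this]
  have hhi : Tendsto (fun n => ∫ v, h n v) atTop (𝓝 0) := by
    rw [← h0]
    refine tendsto_integral_of_dominated_convergence _
      (fun n => (hhc n).continuous.aestronglyMeasurable) hind (fun n => ae_of_all _ (hhB n)) ?_
    have : ∀ᵐ v : ℂ, v ≠ 0 := Measure.ae_ne volume 0
    filter_upwards [this] with v hv using hht v hv
  obtain ⟨D, hD⟩ := hhi.norm.bddAbove_range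
  have hD' : ∀ n, ‖∫ v, h n v‖ ≤ D := fun n => hD ⟨n, rfl⟩
  have hD0 : 0 ≤ D := (norm_nonneg _).trans (hD' 0)
  -- Mean zero is restored with a fixed even bump supported in an annulus; its coefficient tends to
  -- the integral of f, which is 0.
  set F : ℕ → ℂ → ℂ := fun n v => h n v - (∫ v, h n v) * β v with hF
  have hFB : ∀ n v, ‖F n v‖ ≤
      Set.indicator (Metric.closedBall 0 (R + 4)) (fun _ => (B + 1) + D * B') v := by
    intro n v
    by_cases hv : v ∈ Metric.closedBall (0 : ℂ) (R + 4)
    · rw [Set.indicator_of_mem hv, hF]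
      refine (norm_sub_le _ _).trans (add_le_add ((hhB n v).trans ?_) ?_)
      · exact Set.indicator_le_self' (fun _ _ => by positivity) v
      · rw [norm_mul]
        exact mul_le_mul (hD' n) (hB' v) (norm_nonneg _) hD0
    · rw [Set.indicator_of_notMem hv]
      have hv' : R + 4 < ‖v‖ := by simpa using hv
      have h1 : β v = 0 := by
        by_contra h
        linarith [(hβs v h).2]
      have h2 := hhB n v
      rw [Set.indicator_of_notMem (by simp; linarith)] at h2
      simp [hF, h1, norm_le_zero_iff.mp h2]
  refine ⟨F, fun n => ?_, fun v hv => ?_, _, _, hFB⟩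
  · have hFcs : HasCompactSupport (F n) :=
      HasCompactSupport.intro (isCompact_closedBall (0 : ℂ) (R + 4)) fun v hv => by
        have := hFB n v
        rwa [Set.indicator_of_notMem hv, norm_le_zero_iff] at this
    refine ⟨(hhc n).sub (contDiff_const.mul hβ), hFcs, ?_, fun v => ?_, ?_⟩
    · rw [notMem_tsupport_iff_eventuallyEq]
      have hmem : Metric.ball (0 : ℂ) (1 / (2 * ((n : ℝ) + 1))) ∈ 𝓝 (0 : ℂ) :=
        Metric.ball_mem_nhds _ (by positivity)
      filter_upwards [hmem] with v hv
      have hv' : ‖v‖ < 1 / (2 * ((n : ℝ) + 1)) := by simpa using hv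
      have h1 : b n v = 1 := (b n).one_of_mem_closedBall (by simpa [b] using hv'.le)
      have h2 : β v = 0 := by
        by_contra h
        have h3 := (hβs v h).1
        have h4 : 1 / (2 * ((n : ℝ) + 1)) ≤ 1 := by
          rw [div_le_one (by positivity)]; linarith [(Nat.cast_nonneg n : (0 : ℝ) ≤ n)]
        linarith
      simp [hF, hh, h1, h2]
    · simp only [hF, hh, hβe, contDiffBump_neg, neg_neg]
      rw [add_comm (g n (-v))]
    · have h1 : Integrable (h n) := hind.mono' (hhc n).continuous.aestronglyMeasurable
        (ae_of_all _ (hhB n))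
      have h2 : Integrable β := hβ.continuous.integrable_of_hasCompactSupport hβcs
      simp only [hF]
      rw [integral_sub h1 (h2.const_mul _), integral_const_mul, hβi, mul_one, sub_self]
  · have := (hht v hv).sub (hhi.mul_const (β v))
    simpa using this

end Approximation

end SiegelVeech

namespace SiegelVeech

/-! ### The L² bound for mean-zero functions -/

section Bound

open Filter Topology
open scoped ComplexConjugate

variable {f : ℂ → ℂ}

/-- The approximating test functions converge only away from the origin, and primitive vectors avoid
it. -/
theorem latticeVec_ne_zero (p : CoprimePair) (τ : ℍ) (θ : ℝ) : latticeVec p.1 τ θ ≠ 0 := by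
  intro h
  rw [← planeToComplex_rowVec_iwasawa, LinearIsometryEquiv.map_eq_zero_iff] at h
  have h0 : rowVec (iwasawa τ θ) (0 : ℤ × ℤ).1 (0 : ℤ × ℤ).2 = 0 := by
    ext i
    fin_cases i <;> simp [rowVec]
  have h1 := rowVec_injective (iwasawa τ θ) (h.trans h0.symm)
  have h2 := p.2
  rw [h1] at h2
  exact not_isCoprime_zero_zero h2

theorem tendsto_latticeSum {F : ℕ → ℂ → ℂ} {B R : ℝ}
    (hF : ∀ v, v ≠ 0 → Tendsto (fun n => F n v) atTop (𝓝 (f v)))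
    (hB : ∀ n v, ‖F n v‖ ≤ Set.indicator (Metric.closedBall 0 R) (fun _ => B) v) (z : ℍ × ℝ) :
    Tendsto (fun n => latticeSum (F n) z) atTop (𝓝 (latticeSum f z)) := by
  refine tendsto_tsum_of_dominated_convergence (bound := fun p : CoprimePair =>
    Set.indicator (Metric.closedBall 0 R) (fun _ => B) (latticeVec p.1 z.1 z.2)) ?_
    (fun p => hF _ (latticeVec_ne_zero p z.1 z.2)) (Eventually.of_forall fun n p => hB n _)
  have hs : HasCompactSupport (Set.indicator (Metric.closedBall (0 : ℂ) R) (fun _ => (B : ℂ))) :=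
    HasCompactSupport.intro (isCompact_closedBall (0 : ℂ) R) fun v hv =>
      Set.indicator_of_notMem hv _
  refine summable_of_hasFiniteSupport ((finite_support_latticeVec hs z.1 z.2).subset fun p hp => ?_)
  rw [Function.mem_support] at hp ⊢
  intro h
  apply hp
  by_cases hv : latticeVec p.1 z.1 z.2 ∈ Metric.closedBall (0 : ℂ) R
  · rw [Set.indicator_of_mem hv] at h ⊢
    exact_mod_cast h
  · rw [Set.indicator_of_notMem hv]

theorem eLpNorm_two_sq {α : Type*} [MeasurableSpace α] (μ : Measure α) (f : α → ℂ) :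
    eLpNorm f 2 μ ^ 2 = ∫⁻ x, ‖f x‖ₑ ^ 2 ∂μ := by
  have := eLpNorm_nnreal_pow_eq_lintegral (μ := μ) (f := f) (p := 2) two_ne_zero
  simpa using this

theorem ofReal_integral_norm_sq {α : Type*} [MeasurableSpace α] {μ : Measure α} {f : α → ℂ}
    (hf : MemLp f 2 μ) : ENNReal.ofReal (∫ x, ‖f x‖ ^ 2 ∂μ) = eLpNorm f 2 μ ^ 2 := by
  rw [eLpNorm_two_sq, ofReal_integral_eq_lintegral_ofReal ((memLp_two_iff_integrable_sq_norm hf.1).mp hf)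
    (ae_of_all _ fun _ => by positivity)]
  refine lintegral_congr fun x => ?_
  rw [ENNReal.ofReal_pow (norm_nonneg _), ofReal_norm]

theorem IsTestFunction.memLp_latticeSum (hf : IsTestFunction f) :
    MemLp (latticeSum f) 2 fdMeasure := by
  refine ⟨(continuous_latticeSum hf.continuous hf.hasCompactSupport).aestronglyMeasurable, ?_⟩
  have h1 := hf.lintegral_latticeSum_lt_top
  rw [← eLpNorm_two_sq] at h1
  by_contra h
  rw [not_lt, top_le_iff] at h
  simp [h] at h1

theorem IsTestFunction.eLpNorm_latticeSum_le (hf : IsTestFunction f) :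
    eLpNorm (latticeSum f) 2 fdMeasure ^ 2 ≤ 8 * eLpNorm f 2 volume ^ 2 := by
  rw [← ofReal_integral_norm_sq hf.memLp_latticeSum, ← ofReal_integral_norm_sq hf.memLp]
  have h1 := hf.integral_latticeSum_le
  have h2 : ‖hf.memLp.toLp f‖ ^ 2 = ∫ u, ‖f u‖ ^ 2 := by
    rw [norm_sq_eq_integral]
    refine integral_congr_ae ?_
    filter_upwards [hf.memLp.coeFn_toLp] with v hv
    rw [hv]
  rw [h2] at h1
  refine (ENNReal.ofReal_le_ofReal h1).trans (le_of_eq ?_)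
  rw [ENNReal.ofReal_mul (by norm_num)]
  simp

/-- Fatou's lemma on the lattice side, dominated convergence on the plane. -/
theorem eLpNorm_latticeSum_le_of_even (hf : Continuous f) (hs : HasCompactSupport f)
    (he : ∀ v, f (-v) = f v) (h0 : ∫ v, f v = 0) :
    eLpNorm (latticeSum f) 2 fdMeasure ^ 2 ≤ 8 * eLpNorm f 2 volume ^ 2 := by
  obtain ⟨F, hF, hlim, B, R, hB⟩ := exists_testFunction_seq hf hs he h0
  have h1 : ∀ z, ‖latticeSum f z‖ₑ ^ 2 = liminf (fun n => ‖latticeSum (F n) z‖ₑ ^ 2) atTop := fun z =>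
    (((ENNReal.continuous_pow 2).tendsto _).comp
      (tendsto_latticeSum hlim hB z).enorm).liminf_eq.symm
  have h2 : Tendsto (fun n => ∫⁻ v, ‖F n v‖ₑ ^ 2) atTop (𝓝 (∫⁻ v, ‖f v‖ₑ ^ 2)) := by
    refine tendsto_lintegral_of_dominated_convergence
      (Set.indicator (Metric.closedBall 0 R) fun _ => ENNReal.ofReal B ^ 2)
      (fun n => ((hF n).continuous.enorm.measurable.pow_const 2)) (fun n => ae_of_all _ fun v => ?_) ?_ ?_
    · have := hB n v
      beta_reduce
      by_cases hv : v ∈ Metric.closedBall (0 : ℂ) R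
      · rw [Set.indicator_of_mem hv] at this ⊢
        rw [← ofReal_norm]
        gcongr
      · rw [Set.indicator_of_notMem hv] at this ⊢
        rw [norm_le_zero_iff.mp this]
        simp
    · rw [lintegral_indicator measurableSet_closedBall, setLIntegral_const]
      exact ENNReal.mul_ne_top (by simp) measure_closedBall_lt_top.ne
    · filter_upwards [Measure.ae_ne volume 0] with v hv
      exact ((ENNReal.continuous_pow 2).tendsto _).comp (hlim v hv).enorm
  calc eLpNorm (latticeSum f) 2 fdMeasure ^ 2
      = ∫⁻ z, liminf (fun n => ‖latticeSum (F n) z‖ₑ ^ 2) atTop ∂fdMeasure := by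
        rw [eLpNorm_two_sq]
        exact lintegral_congr h1
    _ ≤ liminf (fun n => ∫⁻ z, ‖latticeSum (F n) z‖ₑ ^ 2 ∂fdMeasure) atTop :=
        lintegral_liminf_le fun n => ((continuous_latticeSum (hF n).continuous
          (hF n).hasCompactSupport).enorm.measurable.pow_const 2)
    _ ≤ liminf (fun n => 8 * ∫⁻ v, ‖F n v‖ₑ ^ 2) atTop := by
        refine liminf_le_liminf (Eventually.of_forall fun n => ?_)
        simp only [← eLpNorm_two_sq]
        exact (hF n).eLpNorm_latticeSum_le
    _ = 8 * eLpNorm f 2 volume ^ 2 := by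
        rw [eLpNorm_two_sq]
        exact (ENNReal.Tendsto.const_mul h2 (Or.inr (by simp))).liminf_eq

/-- The even part of a function. -/
noncomputable def evenPart (f : ℂ → ℂ) (v : ℂ) : ℂ := (f v + f (-v)) / 2

theorem transform_add {f g : Plane → ℂ} (hf : HasCompactSupport f) (hg : HasCompactSupport g) :
    transform (f + g) = transform f + transform g := by
  funext x
  induction x using Quotient.ind with
  | _ a =>
    have h1 : Summable fun p : CoprimePair => f (rowVec a p.1.1 p.1.2) :=
      summable_of_hasFiniteSupport (finite_support_rowVec hf a)
    have h2 : Summable fun p : CoprimePair => g (rowVec a p.1.1 p.1.2) :=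
      summable_of_hasFiniteSupport (finite_support_rowVec hg a)
    change transform (f + g) (H0.mk a) = transform f (H0.mk a) + transform g (H0.mk a)
    rw [transform_mk, transform_mk, transform_mk]
    exact h1.tsum_add h2

theorem transform_smul (c : ℂ) (f : Plane → ℂ) : transform (c • f) = c • transform f := by
  funext x
  exact tsum_mul_left

theorem transform_comp_neg (f : Plane → ℂ) : transform (fun v => f (-v)) = transform f := by
  funext x
  induction x using Quotient.ind with
  | _ a =>
    change transform (fun v => f (-v)) (H0.mk a) = transform f (H0.mk a)
    rw [transform_mk, transform_mk,
      ← negEquiv.tsum_eq fun p : CoprimePair => f (rowVec a p.1.1 p.1.2)]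
    refine tsum_congr fun p => congrArg f ?_
    ext i
    fin_cases i <;> simp [rowVec, negEquiv] <;> ring

theorem transform_evenPart (hs : HasCompactSupport f) :
    transform (evenPart f ∘ planeToComplex) = transform (f ∘ planeToComplex) := by
  have hs' := hs.comp_homeomorph planeToComplex.toHomeomorph
  have h1 : evenPart f ∘ planeToComplex = (1 / 2 : ℂ) • ((f ∘ planeToComplex) +
      fun v => (f ∘ planeToComplex) (-v)) := by
    funext v
    simp [evenPart]
    ring
  rw [h1, transform_smul, transform_add (f := f ∘ planeToComplex)
    (g := fun v => (f ∘ planeToComplex) (-v)) hs' (hs'.comp_homeomorph (Homeomorph.neg Plane)),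
    transform_comp_neg, ← two_smul ℂ, smul_smul]
  norm_num

theorem latticeSum_evenPart (hs : HasCompactSupport f) (z : ℍ × ℝ) :
    latticeSum (evenPart f) z = latticeSum f z := by
  rw [latticeSum, latticeSum, ← transform_mk_iwasawa, ← transform_mk_iwasawa, transform_evenPart hs]

theorem continuous_evenPart (hf : Continuous f) : Continuous (evenPart f) :=
  (hf.add (hf.comp continuous_neg)).div_const 2

theorem hasCompactSupport_evenPart (hs : HasCompactSupport f) : HasCompactSupport (evenPart f) :=
  (hs.add (hs.comp_homeomorph (Homeomorph.neg ℂ))).comp_left (g := fun x : ℂ => x / 2) (zero_div 2)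

theorem evenPart_neg (f : ℂ → ℂ) (v : ℂ) : evenPart f (-v) = evenPart f v := by
  rw [evenPart, evenPart, neg_neg, add_comm]

theorem integral_evenPart (hf : Integrable f) : ∫ v, evenPart f v = ∫ v, f v := by
  simp only [evenPart]
  rw [integral_div, integral_add hf hf.comp_neg, integral_neg_eq_self, add_self_div_two]

theorem eLpNorm_evenPart_le (hf : AEStronglyMeasurable f) :
    eLpNorm (evenPart f) 2 volume ≤ eLpNorm f 2 volume := by
  have hmp : MeasurePreserving (fun v : ℂ => -v) := Measure.measurePreserving_neg volume
  have h1 : evenPart f = (1 / 2 : ℂ) • (f + f ∘ fun v => -v) := by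
    funext v
    simp [evenPart]
    ring
  have h2 : eLpNorm (f ∘ fun v => -v) 2 volume = eLpNorm f 2 volume :=
    eLpNorm_comp_measurePreserving hf hmp
  rw [h1, eLpNorm_const_smul]
  have h3 := eLpNorm_add_le hf (hf.comp_measurePreserving hmp) (p := 2) (by norm_num)
  rw [h2] at h3
  calc ‖(1 / 2 : ℂ)‖ₑ * eLpNorm (f + f ∘ fun v => -v) 2 volume
      ≤ ‖(1 / 2 : ℂ)‖ₑ * (eLpNorm f 2 volume + eLpNorm f 2 volume) := by gcongr
    _ = eLpNorm f 2 volume := by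
      rw [← two_mul, ← mul_assoc]
      have : ‖(1 / 2 : ℂ)‖ₑ * 2 = 1 := by
        rw [← ofReal_norm, ← ENNReal.ofReal_ofNat, ← ENNReal.ofReal_mul (norm_nonneg _)]
        norm_num
      rw [this, one_mul]

/-- The Siegel--Veech transform is bounded in `L²`. -/
theorem eLpNorm_latticeSum_le (hf : Continuous f) (hs : HasCompactSupport f) (h0 : ∫ v, f v = 0) :
    eLpNorm (latticeSum f) 2 fdMeasure ^ 2 ≤ 8 * eLpNorm f 2 volume ^ 2 := by
  have h1 : latticeSum f = latticeSum (evenPart f) := funext fun z => (latticeSum_evenPart hs z).symm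
  rw [h1]
  refine (eLpNorm_latticeSum_le_of_even (continuous_evenPart hf) (hasCompactSupport_evenPart hs)
    (evenPart_neg f) ?_).trans ?_
  · rw [integral_evenPart (hf.integrable_of_hasCompactSupport hs), h0]
  · gcongr
    exact eLpNorm_evenPart_le hf.aestronglyMeasurable

end Bound

end SiegelVeech

namespace SiegelVeech

/-! ### Extension to a bounded operator on L² -/

section Operator

open Filter Topology
open scoped ComplexConjugate

variable {f : ℂ → ℂ}

/-- The rescaling a² β(a ·) keeps the integral and multiplies the L² norm by a. The integral is thus
not L²-continuous, which makes mean-zero functions dense. -/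
theorem exists_wide_bump {δ : ℝ} (hδ : 0 < δ) : ∃ (ψ : ℂ → ℂ) (_ : Continuous ψ)
    (_ : HasCompactSupport ψ) (hm : MemLp ψ 2), ∫ v, ψ v = 1 ∧ ‖hm.toLp ψ‖ ≤ δ := by
  obtain ⟨β, hβ, hβs, hβe, hβi⟩ := exists_annulus_bump
  have hβcs : HasCompactSupport β :=
    HasCompactSupport.intro (isCompact_closedBall (0 : ℂ) 4) fun v hv => by
      by_contra h
      exact hv (by simpa using (hβs v h).2)
  have hβm : MemLp β 2 := hβ.continuous.memLp_of_hasCompactSupport hβcs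
  set N := ‖hβm.toLp β‖ with hN
  have hN0 : 0 ≤ N := norm_nonneg _
  -- Makes a N ≤ δ; the 1 guards against division by zero.
  set a : ℝ := δ / (N + 1) with ha
  have ha0 : 0 < a := by positivity
  have hc : Continuous fun v : ℂ => (a : ℂ) * ((a : ℂ) * β (a • v)) := by
    have := hβ.continuous
    fun_prop
  have hcs : HasCompactSupport fun v : ℂ => (a : ℂ) * ((a : ℂ) * β (a • v)) :=
    ((hβcs.comp_homeomorph (Homeomorph.smulOfNeZero a ha0.ne')).mul_left).mul_left
  have hm : MemLp (fun v : ℂ => (a : ℂ) * ((a : ℂ) * β (a • v))) 2 :=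
    hc.memLp_of_hasCompactSupport hcs
  refine ⟨_, hc, hcs, hm, ?_, ?_⟩
  · rw [integral_const_mul, integral_const_mul, Measure.integral_comp_smul, hβi,
      Complex.finrank_real_complex, abs_of_pos (by positivity), Complex.real_smul]
    have : (a : ℂ) ≠ 0 := by exact_mod_cast ha0.ne'
    push_cast
    field_simp
  · have h1 : hm.toLp _ = (a : ℂ) • dilation ha0.ne' (hβm.toLp β) := by
      refine Lp.ext ?_
      filter_upwards [hm.coeFn_toLp, Lp.coeFn_smul (a : ℂ) (dilation ha0.ne' (hβm.toLp β)),
        coeFn_dilation ha0.ne' (hβm.toLp β),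
        (quasiMeasurePreserving_smul_complex ha0.ne').ae hβm.coeFn_toLp] with v h1 h2 h3 h4
      rw [h1, h2, Pi.smul_apply, h3, h4, smul_eq_mul]
    rw [h1, norm_smul, LinearIsometryEquiv.norm_map, Complex.norm_real,
      Real.norm_of_nonneg ha0.le, ← hN, ha, div_mul_eq_mul_div, div_le_iff₀ (by positivity)]
    nlinarith

/-- Continuous compactly supported functions of mean zero. -/
def meanZero : Submodule ℂ (ℂ → ℂ) where
  carrier := {f | Continuous f ∧ HasCompactSupport f ∧ ∫ v, f v = 0}
  add_mem' := by
    rintro f g ⟨h1, h2, h3⟩ ⟨h4, h5, h6⟩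
    refine ⟨h1.add h4, h2.add h5, ?_⟩
    have := integral_add (h1.integrable_of_hasCompactSupport h2 (μ := volume))
      (h4.integrable_of_hasCompactSupport h5)
    rw [h3, h6, add_zero] at this
    exact this
  zero_mem' := ⟨continuous_zero, HasCompactSupport.zero, by simp⟩
  smul_mem' := by
    rintro c f ⟨h1, h2, h3⟩
    refine ⟨h1.const_smul c, h2.smul_left (f := fun _ => c), ?_⟩
    have := integral_smul c f (μ := volume)
    rw [h3, smul_zero] at this
    exact this

theorem memLp_of_mem_meanZero (hf : f ∈ meanZero) : MemLp f 2 :=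
  hf.1.memLp_of_hasCompactSupport hf.2.1

/-- Approximate by a smooth compactly supported function, then remove its integral with a wide bump
of small L² norm. -/
theorem exists_meanZero_approx (h : L2C) {δ : ℝ} (hδ : 0 < δ) :
    ∃ (f : ℂ → ℂ) (hf : f ∈ meanZero), ‖h - (memLp_of_mem_meanZero hf).toLp f‖ < δ := by
  obtain ⟨g, ⟨g', hgg, hcs, hsm⟩, hg⟩ := (Lp.dense_hasCompactSupport_contDiff
    (F := ℂ) (μ := (volume : Measure ℂ)) (p := 2) ENNReal.ofNat_ne_top).exists_dist_lt h (half_pos hδ)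
  set I := ∫ v, g' v with hI
  obtain ⟨ψ, hψ, hψs, hψm, hψi, hψn⟩ := exists_wide_bump
    (δ := δ / 2 / (‖I‖ + 1)) (by positivity)
  have hmem : (g' - I • ψ) ∈ meanZero := by
    refine ⟨hsm.continuous.sub (hψ.const_smul I), hcs.sub (hψs.smul_left (f := fun _ => I)), ?_⟩
    have := integral_sub (hsm.continuous.integrable_of_hasCompactSupport hcs (μ := volume))
      ((hψ.integrable_of_hasCompactSupport hψs).smul I)
    have h2 : ∫ v, (I • ψ) v = I := by
      refine (integral_smul I ψ).trans ?_
      rw [hψi, smul_eq_mul, mul_one]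
    rw [h2, ← hI, sub_self] at this
    exact this
  have hg'm : MemLp g' 2 := hsm.continuous.memLp_of_hasCompactSupport hcs
  refine ⟨_, hmem, ?_⟩
  have e1 : (memLp_of_mem_meanZero hmem).toLp (g' - I • ψ) = hg'm.toLp g' - I • hψm.toLp ψ := rfl
  have e2 : hg'm.toLp g' = g := by
    refine Lp.ext ?_
    filter_upwards [hg'm.coeFn_toLp, hgg] with v h1 h2
    rw [h1, h2]
  rw [e1, e2, ← sub_add]
  have h3 : ‖I • hψm.toLp ψ‖ ≤ δ / 2 := by
    rw [norm_smul]
    calc ‖I‖ * ‖hψm.toLp ψ‖ ≤ ‖I‖ * (δ / 2 / (‖I‖ + 1)) := by gcongr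
      _ ≤ δ / 2 := by
        rw [← mul_div_assoc, div_le_iff₀ (by positivity)]
        nlinarith [norm_nonneg I]
  rw [dist_eq_norm] at hg
  calc _ ≤ ‖h - g‖ + ‖I • hψm.toLp ψ‖ := norm_add_le _ _
    _ < δ := by linarith

/-- The inclusion of `meanZero` into `L²`. -/
noncomputable def meanZeroToLp : meanZero →ₗ[ℂ] L2C where
  toFun f := (memLp_of_mem_meanZero f.2).toLp f.1
  map_add' _ _ := rfl
  map_smul' _ _ := rfl

theorem denseRange_meanZeroToLp : DenseRange meanZeroToLp := by
  intro h
  refine Metric.mem_closure_iff.mpr fun δ hδ => ?_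
  obtain ⟨f, hf, hd⟩ := exists_meanZero_approx h hδ
  exact ⟨_, ⟨⟨f, hf⟩, rfl⟩, by rw [dist_eq_norm]; exact hd⟩

theorem continuous_transform_comp (hf : f ∈ meanZero) :
    Continuous (transform (f ∘ planeToComplex)) :=
  continuous_transform (hf.1.comp planeToComplex.continuous)
    (hf.2.1.comp_homeomorph planeToComplex.toHomeomorph)

theorem eLpNorm_transform (hf : f ∈ meanZero) :
    eLpNorm (transform (f ∘ planeToComplex)) 2 muH0 = eLpNorm (latticeSum f) 2 fdMeasure := by
  have h1 : latticeSum f = transform (f ∘ planeToComplex) ∘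
      fun p : ℍ × ℝ => H0.mk (iwasawa p.1 p.2) := by
    funext z
    exact (transform_mk_iwasawa f z.1 z.2).symm
  rw [h1]
  exact eLpNorm_map_measure (continuous_transform_comp hf).aestronglyMeasurable
    continuous_mk_iwasawa.aemeasurable

theorem memLp_transform (hf : f ∈ meanZero) : MemLp (transform (f ∘ planeToComplex)) 2 muH0 := by
  refine ⟨(continuous_transform_comp hf).aestronglyMeasurable, ?_⟩
  rw [eLpNorm_transform hf]
  have h1 := eLpNorm_latticeSum_le hf.1 hf.2.1 hf.2.2
  have h2 : 8 * eLpNorm f 2 volume ^ 2 < ⊤ :=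
    ENNReal.mul_lt_top (by simp) (ENNReal.pow_lt_top (memLp_of_mem_meanZero hf).2)
  by_contra h
  rw [not_lt, top_le_iff] at h
  simp [h] at h1
  rw [h1] at h2
  exact lt_irrefl _ h2

/-- The Siegel--Veech transform on `meanZero`. -/
noncomputable def meanZeroTransform : meanZero →ₗ[ℂ] L2H0 where
  toFun f := (memLp_transform f.2).toLp _
  map_add' f g := by
    rw [← MemLp.toLp_add]
    refine MemLp.toLp_congr _ _ (ae_of_all _ fun x => ?_)
    have := transform_add (f.2.2.1.comp_homeomorph planeToComplex.toHomeomorph)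
      (g.2.2.1.comp_homeomorph planeToComplex.toHomeomorph)
    exact congrFun this x
  map_smul' c f := by
    rw [RingHom.id_apply, ← MemLp.toLp_const_smul]
    refine MemLp.toLp_congr _ _ (ae_of_all _ fun x => ?_)
    exact congrFun (transform_smul c (f.1 ∘ planeToComplex)) x

/-- The constant uses only 8 ≤ 3². -/
theorem norm_meanZeroTransform_le (f : meanZero) :
    ‖meanZeroTransform f‖ ≤ 3 * ‖meanZeroToLp f‖ := by
  have h1 := eLpNorm_latticeSum_le f.2.1 f.2.2.1 f.2.2.2
  rw [← eLpNorm_transform f.2] at h1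
  have h2 : ‖meanZeroTransform f‖ = (eLpNorm (transform (f.1 ∘ planeToComplex)) 2 muH0).toReal :=
    Lp.norm_toLp (transform (f.1 ∘ planeToComplex)) (memLp_transform f.2)
  have h3 : ‖meanZeroToLp f‖ = (eLpNorm f.1 2 volume).toReal :=
    Lp.norm_toLp _ (memLp_of_mem_meanZero f.2)
  have h4 : ‖meanZeroTransform f‖ ^ 2 ≤ 8 * ‖meanZeroToLp f‖ ^ 2 := by
    rw [h2, h3, ← ENNReal.toReal_pow, ← ENNReal.toReal_pow]
    have := ENNReal.toReal_mono (ENNReal.mul_ne_top (by simp)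
      (ENNReal.pow_ne_top (memLp_of_mem_meanZero f.2).2.ne)) h1
    simpa using this
  nlinarith [norm_nonneg (meanZeroTransform f), norm_nonneg (meanZeroToLp f)]

/-- The Siegel--Veech transform on `L²(ℂ)`. -/
noncomputable def complexTransform : L2C →L[ℂ] L2H0 :=
  meanZeroTransform.extendOfNorm meanZeroToLp

theorem complexTransform_toLp (hf : f ∈ meanZero) :
    complexTransform ((memLp_of_mem_meanZero hf).toLp f) = (memLp_transform hf).toLp _ :=
  LinearMap.extendOfNorm_eq denseRange_meanZeroToLp ⟨3, norm_meanZeroTransform_le⟩ ⟨f, hf⟩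

/-- The reflection `f ↦ f(-·)` of `L²(ℂ)`. -/
noncomputable def reflection : L2C →ₗᵢ[ℂ] L2C :=
  Lp.compMeasurePreservingₗᵢ ℂ _ (Measure.measurePreserving_neg (volume : Measure ℂ))

theorem coeFn_reflection (f : L2C) : reflection f =ᵐ[volume] fun v : ℂ => f (-v) :=
  Lp.coeFn_compMeasurePreserving f (Measure.measurePreserving_neg (volume : Measure ℂ))

/-- The projection to even functions. -/
noncomputable def evenProj (f : L2C) : L2C := (1 / 2 : ℂ) • (f + reflection f)

theorem continuous_evenProj : Continuous evenProj :=
  (continuous_id.add reflection.continuous).const_smul (1 / 2 : ℂ)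

theorem norm_evenProj_le (f : L2C) : ‖evenProj f‖ ≤ ‖f‖ := by
  rw [evenProj, norm_smul]
  have h := norm_add_le f (reflection f)
  rw [reflection.norm_map] at h
  have : ‖(1 / 2 : ℂ)‖ = 1 / 2 := by norm_num
  rw [this]
  linarith

theorem evenProj_sub (f g : L2C) : evenProj (f - g) = evenProj f - evenProj g := by
  simp only [evenProj, map_sub, smul_sub, smul_add]
  abel

theorem evenProj_of_even {h : L2C} (hh : reflection h = h) : evenProj h = h := by
  rw [evenProj, hh, ← two_smul ℂ h, smul_smul]
  norm_num

theorem evenPart_mem_meanZero (hf : f ∈ meanZero) : evenPart f ∈ meanZero :=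
  ⟨continuous_evenPart hf.1, hasCompactSupport_evenPart hf.2.1, by
    rw [integral_evenPart (hf.1.integrable_of_hasCompactSupport hf.2.1), hf.2.2]⟩

theorem evenProj_toLp (hf : f ∈ meanZero) :
    evenProj ((memLp_of_mem_meanZero hf).toLp f) =
      (memLp_of_mem_meanZero (evenPart_mem_meanZero hf)).toLp (evenPart f) := by
  set g := (memLp_of_mem_meanZero hf).toLp f with hg
  refine Lp.ext ?_
  have h0 : g =ᵐ[volume] f := (memLp_of_mem_meanZero hf).coeFn_toLp
  filter_upwards [(memLp_of_mem_meanZero (evenPart_mem_meanZero hf)).coeFn_toLp,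
    Lp.coeFn_smul (1 / 2 : ℂ) (g + reflection g), Lp.coeFn_add g (reflection g),
    coeFn_reflection g, h0,
    (Measure.measurePreserving_neg (volume : Measure ℂ)).quasiMeasurePreserving.ae h0]
    with v h1 h2 h3 h4 h5 h6
  rw [h1, evenProj, h2, Pi.smul_apply, h3, Pi.add_apply, h4, h5, h6, evenPart, smul_eq_mul]
  ring

/-- Primitive vectors come in pairs ±v, so the transform sees only even parts on the dense subspace;
continuity does the rest. In particular odd functions are killed. -/
theorem complexTransform_evenProj (h : L2C) :
    complexTransform (evenProj h) = complexTransform h := by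
  refine denseRange_meanZeroToLp.induction_on (p := fun h : L2C =>
    complexTransform (evenProj h) = complexTransform h) h ?_ ?_
  · exact isClosed_eq (complexTransform.continuous.comp continuous_evenProj)
      complexTransform.continuous
  · rintro ⟨f, hf⟩
    change complexTransform (evenProj ((memLp_of_mem_meanZero hf).toLp f)) =
      complexTransform ((memLp_of_mem_meanZero hf).toLp f)
    rw [evenProj_toLp hf, complexTransform_toLp hf,
      complexTransform_toLp (evenPart_mem_meanZero hf)]
    exact MemLp.toLp_congr _ _ (ae_of_all _ fun x => congrFun (transform_evenPart hf.2.1) x)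

end Operator

end SiegelVeech

namespace SiegelVeech

/-! ### A kernel criterion, and uniqueness of the operator -/

section Kernel

open Filter Topology
open scoped ComplexConjugate

variable {f : ℂ → ℂ}

theorem IsTestFunction.mem_meanZero (hf : IsTestFunction f) : f ∈ meanZero :=
  ⟨hf.continuous, hf.hasCompactSupport, hf.integral_eq_zero⟩

theorem IsTestFunction.norm_sq_complexTransform (hf : IsTestFunction f) :
    ‖complexTransform (hf.memLp.toLp f)‖ ^ 2 = ∫ z, ‖latticeSum f z‖ ^ 2 ∂fdMeasure := by
  have h0 : complexTransform (hf.memLp.toLp f) = (memLp_transform hf.mem_meanZero).toLp _ :=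
    complexTransform_toLp hf.mem_meanZero
  rw [h0, Lp.norm_toLp, eLpNorm_transform hf.mem_meanZero, ← ENNReal.toReal_pow,
    ← ofReal_integral_norm_sq hf.memLp_latticeSum,
    ENNReal.toReal_ofReal (integral_nonneg fun _ => by positivity)]

/-- The projection to even functions is a contraction fixing h, so symmetrizing a mean-zero
approximation does not worsen it. It is then replaced by one of its approximating test functions. -/
theorem exists_testFunction_approx {h : L2C} (hh : reflection h = h) {δ : ℝ} (hδ : 0 < δ) :
    ∃ (f : ℂ → ℂ) (hf : IsTestFunction f), ‖h - hf.memLp.toLp f‖ < δ := by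
  obtain ⟨g, hg, hgd⟩ := exists_meanZero_approx h (half_pos hδ)
  set G := evenPart g with hG
  have hGm : G ∈ meanZero := evenPart_mem_meanZero hg
  have h1 : ‖h - (memLp_of_mem_meanZero hGm).toLp G‖ < δ / 2 := by
    rw [← evenProj_toLp hg]
    conv_lhs => rw [← evenProj_of_even hh, ← evenProj_sub]
    exact (norm_evenProj_le _).trans_lt hgd
  obtain ⟨F, hF, hlim, B, R, hB⟩ := exists_testFunction_seq hGm.1 hGm.2.1 (evenPart_neg g) hGm.2.2
  have hGB : ∀ v, v ≠ 0 → ‖G v‖ ≤ Set.indicator (Metric.closedBall 0 R) (fun _ => B) v :=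
    fun v hv => le_of_tendsto (hlim v hv).norm (Eventually.of_forall fun n => hB n v)
  have hne : ∀ᵐ v : ℂ, v ≠ 0 := Measure.ae_ne volume 0
  have h2 : Tendsto (fun n => ∫ v, ‖G v - F n v‖ ^ 2) atTop (𝓝 0) := by
    have hlim0 : ∫ _ : ℂ, (0 : ℝ) = 0 := integral_zero _ _
    rw [← hlim0]
    refine tendsto_integral_of_dominated_convergence
      (Set.indicator (Metric.closedBall 0 R) fun _ => (B + B) ^ 2)
      (fun n => ((hGm.1.sub (hF n).continuous).norm.pow 2).aestronglyMeasurable)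
      ((integrableOn_const measure_closedBall_lt_top.ne).integrable_indicator
        measurableSet_closedBall) (fun n => ?_) ?_
    · filter_upwards [hne] with v hv
      have a1 := hGB v hv
      have a2 := hB n v
      rw [Real.norm_of_nonneg (by positivity)]
      by_cases hm : v ∈ Metric.closedBall (0 : ℂ) R
      · rw [Set.indicator_of_mem hm] at a1 a2 ⊢
        gcongr
        exact (norm_sub_le _ _).trans (add_le_add a1 a2)
      · rw [Set.indicator_of_notMem hm] at a1 a2 ⊢
        rw [norm_le_zero_iff.mp a1, norm_le_zero_iff.mp a2]
        simp
    · filter_upwards [hne] with v hv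
      have := ((hlim v hv).const_sub (G v)).norm.pow 2
      simpa using this
  obtain ⟨n, hn⟩ := (h2.eventually (gt_mem_nhds (by positivity : 0 < (δ / 2) ^ 2))).exists
  refine ⟨F n, hF n, ?_⟩
  have h3 : ‖(memLp_of_mem_meanZero hGm).toLp G - (hF n).memLp.toLp (F n)‖ < δ / 2 := by
    refine lt_of_pow_lt_pow_left₀ 2 (by positivity) (lt_of_eq_of_lt ?_ hn)
    rw [norm_sq_eq_integral]
    refine integral_congr_ae ?_
    filter_upwards [(memLp_of_mem_meanZero hGm).coeFn_toLp, (hF n).memLp.coeFn_toLp,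
      Lp.coeFn_sub ((memLp_of_mem_meanZero hGm).toLp G) ((hF n).memLp.toLp (F n))] with v a1 a2 a3
    rw [a3, Pi.sub_apply, a1, a2]
  calc ‖h - (hF n).memLp.toLp (F n)‖ = ‖(h - (memLp_of_mem_meanZero hGm).toLp G) +
        ((memLp_of_mem_meanZero hGm).toLp G - (hF n).memLp.toLp (F n))‖ := by congr 1; abel
    _ ≤ _ := norm_add_le _ _
    _ < δ := by linarith

/-- A criterion for an even function to lie in the kernel of the Siegel--Veech transform. -/
theorem complexTransform_eq_zero {h : L2C} (hh : reflection h = h)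
    (hlim : Tendsto (fun ε => inner ℂ h (regularizedOperator ε h)) (𝓝[>] 0)
      (𝓝 (-((‖h‖ ^ 2 : ℝ) : ℂ)))) :
    complexTransform h = 0 := by
  set N := ‖h‖ with hN
  have hN0 : 0 ≤ N := norm_nonneg h
  -- The second moment formula holds for test functions only, and h is merely in L². Since all
  -- regularized operators are isometric, replacing h by f changes ‖·‖² and the form ⟨·, M_ε ·⟩ by
  -- at most (2N + 1)δ each, uniformly in ε; the factor 4 of the formula gives 8(2N + 1)δ.
  have key : ∀ δ > 0, δ ≤ 1 → ∃ f : L2C, ‖h - f‖ ≤ δ ∧ ‖complexTransform f‖ ^ 2 ≤ 8 * (2 * N + 1) * δ := by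
    intro δ hδ hδ1
    obtain ⟨f, hf, hd⟩ := exists_testFunction_approx hh hδ
    set g := hf.memLp.toLp f with hg
    refine ⟨g, hd.le, ?_⟩
    have hgN : ‖g‖ ≤ N + δ := by
      have := norm_sub_norm_le g h
      rw [norm_sub_rev] at this
      linarith
    have h1 := hf.tendsto_second_moment
    rw [← hf.norm_sq_complexTransform, ← hg] at h1
    have h2 : Tendsto (fun ε => 4 * (((N ^ 2 : ℝ) : ℂ) + inner ℂ h (regularizedOperator ε h)))
        (𝓝[>] 0) (𝓝 0) := by
      have := (hlim.const_add (((N ^ 2 : ℝ) : ℂ))).const_mul 4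
      rwa [add_neg_cancel, mul_zero] at this
    have h3 := (h1.sub h2).norm
    rw [sub_zero, Complex.norm_real, Real.norm_of_nonneg (by positivity)] at h3
    refine le_of_tendsto h3 (Eventually.of_forall fun ε => ?_)
    have e1 : |‖g‖ ^ 2 - N ^ 2| ≤ (2 * N + 1) * δ := by
      have a1 : |‖g‖ - N| ≤ δ := by
        have := abs_norm_sub_norm_le g h
        rw [norm_sub_rev] at this
        exact this.trans hd.le
      calc |‖g‖ ^ 2 - N ^ 2| = |‖g‖ - N| * |‖g‖ + N| := by rw [← abs_mul]; congr 1; ring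
        _ ≤ δ * (2 * N + 1) := by
          refine mul_le_mul a1 ?_ (abs_nonneg _) hδ.le
          rw [abs_of_nonneg (by positivity)]
          linarith
        _ = _ := by ring
    have e2 : ‖inner ℂ g (regularizedOperator ε g) - inner ℂ h (regularizedOperator ε h)‖ ≤
        (2 * N + 1) * δ := by
      have a1 : inner ℂ g (regularizedOperator ε g) - inner ℂ h (regularizedOperator ε h) =
          inner ℂ (g - h) (regularizedOperator ε g) + inner ℂ h (regularizedOperator ε (g - h)) := by
        rw [map_sub, inner_sub_left, inner_sub_right]
        ring
      rw [a1]
      have a2 : ‖g - h‖ ≤ δ := by rw [norm_sub_rev]; exact hd.le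
      calc _ ≤ ‖inner ℂ (g - h) (regularizedOperator ε g)‖ +
            ‖inner ℂ h (regularizedOperator ε (g - h))‖ := norm_add_le _ _
        _ ≤ ‖g - h‖ * ‖g‖ + ‖h‖ * ‖g - h‖ := by
          refine add_le_add ((norm_inner_le_norm _ _).trans (le_of_eq ?_))
            ((norm_inner_le_norm _ _).trans (le_of_eq ?_)) <;> rw [norm_regularizedOperator]
        _ ≤ δ * (N + 1) + N * δ := by gcongr; linarith
        _ = _ := by ring
    have e3 : (4 * (((‖g‖ ^ 2 : ℝ) : ℂ) + inner ℂ g (regularizedOperator ε g)) -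
        4 * (((N ^ 2 : ℝ) : ℂ) + inner ℂ h (regularizedOperator ε h))) =
        4 * (((‖g‖ ^ 2 - N ^ 2 : ℝ) : ℂ) +
          (inner ℂ g (regularizedOperator ε g) - inner ℂ h (regularizedOperator ε h))) := by
      push_cast
      ring
    rw [e3, norm_mul]
    have e4 : ‖(4 : ℂ)‖ = 4 := by norm_num
    have e5 := norm_add_le (((‖g‖ ^ 2 - N ^ 2 : ℝ) : ℂ))
      (inner ℂ g (regularizedOperator ε g) - inner ℂ h (regularizedOperator ε h))
    rw [Complex.norm_real, Real.norm_eq_abs] at e5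
    rw [e4]
    linarith
  choose g hg1 hg2 using fun n : ℕ => key (1 / ((n : ℝ) + 1)) (by positivity) (by
    rw [div_le_one (by positivity)]; linarith [(Nat.cast_nonneg n : (0 : ℝ) ≤ n)])
  have hone : Tendsto (fun n : ℕ => 1 / ((n : ℝ) + 1)) atTop (𝓝 0) :=
    tendsto_one_div_add_atTop_nhds_zero_nat
  have t1 : Tendsto g atTop (𝓝 h) := by
    rw [tendsto_iff_norm_sub_tendsto_zero]
    refine squeeze_zero (fun _ => norm_nonneg _) (fun n => ?_) hone
    rw [norm_sub_rev]
    exact hg1 n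
  have t2 : Tendsto (fun n => ‖complexTransform (g n)‖ ^ 2) atTop (𝓝 0) := by
    refine squeeze_zero (fun _ => by positivity) hg2 ?_
    simpa using hone.const_mul (8 * (2 * N + 1))
  have t3 := ((complexTransform.continuous.tendsto h).comp t1).norm.pow 2
  have t4 := tendsto_nhds_unique t3 t2
  simpa using t4

/-- Transport of `L²` functions from the plane to `ℂ`. -/
noncomputable def toComplexLp : L2Plane →ₗᵢ[ℂ] L2C :=
  Lp.compMeasurePreservingₗᵢ ℂ _ planeToComplex.symm.measurePreserving

/-- Transport of `L²` functions from `ℂ` to the plane. -/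
noncomputable def ofComplexLp : L2C →ₗᵢ[ℂ] L2Plane :=
  Lp.compMeasurePreservingₗᵢ ℂ _ planeToComplex.measurePreserving

theorem coeFn_toComplexLp (f : L2Plane) :
    toComplexLp f =ᵐ[volume] fun v : ℂ => f (planeToComplex.symm v) :=
  Lp.coeFn_compMeasurePreserving f planeToComplex.symm.measurePreserving

theorem coeFn_ofComplexLp (f : L2C) :
    ofComplexLp f =ᵐ[volume] fun v : Plane => f (planeToComplex v) :=
  Lp.coeFn_compMeasurePreserving f planeToComplex.measurePreserving

theorem ofComplexLp_toComplexLp (f : L2Plane) : ofComplexLp (toComplexLp f) = f := by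
  refine Lp.ext ?_
  filter_upwards [coeFn_ofComplexLp (toComplexLp f),
    planeToComplex.measurePreserving.quasiMeasurePreserving.ae (coeFn_toComplexLp f)] with v h1 h2
  rw [h1, h2, LinearIsometryEquiv.symm_apply_apply]

/-- The Siegel--Veech transform on `L²(ℝ²)`. -/
noncomputable def siegelVeechTransform : L2Plane →L[ℂ] L2H0 :=
  complexTransform.comp toComplexLp.toContinuousLinearMap

theorem comp_symm_mem_meanZero {f : Plane → ℂ} (hf : Continuous f) (hs : HasCompactSupport f)
    (h0 : ∫ x, f x = 0) : f ∘ planeToComplex.symm ∈ meanZero :=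
  ⟨hf.comp planeToComplex.symm.continuous,
    hs.comp_homeomorph planeToComplex.symm.toHomeomorph,
    (planeToComplex.symm.measurePreserving.integral_comp
      planeToComplex.symm.toHomeomorph.measurableEmbedding f).trans h0⟩

theorem isTransformOperator_siegelVeechTransform : IsTransformOperator siegelVeechTransform := by
  intro f hf hs h0
  have hm := comp_symm_mem_meanZero hf hs h0
  have h1 : siegelVeechTransform ((hf.memLp_of_hasCompactSupport hs (p := 2) (μ := volume)).toLp f) =
      complexTransform ((memLp_of_mem_meanZero hm).toLp _) := rfl
  rw [h1, complexTransform_toLp hm]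
  refine (memLp_transform hm).coeFn_toLp.trans (ae_of_all _ fun x => ?_)
  congr 1
  funext v
  simp

/-- Both operators are continuous and are prescribed on the mean-zero functions, which are dense in
L². -/
theorem eq_siegelVeechTransform {S : L2Plane →L[ℂ] L2H0} (hS : IsTransformOperator S) :
    S = siegelVeechTransform := by
  have h1 : ∀ h : L2C, S (ofComplexLp h) = complexTransform h := by
    intro h
    refine denseRange_meanZeroToLp.induction_on (p := fun h : L2C =>
      S (ofComplexLp h) = complexTransform h) h ?_ ?_
    · exact isClosed_eq (S.continuous.comp ofComplexLp.continuous) complexTransform.continuous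
    · rintro ⟨f, hf⟩
      have hc : Continuous (f ∘ planeToComplex) := hf.1.comp planeToComplex.continuous
      have hcs : HasCompactSupport (f ∘ planeToComplex) :=
        hf.2.1.comp_homeomorph planeToComplex.toHomeomorph
      have h0 : ∫ x, (f ∘ planeToComplex) x = 0 :=
        (planeToComplex.measurePreserving.integral_comp
          planeToComplex.toHomeomorph.measurableEmbedding f).trans hf.2.2
      have h2 := hS _ hc hcs h0
      change S (ofComplexLp ((memLp_of_mem_meanZero hf).toLp f)) =
        complexTransform ((memLp_of_mem_meanZero hf).toLp f)
      rw [complexTransform_toLp hf]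
      exact Lp.ext (h2.trans (memLp_transform hf).coeFn_toLp.symm)
  ext1 f
  change S f = complexTransform (toComplexLp f)
  rw [← h1, ofComplexLp_toComplexLp]

theorem siegelVeechTransform_eq_zero_of_odd {f : L2Plane} (hf : f ∈ oddFunctions) :
    siegelVeechTransform f = 0 := by
  change complexTransform (toComplexLp f) = 0
  rw [← complexTransform_evenProj]
  have h1 : reflection (toComplexLp f) = -toComplexLp f := by
    refine Lp.ext ?_
    filter_upwards [coeFn_reflection (toComplexLp f), Lp.coeFn_neg (toComplexLp f),
      coeFn_toComplexLp f,
      (Measure.measurePreserving_neg (volume : Measure ℂ)).quasiMeasurePreserving.ae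
        (coeFn_toComplexLp f),
      planeToComplex.symm.measurePreserving.quasiMeasurePreserving.ae hf] with v h1 h2 h3 h4 h5
    rw [h1, h2, Pi.neg_apply, h3, h4, map_neg, h5]
  rw [evenProj, h1, add_neg_cancel, smul_zero, map_zero]

end Kernel

end SiegelVeech

namespace SiegelVeech

/-! ### Radial functions and their Mellin profiles -/

section MellinRadial

open Filter Topology
open scoped FourierTransform SchwartzMap

theorem setIntegral_Ioi_inv_smul_log {E : Type*} [NormedAddCommGroup E] [NormedSpace ℝ E]
    (Φ : ℝ → E) : ∫ r in Set.Ioi (0 : ℝ), r⁻¹ • Φ (Real.log r) = ∫ x, Φ x := by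
  have h := integral_image_eq_integral_abs_deriv_smul (s := Set.univ) (f := Real.exp)
    (f' := Real.exp) MeasurableSet.univ (fun x _ => (Real.hasDerivAt_exp x).hasDerivWithinAt)
    Real.exp_injective.injOn (fun r => r⁻¹ • Φ (Real.log r))
  rw [Set.image_univ, Real.range_exp] at h
  rw [h, setIntegral_univ]
  refine integral_congr_ae (Eventually.of_forall fun x => ?_)
  simp [smul_smul, (Real.exp_pos x).ne']

theorem integrableOn_Ioi_inv_smul_log {E : Type*} [NormedAddCommGroup E] [NormedSpace ℝ E]
    (Φ : ℝ → E) : IntegrableOn (fun r : ℝ => r⁻¹ • Φ (Real.log r)) (Set.Ioi 0) ↔ Integrable Φ := by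
  have h := integrableOn_image_iff_integrableOn_abs_deriv_smul (s := Set.univ) (f := Real.exp)
    (f' := Real.exp) MeasurableSet.univ (fun x _ => (Real.hasDerivAt_exp x).hasDerivWithinAt)
    Real.exp_injective.injOn (fun r => r⁻¹ • Φ (Real.log r))
  rw [Set.image_univ, Real.range_exp] at h
  rw [h, integrableOn_univ]
  refine integrable_congr (Eventually.of_forall fun x => ?_)
  simp [smul_smul, (Real.exp_pos x).ne']

/-- Logarithmic polar coordinates. One factor 2π is the length of the circle, the other comes from
rescaling the logarithm to match the Fourier normalization. -/
theorem integral_inv_norm_sq_smul_log (Φ : ℝ → ℂ) :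
    ∫ v : ℂ, (‖v‖ ^ 2)⁻¹ • Φ (Real.log ‖v‖ / (2 * Real.pi)) =
      ((2 * Real.pi) ^ 2 : ℝ) • ∫ y, Φ y := by
  have h := integral_fun_norm_addHaar (volume : Measure ℂ)
    (fun r => (r ^ 2)⁻¹ • Φ (Real.log r / (2 * Real.pi)))
  rw [h, Complex.finrank_real_complex]
  have h2 : ∫ r in Set.Ioi (0 : ℝ), r ^ (2 - 1) • (r ^ 2)⁻¹ • Φ (Real.log r / (2 * Real.pi)) =
      ∫ r in Set.Ioi (0 : ℝ), r⁻¹ • Φ (Real.log r / (2 * Real.pi)) := by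
    refine setIntegral_congr_fun measurableSet_Ioi fun r hr => ?_
    have : r ≠ 0 := (Set.mem_Ioi.mp hr).ne'
    rw [smul_smul]
    congr 1
    rw [show 2 - 1 = 1 from rfl]
    field_simp
  rw [h2, setIntegral_Ioi_inv_smul_log (fun x => Φ (x / (2 * Real.pi))),
    Measure.integral_comp_div, Measure.real, Complex.volume_ball, abs_of_pos (by positivity),
    ← Nat.cast_smul_eq_nsmul ℝ, smul_smul, smul_smul]
  simp only [one_pow, ENNReal.ofReal_one, one_mul, ENNReal.coe_toReal, NNReal.coe_real_pi]
  congr 1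
  push_cast
  ring

theorem integrable_inv_norm_sq_smul_log (Φ : ℝ → ℂ) (hΦ : Integrable Φ) :
    Integrable fun v : ℂ => (‖v‖ ^ 2)⁻¹ • Φ (Real.log ‖v‖ / (2 * Real.pi)) := by
  have h := integrable_fun_norm_addHaar (volume : Measure ℂ)
    (f := fun r => (r ^ 2)⁻¹ • Φ (Real.log r / (2 * Real.pi)))
  rw [h, Complex.finrank_real_complex]
  have h2 := (integrableOn_Ioi_inv_smul_log (fun x => Φ (x / (2 * Real.pi)))).mpr
    (hΦ.comp_div (by positivity))
  refine h2.congr_fun (fun r hr => ?_) measurableSet_Ioi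
  have : r ≠ 0 := (Set.mem_Ioi.mp hr).ne'
  beta_reduce
  rw [smul_smul]
  congr 1
  rw [show 2 - 1 = 1 from rfl]
  field_simp

/-- The superposition `∫ ψ(t) r^{-1 + i t} dt`, `r = ‖v‖`, of homogeneous radial functions. -/
noncomputable def mellinRadial (ψ : ℝ → ℂ) (v : ℂ) : ℂ :=
  ∫ t, ψ t * ((‖v‖ : ℝ) : ℂ) ^ (-1 + t * Complex.I)

theorem ofReal_cpow_neg_one_add {r : ℝ} (hr : 0 < r) (t : ℝ) :
    (r : ℂ) ^ (-1 + t * Complex.I) =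
      ((r⁻¹ : ℝ) : ℂ) * Complex.exp (((Real.log r * t : ℝ) : ℂ) * Complex.I) := by
  have hr' : (r : ℂ) ≠ 0 := by exact_mod_cast hr.ne'
  rw [Complex.cpow_add _ _ hr', Complex.cpow_neg_one, Complex.cpow_def_of_ne_zero hr',
    ← Complex.ofReal_log hr.le]
  push_cast
  ring_nf

/-- On the line Re s = -1 the Mellin superposition is r⁻¹ times an inverse Fourier transform in log
r; this reduces L² membership and Plancherel to the Schwartz case on ℝ. -/
theorem mellinRadial_eq (ψ : 𝓢(ℝ, ℂ)) (v : ℂ) :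
    mellinRadial ψ v = ((‖v‖⁻¹ : ℝ) : ℂ) * (𝓕⁻ ψ) (Real.log ‖v‖ / (2 * Real.pi)) := by
  -- At the origin both sides are 0: zero to a nonzero complex power, and 0⁻¹ = 0.
  rcases eq_or_ne v 0 with rfl | hv
  · have h (t : ℝ) : (-1 + t * Complex.I : ℂ) ≠ 0 := fun h => by simpa using congrArg Complex.re h
    simp [mellinRadial, Complex.zero_cpow (h _)]
  have hv' := norm_pos_iff.mpr hv
  rw [SchwartzMap.fourierInv_coe, Real.fourierInv_eq', mellinRadial, ← integral_const_mul]
  refine integral_congr_ae (Eventually.of_forall fun t => ?_)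
  beta_reduce
  rw [ofReal_cpow_neg_one_add hv', smul_eq_mul]
  have : (2 * Real.pi * inner ℝ t (Real.log ‖v‖ / (2 * Real.pi)) : ℝ) = Real.log ‖v‖ * t := by
    simp only [Real.inner_apply]
    field_simp
  rw [this]
  ring

theorem aestronglyMeasurable_mellinRadial (ψ : 𝓢(ℝ, ℂ)) :
    AEStronglyMeasurable (mellinRadial ψ) := by
  rw [funext (mellinRadial_eq ψ)]
  have h1 : Measurable fun v : ℂ => ((‖v‖⁻¹ : ℝ) : ℂ) := by fun_prop
  have h2 : Measurable fun v : ℂ => Real.log ‖v‖ / (2 * Real.pi) := by fun_prop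
  exact (h1.mul ((𝓕⁻ ψ).continuous.measurable.comp h2)).aestronglyMeasurable

theorem conj_mellinRadial_mul (ψ₁ ψ₂ : 𝓢(ℝ, ℂ)) (v : ℂ) :
    inner ℂ (mellinRadial ψ₁ v) (mellinRadial ψ₂ v) = (‖v‖ ^ 2)⁻¹ •
      inner ℂ ((𝓕⁻ ψ₁) (Real.log ‖v‖ / (2 * Real.pi))) ((𝓕⁻ ψ₂) (Real.log ‖v‖ / (2 * Real.pi))) := by
  rw [mellinRadial_eq, mellinRadial_eq, Complex.real_smul]
  simp only [RCLike.inner_apply, map_mul, Complex.conj_ofReal]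
  push_cast
  ring

theorem memLp_mellinRadial (ψ : 𝓢(ℝ, ℂ)) : MemLp (mellinRadial ψ) 2 := by
  rw [memLp_two_iff_integrable_sq_norm (aestronglyMeasurable_mellinRadial ψ)]
  have h1 : Integrable fun y => inner ℂ ((𝓕⁻ ψ) y) ((𝓕⁻ ψ) y) :=
    ((𝓕⁻ ψ).memLp 2).integrable_mul ((𝓕⁻ ψ).memLp 2).star
  refine (integrable_inv_norm_sq_smul_log _ h1).re.congr (Eventually.of_forall fun v => ?_)
  beta_reduce
  rw [← conj_mellinRadial_mul, inner_self_eq_norm_sq]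

/-- The square-integrable function on the plane given by a Schwartz profile. -/
noncomputable def mellinRadialLp (ψ : 𝓢(ℝ, ℂ)) : L2C := (memLp_mellinRadial ψ).toLp _

theorem coeFn_mellinRadialLp (ψ : 𝓢(ℝ, ℂ)) : mellinRadialLp ψ =ᵐ[volume] mellinRadial ψ :=
  MemLp.coeFn_toLp _

/-- Plancherel formula for radial functions. -/
theorem inner_mellinRadialLp (ψ₁ ψ₂ : 𝓢(ℝ, ℂ)) :
    inner ℂ (mellinRadialLp ψ₁) (mellinRadialLp ψ₂) =
      ((2 * Real.pi) ^ 2 : ℝ) * ∫ t, inner ℂ (ψ₁ t) (ψ₂ t) := by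
  have h1 : inner ℂ (mellinRadialLp ψ₁) (mellinRadialLp ψ₂) =
      ∫ v, inner ℂ (mellinRadial ψ₁ v) (mellinRadial ψ₂ v) := by
    rw [L2.inner_def]
    refine integral_congr_ae ?_
    filter_upwards [coeFn_mellinRadialLp ψ₁, coeFn_mellinRadialLp ψ₂] with v h1 h2
    rw [h1, h2]
  have h2 : ∫ y, inner ℂ ((𝓕⁻ ψ₁) y) ((𝓕⁻ ψ₂) y) = ∫ t, inner ℂ (ψ₁ t) (ψ₂ t) := by
    rw [← SchwartzMap.integral_inner_fourier_fourier (𝓕⁻ ψ₁) (𝓕⁻ ψ₂)]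
    simp
  rw [h1, integral_congr_ae (Eventually.of_forall (conj_mellinRadial_mul ψ₁ ψ₂)), ← h2,
    ← Complex.real_smul]
  exact integral_inv_norm_sq_smul_log (fun y => inner ℂ ((𝓕⁻ ψ₁) y) ((𝓕⁻ ψ₂) y))

theorem reflection_mellinRadialLp (ψ : 𝓢(ℝ, ℂ)) :
    reflection (mellinRadialLp ψ) = mellinRadialLp ψ := by
  refine Lp.ext ?_
  have h := (Measure.measurePreserving_neg (volume : Measure ℂ)).quasiMeasurePreserving.ae_eq_comp
    (coeFn_mellinRadialLp ψ)
  filter_upwards [coeFn_reflection (mellinRadialLp ψ), coeFn_mellinRadialLp ψ, h] with v h1 h2 h3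
  rw [h1, h2]
  refine h3.trans ?_
  simp [mellinRadial]

/-- The functions r^{-1+it} are generalized eigenfunctions of the unitary dilations, with eigenvalue
a^{it}. -/
theorem dilation_mellinRadialLp {a : ℝ} (ha : a ≠ 0) (ha' : 0 < a) {ψ ψ' : 𝓢(ℝ, ℂ)}
    (h : ∀ t, ψ' t = ψ t * (a : ℂ) ^ (t * Complex.I)) :
    dilation ha (mellinRadialLp ψ) = mellinRadialLp ψ' := by
  refine Lp.ext ?_
  have h4 := (quasiMeasurePreserving_smul_complex ha).ae_eq_comp (coeFn_mellinRadialLp ψ)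
  filter_upwards [coeFn_dilation ha (mellinRadialLp ψ), coeFn_mellinRadialLp ψ', h4] with v h1 h2 h3
  rw [h1, h2]
  refine (congrArg ((a : ℂ) * ·) h3).trans ?_
  simp only [Function.comp, mellinRadial]
  rw [← integral_const_mul]
  refine integral_congr_ae (Eventually.of_forall fun t => ?_)
  have ha0 : (a : ℂ) ≠ 0 := by exact_mod_cast ha
  beta_reduce
  rw [h t, norm_smul, Real.norm_of_nonneg ha'.le, Complex.ofReal_mul,
    Complex.mul_cpow_ofReal_nonneg ha'.le (norm_nonneg _), Complex.cpow_add (x := (a : ℂ)) _ _ ha0,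
    Complex.cpow_neg_one]
  field_simp

end MellinRadial

end SiegelVeech

namespace SiegelVeech

/-! ### The Fourier transform of homogeneous radial functions -/

section RadialFourier

open Filter Topology
open scoped FourierTransform SchwartzMap

theorem integrable_schwartz_mul_inv_norm (k : 𝓢(ℂ, ℂ)) :
    Integrable fun v : ℂ => ‖k v‖ * ‖v‖⁻¹ := by
  obtain ⟨C, -, hC⟩ := k.decay 0 0
  simp only [pow_zero, one_mul, norm_iteratedFDeriv_zero] at hC
  have h1 : IntegrableOn (fun v : ℂ => ‖v‖⁻¹) (Metric.ball 0 1) := by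
    have h := integrableOn_fun_norm_addHaar (volume : Measure ℂ) (f := fun r => r⁻¹) (r := 1)
    rw [h, Complex.finrank_real_complex]
    have h2 : IntegrableOn (fun _ : ℝ => (1 : ℝ)) (Set.Ioo 0 1) := by simp
    refine h2.congr_fun (fun r hr => ?_) measurableSet_Ioo
    have := hr.1.ne'
    simp [this]
  have h2 := ((integrable_indicator_iff Metric.isOpen_ball.measurableSet).mpr h1).const_mul C
  have hm : Measurable fun v : ℂ => ‖k v‖ * ‖v‖⁻¹ :=
    k.continuous.norm.measurable.mul measurable_norm.inv
  refine (h2.add k.integrable.norm).mono' hm.aestronglyMeasurable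
    (Eventually.of_forall fun v => ?_)
  have hC0 := (norm_nonneg _).trans (hC v)
  rw [Real.norm_of_nonneg (by positivity), Pi.add_apply]
  by_cases hv : v ∈ Metric.ball (0 : ℂ) 1
  · rw [Set.indicator_of_mem hv]
    have := mul_le_mul_of_nonneg_right (hC v) (inv_nonneg.mpr (norm_nonneg v))
    linarith [norm_nonneg (k v)]
  · rw [Set.indicator_of_notMem hv, mul_zero, zero_add]
    have : 1 ≤ ‖v‖ := by simpa using hv
    exact mul_le_of_le_one_right (norm_nonneg _) (inv_le_one_of_one_le₀ this)

/-- The Fourier transform is moved onto the Gaussian, which in dimension 2 reproduces itself with u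
replaced by u⁻¹ and a factor u⁻¹. -/
theorem integral_fourier_mul_gaussian (k : 𝓢(ℂ, ℂ)) {u : ℝ} (hu : 0 < u) :
    ∫ w, (𝓕 k) w * Complex.exp (-(Real.pi * u * ‖w‖ ^ 2 : ℝ)) =
      (u : ℂ)⁻¹ * ∫ x, k x * Complex.exp (-(Real.pi * u⁻¹ * ‖x‖ ^ 2 : ℝ)) := by
  have hb : 0 < ((Real.pi * u : ℝ) : ℂ).re := by
    rw [Complex.ofReal_re]; positivity
  have hg : Integrable fun w : ℂ => Complex.exp (-((Real.pi * u : ℝ) : ℂ) * (‖w‖ : ℂ) ^ 2) := by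
    simpa using GaussianFourier.integrable_cexp_neg_mul_sq_norm_add hb 0 (0 : ℂ)
  have h := VectorFourier.integral_fourierIntegral_smul_eq_flip (μ := (volume : Measure ℂ))
    (ν := (volume : Measure ℂ)) (L := innerₗ ℂ)
    Real.continuous_fourierChar continuous_inner k.integrable hg
  have h1 : ∫ w, (𝓕 (k : ℂ → ℂ)) w • Complex.exp (-((Real.pi * u : ℝ) : ℂ) * (‖w‖ : ℂ) ^ 2) =
      ∫ x, k x • 𝓕 (fun w : ℂ => Complex.exp (-((Real.pi * u : ℝ) : ℂ) * (‖w‖ : ℂ) ^ 2)) x := by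
    simpa using! h
  have h2 : ∀ x : ℂ, 𝓕 (fun w : ℂ => Complex.exp (-((Real.pi * u : ℝ) : ℂ) * (‖w‖ : ℂ) ^ 2)) x =
      (u : ℂ)⁻¹ * Complex.exp (-(Real.pi * u⁻¹ * ‖x‖ ^ 2 : ℝ)) := by
    intro x
    have hu' : (u : ℂ) ≠ 0 := by exact_mod_cast hu.ne'
    have hpi : (Real.pi : ℂ) ≠ 0 := by exact_mod_cast Real.pi_ne_zero
    rw [fourier_gaussian_innerProductSpace hb, Complex.finrank_real_complex]
    congr 1
    · rw [Nat.cast_ofNat, div_self two_ne_zero, Complex.cpow_one]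
      push_cast
      field_simp
    · congr 1
      push_cast
      field_simp
  rw [← integral_const_mul]
  refine Eq.trans ?_ (h1.trans ?_)
  · refine integral_congr_ae (Eventually.of_forall fun w => ?_)
    beta_reduce
    rw [SchwartzMap.fourier_coe, smul_eq_mul]
    push_cast
    ring_nf
  · refine integral_congr_ae (Eventually.of_forall fun x => ?_)
    beta_reduce
    rw [h2, smul_eq_mul]
    ring

/-- Writes r^{-1-it}, up to its gamma factor, as a superposition of Gaussians, for which the Fourier
transform is explicit. -/
theorem integral_cpow_mul_gaussian {r : ℝ} (hr : 0 < r) (t : ℝ) :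
    ∫ u in Set.Ioi (0 : ℝ), (u : ℂ) ^ ((1 + t * Complex.I) / 2 - 1) *
      Complex.exp (-(Real.pi * u * r ^ 2 : ℝ)) =
      Complex.Gammaℝ (1 + t * Complex.I) * (r : ℂ) ^ (-1 - t * Complex.I) := by
  have ha : 0 < ((1 + t * Complex.I) / 2 : ℂ).re := by simp
  have h := Complex.integral_cpow_mul_exp_neg_mul_Ioi ha
    (show 0 < Real.pi * r ^ 2 by positivity)
  have hr' : (r : ℂ) ≠ 0 := by exact_mod_cast hr.ne'
  have h2 : (1 / ((Real.pi * r ^ 2 : ℝ) : ℂ)) ^ ((1 + t * Complex.I) / 2) =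
      (Real.pi : ℂ) ^ (-(1 + t * Complex.I) / 2) * (r : ℂ) ^ (-1 - t * Complex.I) := by
    have h3 : (1 / ((Real.pi * r ^ 2 : ℝ) : ℂ)) = ((Real.pi⁻¹ : ℝ) : ℂ) * ((r⁻¹ ^ 2 : ℝ) : ℂ) := by
      push_cast
      field_simp
    rw [h3, Complex.mul_cpow_ofReal_nonneg (by positivity) (by positivity)]
    congr 1
    · rw [Complex.ofReal_inv, Complex.inv_cpow _ _ (by
        rw [Complex.arg_ofReal_of_nonneg Real.pi_nonneg]; exact Real.pi_ne_zero.symm),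
        ← Complex.cpow_neg, neg_div]
    · have h4 : Complex.arg ((r : ℝ) : ℂ) ≠ Real.pi := by
        rw [Complex.arg_ofReal_of_nonneg hr.le]; exact Real.pi_ne_zero.symm
      have h5 : ((r⁻¹ ^ 2 : ℝ) : ℂ) = ((r⁻¹ : ℝ) : ℂ) * ((r⁻¹ : ℝ) : ℂ) := by push_cast; ring
      rw [h5, Complex.mul_cpow_ofReal_nonneg (by positivity) (by positivity), Complex.ofReal_inv,
        Complex.inv_cpow _ _ h4, ← Complex.cpow_neg, ← Complex.cpow_add _ _ hr']
      congr 1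
      ring
  rw [h2] at h
  rw [Complex.Gammaℝ_def, mul_assoc, mul_comm (Complex.Gamma _), ← mul_assoc, ← h]
  refine setIntegral_congr_fun measurableSet_Ioi fun u _ => ?_
  push_cast
  ring_nf

theorem norm_ofReal_cpow_of_re_eq {r : ℝ} (hr : 0 ≤ r) {s : ℂ} (hs : s.re = -1) :
    ‖(r : ℂ) ^ s‖ = r⁻¹ := by
  rcases hr.eq_or_lt with rfl | hr
  · rw [Complex.ofReal_zero, Complex.zero_cpow (by rintro rfl; simp at hs)]
    simp
  · rw [Complex.norm_cpow_eq_rpow_re_of_pos hr, hs, Real.rpow_neg_one]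

theorem integrable_schwartz_mul_gaussian (k : 𝓢(ℂ, ℂ)) (t : ℝ) :
    Integrable (fun p : ℂ × ℝ => k p.1 * ((p.2 : ℂ) ^ ((1 + t * Complex.I) / 2 - 1) *
      Complex.exp (-(Real.pi * p.2 * ‖p.1‖ ^ 2 : ℝ))))
      (volume.prod (volume.restrict (Set.Ioi 0))) := by
  have hm : Measurable fun p : ℂ × ℝ => k p.1 * ((p.2 : ℂ) ^ ((1 + t * Complex.I) / 2 - 1) *
      Complex.exp (-(Real.pi * p.2 * ‖p.1‖ ^ 2 : ℝ))) := by
    have := k.continuous.measurable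
    fun_prop
  have hn : ∀ v : ℂ, ∀ u ∈ Set.Ioi (0 : ℝ), ‖k v * ((u : ℂ) ^ ((1 + t * Complex.I) / 2 - 1) *
      Complex.exp (-(Real.pi * u * ‖v‖ ^ 2 : ℝ)))‖ =
      ‖k v‖ * (u ^ ((1 / 2 : ℝ) - 1) * Real.exp (-(Real.pi * ‖v‖ ^ 2 * u))) := by
    intro v u hu
    rw [norm_mul, norm_mul, Complex.norm_cpow_eq_rpow_re_of_pos hu, ← Complex.ofReal_neg,
      Complex.norm_exp_ofReal]
    congr 3
    · simp
    · ring_nf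
  have hv0 : ∀ᵐ v : ℂ, v ≠ 0 := by simp [ae_iff]
  have hI : ∀ v : ℂ, v ≠ 0 → ∫ u in Set.Ioi (0 : ℝ), u ^ ((1 / 2 : ℝ) - 1) *
      Real.exp (-(Real.pi * ‖v‖ ^ 2 * u)) = ‖v‖⁻¹ := by
    intro v hv
    have hv' := norm_pos_iff.mpr hv
    rw [Real.integral_rpow_mul_exp_neg_mul_Ioi (by norm_num) (by positivity),
      Real.Gamma_one_half_eq, ← Real.sqrt_eq_rpow, ← Real.sqrt_mul (by positivity)]
    have : 1 / (Real.pi * ‖v‖ ^ 2) * Real.pi = (‖v‖⁻¹) ^ 2 := by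
      field_simp
    rw [this, Real.sqrt_sq (by positivity)]
  rw [integrable_prod_iff hm.aestronglyMeasurable]
  constructor
  · filter_upwards [hv0] with v hv
    have hv' := norm_pos_iff.mpr hv
    have h1 : IntegrableOn (fun u : ℝ => u ^ ((1 / 2 : ℝ) - 1) *
        Real.exp (-(Real.pi * ‖v‖ ^ 2 * u))) (Set.Ioi 0) :=
      .of_integral_ne_zero (by rw [hI v hv]; positivity)
    refine (h1.const_mul ‖k v‖).mono' (hm.comp measurable_prodMk_left).aestronglyMeasurable ?_
    refine (ae_restrict_mem measurableSet_Ioi).mono fun u hu => ?_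
    exact (hn v u hu).le
  · refine (integrable_schwartz_mul_inv_norm k).congr ?_
    filter_upwards [hv0] with v hv
    rw [← hI v hv, ← integral_const_mul]
    exact (setIntegral_congr_fun measurableSet_Ioi (hn v)).symm

/-- The integral of a Schwartz function against `|v|^{-1 - i t}`. -/
noncomputable def rieszPairing (k : 𝓢(ℂ, ℂ)) (t : ℝ) : ℂ :=
  ∫ v, k v * ((‖v‖ : ℝ) : ℂ) ^ (-1 - t * Complex.I)

theorem Gammaℝ_mul_rieszPairing (k : 𝓢(ℂ, ℂ)) (t : ℝ) :
    Complex.Gammaℝ (1 + t * Complex.I) * rieszPairing k t =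
      ∫ u in Set.Ioi (0 : ℝ), (u : ℂ) ^ ((1 + t * Complex.I) / 2 - 1) *
        ∫ v, k v * Complex.exp (-(Real.pi * u * ‖v‖ ^ 2 : ℝ)) := by
  have hv0 : ∀ᵐ v : ℂ, v ≠ 0 := by simp [ae_iff]
  have h := integral_integral_swap (μ := (volume : Measure ℂ))
    (ν := (volume : Measure ℝ).restrict (Set.Ioi 0))
    (f := fun v u => k v * ((u : ℂ) ^ ((1 + t * Complex.I) / 2 - 1) *
      Complex.exp (-(Real.pi * u * ‖v‖ ^ 2 : ℝ)))) (integrable_schwartz_mul_gaussian k t)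
  rw [rieszPairing, ← integral_const_mul]
  refine Eq.trans ?_ (h.trans ?_)
  · refine integral_congr_ae ?_
    filter_upwards [hv0] with v hv
    rw [integral_const_mul, integral_cpow_mul_gaussian (norm_pos_iff.mpr hv)]
    ring
  · refine integral_congr_ae (Eventually.of_forall fun u => ?_)
    beta_reduce
    rw [← integral_const_mul]
    refine integral_congr_ae (Eventually.of_forall fun v => ?_)
    beta_reduce
    ring

/-- Functional equation of the Riesz potentials on the line `Re s = 1`. -/
theorem Gammaℝ_mul_rieszPairing_fourier (k : 𝓢(ℂ, ℂ)) (t : ℝ) :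
    Complex.Gammaℝ (1 + t * Complex.I) * rieszPairing (𝓕 k) t =
      Complex.Gammaℝ (1 - t * Complex.I) * rieszPairing k (-t) := by
  have h1 := Gammaℝ_mul_rieszPairing k (-t)
  -- The substitution u ↦ u⁻¹ matches the Gaussians of the two sides; the Jacobian and the factor
  -- u⁻¹ exchange t and -t in the exponent.
  rw [← integral_comp_rpow_Ioi _ (show (-1 : ℝ) ≠ 0 by norm_num)] at h1
  have h2 : (1 + ((-t : ℝ) : ℂ) * Complex.I) = 1 - t * Complex.I := by push_cast; ring
  rw [h2] at h1
  rw [h1, Gammaℝ_mul_rieszPairing]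
  refine setIntegral_congr_fun measurableSet_Ioi fun u hu => ?_
  have hu : 0 < u := hu
  have hu' : (u : ℂ) ≠ 0 := by exact_mod_cast hu.ne'
  rw [integral_fourier_mul_gaussian k hu, Real.rpow_neg_one, ← mul_assoc, Complex.real_smul,
    ← mul_assoc]
  congr 1
  have h4 : Complex.arg ((u : ℝ) : ℂ) ≠ Real.pi := by
    rw [Complex.arg_ofReal_of_nonneg hu.le]; exact Real.pi_ne_zero.symm
  rw [Complex.ofReal_inv, Complex.inv_cpow _ _ h4, ← Complex.cpow_neg, abs_neg, abs_one, one_mul,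
    Complex.ofReal_cpow hu.le, ← Complex.cpow_neg_one, ← Complex.cpow_add _ _ hu',
    ← Complex.cpow_add _ _ hu']
  congr 1
  push_cast
  ring

end RadialFourier

end SiegelVeech

namespace SiegelVeech

/-! ### The symplectic Fourier transform on profiles -/

section RadialFourierLp

open Filter Topology
open scoped FourierTransform SchwartzMap

theorem Gammaℝ_conj (s : ℂ) :
    Complex.Gammaℝ (starRingEnd ℂ s) = starRingEnd ℂ (Complex.Gammaℝ s) := by
  have h : -(starRingEnd ℂ s) / 2 = starRingEnd ℂ (-s / 2) := by simp [map_div₀, Complex.conj_ofNat]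
  have h' : (starRingEnd ℂ s) / 2 = starRingEnd ℂ (s / 2) := by simp [map_div₀, Complex.conj_ofNat]
  have hpi : Complex.arg (Real.pi : ℂ) ≠ Real.pi := by
    rw [Complex.arg_ofReal_of_nonneg Real.pi_nonneg]; exact Real.pi_ne_zero.symm
  rw [Complex.Gammaℝ_def, Complex.Gammaℝ_def, h, h', Complex.Gamma_conj,
    Complex.cpow_conj _ _ hpi, Complex.conj_ofReal, map_mul]

theorem conj_one_add_mul_I (t : ℝ) :
    starRingEnd ℂ (1 + t * Complex.I) = 1 - t * Complex.I := by
  simp [sub_eq_add_neg]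

theorem Gammaℝ_one_add_mul_I_ne_zero (t : ℝ) : Complex.Gammaℝ (1 + t * Complex.I) ≠ 0 :=
  Complex.Gammaℝ_ne_zero_of_re_pos (by simp)

theorem conj_mellinRadial (ψ : ℝ → ℂ) (v : ℂ) : starRingEnd ℂ (mellinRadial ψ v) =
    ∫ t, starRingEnd ℂ (ψ t) * ((‖v‖ : ℝ) : ℂ) ^ (-1 - t * Complex.I) := by
  rw [mellinRadial, ← integral_conj]
  refine integral_congr_ae (Eventually.of_forall fun t => ?_)
  beta_reduce
  rw [map_mul]
  congr 1
  have hv : Complex.arg ((‖v‖ : ℝ) : ℂ) ≠ Real.pi := by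
    rw [Complex.arg_ofReal_of_nonneg (norm_nonneg v)]; exact Real.pi_ne_zero.symm
  have h : (-1 - t * Complex.I : ℂ) = starRingEnd ℂ (-1 + t * Complex.I) := by
    simp [sub_eq_add_neg]
  rw [h, Complex.cpow_conj _ _ hv, Complex.conj_ofReal]

theorem integral_conj_mellinRadial_mul (ψ : 𝓢(ℝ, ℂ)) (k : 𝓢(ℂ, ℂ)) :
    ∫ v, k v * starRingEnd ℂ (mellinRadial ψ v) =
      ∫ t, starRingEnd ℂ (ψ t) * rieszPairing k t := by
  have hm : Measurable fun p : ℂ × ℝ => k p.1 * (starRingEnd ℂ (ψ p.2) *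
      ((‖p.1‖ : ℝ) : ℂ) ^ (-1 - p.2 * Complex.I)) := by
    have h1 := k.continuous.measurable
    have h2 : Measurable fun t => starRingEnd ℂ (ψ t) :=
      (Complex.continuous_conj.comp ψ.continuous).measurable
    fun_prop
  have hi : Integrable (fun p : ℂ × ℝ => k p.1 * (starRingEnd ℂ (ψ p.2) *
      ((‖p.1‖ : ℝ) : ℂ) ^ (-1 - p.2 * Complex.I))) (volume.prod volume) := by
    have h := (integrable_schwartz_mul_inv_norm k).mul_prod
      (ψ.integrable (μ := (volume : Measure ℝ))).norm
    refine h.mono' hm.aestronglyMeasurable (Eventually.of_forall fun p => ?_)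
    rw [norm_mul, norm_mul, norm_ofReal_cpow_of_re_eq (norm_nonneg _) (by simp), RCLike.norm_conj]
    exact le_of_eq (by ring)
  have h := integral_integral_swap (f := fun (v : ℂ) (t : ℝ) => k v * (starRingEnd ℂ (ψ t) *
      ((‖v‖ : ℝ) : ℂ) ^ (-1 - t * Complex.I))) hi
  refine Eq.trans ?_ (h.trans ?_)
  · refine integral_congr_ae (Eventually.of_forall fun v => ?_)
    beta_reduce
    rw [conj_mellinRadial, integral_const_mul]
  · refine integral_congr_ae (Eventually.of_forall fun t => ?_)
    beta_reduce
    rw [rieszPairing, ← integral_const_mul]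
    refine integral_congr_ae (Eventually.of_forall fun v => ?_)
    beta_reduce
    ring

theorem inner_mellinRadialLp_toLp (ψ : 𝓢(ℝ, ℂ)) (k : 𝓢(ℂ, ℂ)) :
    inner ℂ (mellinRadialLp ψ) (k.toLp 2 volume) =
      ∫ t, starRingEnd ℂ (ψ t) * rieszPairing k t := by
  rw [← integral_conj_mellinRadial_mul, L2.inner_def]
  refine integral_congr_ae ?_
  filter_upwards [coeFn_mellinRadialLp ψ, k.coeFn_toLp 2 volume] with v h1 h2
  rw [h1, h2, RCLike.inner_apply]

theorem inner_mellinRadialLp_symplecticFourier (ψ : 𝓢(ℝ, ℂ)) (k : 𝓢(ℂ, ℂ)) :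
    inner ℂ (mellinRadialLp ψ) (symplecticFourier (k.toLp 2 volume)) =
      ∫ t, starRingEnd ℂ (ψ t) * rieszPairing (𝓕 k) t := by
  rw [← integral_conj_mellinRadial_mul, L2.inner_def]
  have h := measurePreserving_I_mul.integral_comp'
    (f := (Homeomorph.mulLeft₀ Complex.I Complex.I_ne_zero).toMeasurableEquiv)
    (fun v => (𝓕 k) v * starRingEnd ℂ (mellinRadial ψ v))
  refine Eq.trans ?_ h
  refine integral_congr_ae ?_
  filter_upwards [coeFn_mellinRadialLp ψ, coeFn_symplecticFourier k] with v h1 h2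
  rw [h1, h2, RCLike.inner_apply, SchwartzMap.fourier_coe]
  have : mellinRadial ψ v = mellinRadial ψ (Complex.I * v) := by simp [mellinRadial]
  rw [this]
  rfl

/-- The symplectic Fourier transform acts on the profiles of radial functions by the reflection
`t ↦ -t`, up to a factor of modulus one. -/
theorem symplecticFourier_mellinRadialLp {ψ ψ' : 𝓢(ℝ, ℂ)}
    (h : ∀ t : ℝ, ψ' t * Complex.Gammaℝ (1 + t * Complex.I) =
      ψ (-t) * Complex.Gammaℝ (1 - t * Complex.I)) :
    symplecticFourier (mellinRadialLp ψ) = mellinRadialLp ψ' := by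
  have hconj : ∀ t : ℝ, Complex.Gammaℝ (1 - t * Complex.I) =
      starRingEnd ℂ (Complex.Gammaℝ (1 + t * Complex.I)) := fun t => by
    rw [← Gammaℝ_conj, conj_one_add_mul_I]
  -- The radial function need not be Schwartz, so its Fourier transform is identified by duality,
  -- testing against Schwartz functions.
  have h1 : ∀ k : 𝓢(ℂ, ℂ), inner ℂ (mellinRadialLp ψ') (symplecticFourier (k.toLp 2 volume)) =
      inner ℂ (mellinRadialLp ψ) (k.toLp 2 volume) := by
    intro k
    rw [inner_mellinRadialLp_symplecticFourier, inner_mellinRadialLp_toLp,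
      ← integral_neg_eq_self (fun t => starRingEnd ℂ (ψ t) * rieszPairing k t)]
    refine integral_congr_ae (Eventually.of_forall fun t => ?_)
    beta_reduce
    have h2 := congrArg (starRingEnd ℂ) (h t)
    rw [map_mul, map_mul, ← hconj, hconj, Complex.conj_conj] at h2
    have h3 := Gammaℝ_mul_rieszPairing_fourier k t
    refine mul_left_cancel₀ (Gammaℝ_one_add_mul_I_ne_zero t) ?_
    rw [mul_left_comm, h3, ← mul_assoc, ← hconj] at *
    linear_combination rieszPairing k (-t) * h2
  have h2 : ∀ y : L2C, inner ℂ (mellinRadialLp ψ') (symplecticFourier y) =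
      inner ℂ (mellinRadialLp ψ) y := by
    have hd := SchwartzMap.denseRange_toLpCLM (E := ℂ) (F := ℂ) (p := 2)
      (μ := (volume : Measure ℂ)) ENNReal.ofNat_ne_top
    intro y
    refine hd.induction_on (p := fun y => inner ℂ (mellinRadialLp ψ') (symplecticFourier y) =
      inner ℂ (mellinRadialLp ψ) y) y ?_ ?_
    · exact isClosed_eq (continuous_const.inner symplecticFourier.continuous)
        (continuous_const.inner continuous_id)
    · intro k
      simp only [SchwartzMap.toLpCLM_apply]
      exact h1 k
  have hnorm : inner ℂ (mellinRadialLp ψ') (mellinRadialLp ψ') =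
      inner ℂ (mellinRadialLp ψ) (mellinRadialLp ψ) := by
    rw [inner_mellinRadialLp, inner_mellinRadialLp,
      ← integral_neg_eq_self (fun t => inner ℂ (ψ t) (ψ t))]
    congr 1
    refine integral_congr_ae (Eventually.of_forall fun t => ?_)
    have h3 : ‖ψ' t‖ = ‖ψ (-t)‖ := by
      have h4 := congrArg norm (h t)
      rw [norm_mul, norm_mul, hconj, RCLike.norm_conj] at h4
      exact mul_right_cancel₀ (norm_ne_zero_iff.mpr (Gammaℝ_one_add_mul_I_ne_zero t)) h4
    beta_reduce
    rw [inner_self_eq_norm_sq_to_K, inner_self_eq_norm_sq_to_K, h3]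
  -- With x, y the functions of profiles ψ, ψ' and F isometric, ‖Fx - y‖² expands into terms that
  -- all equal ±‖x‖²: ⟨y, Fx⟩ = ⟨x, x⟩ by duality, and ‖y‖ = ‖x‖ because the two gamma factors are
  -- conjugate.
  rw [← sub_eq_zero, ← inner_self_eq_zero (𝕜 := ℂ), inner_sub_left, inner_sub_right,
    inner_sub_right, h2, hnorm, symplecticFourier.inner_map_map,
    ← inner_conj_symm (symplecticFourier (mellinRadialLp ψ)), h2, inner_conj_symm]
  ring

end RadialFourierLp

end SiegelVeech

namespace SiegelVeech

/-! ### Regularized operators on profiles: a quotient of zeta values -/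

section RegularizedRadial

open Filter Topology
open scoped FourierTransform SchwartzMap

theorem norm_ofReal_cpow_mul_I_le {r : ℝ} (hr : 0 ≤ r) (t : ℝ) :
    ‖(r : ℂ) ^ (t * Complex.I)‖ ≤ 1 := by
  rcases hr.eq_or_lt with rfl | hr
  · rcases eq_or_ne t 0 with rfl | ht
    · simp
    · rw [Complex.ofReal_zero, Complex.zero_cpow (by simpa using ht)]
      simp
  · rw [Complex.norm_cpow_eq_rpow_re_of_pos hr]
    simp

theorem tsum_mul_integral {ρ : ℝ → ℂ} (hρ : Integrable ρ) {c : ℕ → ℂ} (hc : Summable fun n => ‖c n‖)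
    {e : ℕ → ℝ → ℂ} (he : ∀ n, Measurable (e n)) (he' : ∀ n t, ‖e n t‖ ≤ 1) :
    ∑' n, c n * ∫ t, ρ t * e n t = ∫ t, ρ t * ∑' n, c n * e n t := by
  have hi : ∀ n, Integrable fun t => c n * (ρ t * e n t) := fun n =>
    (hρ.mul_bdd (c := 1) (he n).aestronglyMeasurable (Eventually.of_forall (he' n))).const_mul _
  have hs : Summable fun n => ∫ t, ‖c n * (ρ t * e n t)‖ := by
    refine Summable.of_nonneg_of_le (fun n => integral_nonneg fun t => norm_nonneg _) (fun n => ?_)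
      (hc.mul_right (∫ t, ‖ρ t‖))
    rw [← integral_const_mul]
    refine integral_mono (hi n).norm (hρ.norm.const_mul _) fun t => ?_
    beta_reduce
    rw [norm_mul, norm_mul]
    exact mul_le_mul_of_nonneg_left (mul_le_of_le_one_right (norm_nonneg _) (he' n t))
      (norm_nonneg _)
  have h := (hasSum_integral_of_summable_integral_norm hi hs).tsum_eq
  simp only [integral_const_mul] at h
  rw [h]
  refine integral_congr_ae (Eventually.of_forall fun t => ?_)
  beta_reduce
  rw [← tsum_mul_left]
  exact tsum_congr fun n => by ring

theorem summable_norm_rpow {ε : ℝ} (hε : 0 < ε) :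
    Summable fun n : ℕ => ‖(((n : ℝ) ^ (-(1 + ε)) : ℝ) : ℂ)‖ := by
  simp_rw [Complex.norm_real]
  exact (Real.summable_nat_rpow.mpr (by linarith)).norm

theorem summable_norm_moebius_rpow {ε : ℝ} (hε : 0 < ε) :
    Summable fun n : ℕ =>
      ‖(((ArithmeticFunction.moebius n : ℝ) * (n : ℝ) ^ (-(1 + ε)) : ℝ) : ℂ)‖ := by
  refine Summable.of_nonneg_of_le (fun n => norm_nonneg _) (fun n => ?_) (summable_norm_rpow hε)
  rw [Complex.norm_real, Complex.norm_real, norm_mul]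
  refine mul_le_of_le_one_left (norm_nonneg _) ?_
  rw [Real.norm_eq_abs]
  exact_mod_cast ArithmeticFunction.abs_moebius_le_one

theorem ofReal_natCast_rpow_mul_cpow {ε : ℝ} (hε : 0 < ε) (n : ℕ) (t : ℝ) :
    (((n : ℝ) ^ (-(1 + ε)) : ℝ) : ℂ) * ((n : ℝ) : ℂ) ^ (t * Complex.I) =
      1 / (n : ℂ) ^ (1 + ε - t * Complex.I) := by
  rcases eq_or_ne n 0 with rfl | hn
  · have h : (1 + ε - t * Complex.I : ℂ) ≠ 0 := fun h => by
      have := congrArg Complex.re h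
      simp at this
      linarith
    rw [Nat.cast_zero, Real.zero_rpow (by linarith), Nat.cast_zero, Complex.zero_cpow h]
    simp
  · have hn' : (n : ℂ) ≠ 0 := by exact_mod_cast hn
    rw [Complex.ofReal_cpow (by positivity), Complex.ofReal_natCast, ← Complex.cpow_add _ _ hn',
      one_div, ← Complex.cpow_neg]
    congr 1
    push_cast
    ring

theorem tsum_rpow_mul_cpow {ε : ℝ} (hε : 0 < ε) (t : ℝ) :
    ∑' m : ℕ, (((m : ℝ) ^ (-(1 + ε)) : ℝ) : ℂ) * ((m : ℝ) : ℂ) ^ (t * Complex.I) =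
      riemannZeta (1 + ε - t * Complex.I) := by
  rw [zeta_eq_tsum_one_div_nat_cpow (by simpa using hε)]
  exact tsum_congr fun m => ofReal_natCast_rpow_mul_cpow hε m t

theorem tsum_moebius_mul_cpow {ε : ℝ} (hε : 0 < ε) (t : ℝ) :
    ∑' n : ℕ, (((ArithmeticFunction.moebius n : ℝ) * (n : ℝ) ^ (-(1 + ε)) : ℝ) : ℂ) *
      ((n : ℝ) : ℂ) ^ (((-t : ℝ) : ℂ) * Complex.I) = (riemannZeta (1 + ε + t * Complex.I))⁻¹ := by
  have hs : 1 < (1 + ε + t * Complex.I : ℂ).re := by simpa using hε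
  have h := ArithmeticFunction.LSeries_zeta_mul_Lseries_moebius hs
  rw [ArithmeticFunction.LSeries_zeta_eq_riemannZeta hs] at h
  rw [← eq_inv_of_mul_eq_one_right h, LSeries]
  refine tsum_congr fun n => ?_
  rw [Complex.ofReal_mul, mul_assoc, ofReal_natCast_rpow_mul_cpow hε, LSeries.term_def]
  split_ifs with hn
  · simp [hn]
  · push_cast
    rw [mul_one_div]
    congr 2
    ring

theorem continuous_zeta_comp {ε : ℝ} (hε : 0 < ε) :
    Continuous fun t : ℝ => riemannZeta (1 + ε - t * Complex.I) := by
  refine continuous_iff_continuousAt.mpr fun t => ?_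
  have h : DifferentiableAt ℂ riemannZeta (1 + ε - t * Complex.I) := by
    refine differentiableAt_riemannZeta fun h => ?_
    have := congrArg Complex.re h
    simp at this
    linarith
  exact ContinuousAt.comp (f := fun t : ℝ => (1 + ε - t * Complex.I : ℂ)) h.continuousAt
    (by fun_prop)

/-- Since (m/n)^{it} factors, the sum over m gives ζ(1+ε-it) and the Möbius sum over n gives
1/ζ(1+ε+it). Absolute convergence for ε > 0 allows the exchange with the integral. -/
theorem tsum_tsum_eq_integral_zeta {ρ : ℝ → ℂ} (hρ : Continuous ρ) (hs : HasCompactSupport ρ)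
    {ε : ℝ} (hε : 0 < ε) :
    ∑' n : ℕ, (((ArithmeticFunction.moebius n : ℝ) * (n : ℝ) ^ (-(1 + ε)) : ℝ) : ℂ) *
        ∑' m : ℕ, (((m : ℝ) ^ (-(1 + ε)) : ℝ) : ℂ) *
          ∫ t, ρ t * (((m : ℝ) / n : ℝ) : ℂ) ^ (t * Complex.I) =
      ∫ t, ρ t * (riemannZeta (1 + ε - t * Complex.I) / riemannZeta (1 + ε + t * Complex.I)) := by
  have h1 : ∀ n : ℕ, n ≠ 0 → ∑' m : ℕ, (((m : ℝ) ^ (-(1 + ε)) : ℝ) : ℂ) *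
      ∫ t, ρ t * (((m : ℝ) / n : ℝ) : ℂ) ^ (t * Complex.I) =
      ∫ t, ρ t * riemannZeta (1 + ε - t * Complex.I) *
        ((n : ℝ) : ℂ) ^ (((-t : ℝ) : ℂ) * Complex.I) := by
    intro n hn
    rw [tsum_mul_integral (hρ.integrable_of_hasCompactSupport hs) (summable_norm_rpow hε)
      (e := fun m t => (((m : ℝ) / n : ℝ) : ℂ) ^ (t * Complex.I)) (fun m => by fun_prop)
      (fun m t => norm_ofReal_cpow_mul_I_le (by positivity) t)]
    refine integral_congr_ae (Eventually.of_forall fun t => ?_)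
    beta_reduce
    rw [mul_assoc, ← tsum_rpow_mul_cpow hε, ← tsum_mul_right]
    congr 1
    refine tsum_congr fun m => ?_
    rw [mul_assoc, div_eq_mul_inv, Complex.ofReal_mul,
      Complex.mul_cpow_ofReal_nonneg (by positivity) (by positivity), Complex.ofReal_inv,
      Complex.inv_cpow _ _ (by
        rw [Complex.arg_ofReal_of_nonneg (by positivity)]; exact Real.pi_ne_zero.symm),
      ← Complex.cpow_neg]
    push_cast
    ring_nf
  have h2 : ∀ n : ℕ, (((ArithmeticFunction.moebius n : ℝ) * (n : ℝ) ^ (-(1 + ε)) : ℝ) : ℂ) *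
        ∑' m : ℕ, (((m : ℝ) ^ (-(1 + ε)) : ℝ) : ℂ) *
          ∫ t, ρ t * (((m : ℝ) / n : ℝ) : ℂ) ^ (t * Complex.I) =
      (((ArithmeticFunction.moebius n : ℝ) * (n : ℝ) ^ (-(1 + ε)) : ℝ) : ℂ) *
        ∫ t, ρ t * riemannZeta (1 + ε - t * Complex.I) *
        ((n : ℝ) : ℂ) ^ (((-t : ℝ) : ℂ) * Complex.I) := by
    intro n
    rcases eq_or_ne n 0 with rfl | hn
    · simp
    · rw [h1 n hn]
  have hi : Integrable fun t => ρ t * riemannZeta (1 + ε - t * Complex.I) :=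
    (hρ.mul (continuous_zeta_comp hε)).integrable_of_hasCompactSupport hs.mul_right
  rw [tsum_congr h2, tsum_mul_integral hi (summable_norm_moebius_rpow hε)
    (e := fun n t => ((n : ℝ) : ℂ) ^ (((-t : ℝ) : ℂ) * Complex.I)) (fun n => by fun_prop)
    (fun n t => norm_ofReal_cpow_mul_I_le (by positivity) _)]
  refine integral_congr_ae (Eventually.of_forall fun t => ?_)
  beta_reduce
  rw [tsum_moebius_mul_cpow hε, mul_assoc, div_eq_mul_inv]

/-- Numerator and denominator are complex conjugates. This uniform bound dominates the passage ε →
0. -/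
theorem norm_zeta_div_zeta_le (ε t : ℝ) :
    ‖riemannZeta (1 + ε - t * Complex.I) / riemannZeta (1 + ε + t * Complex.I)‖ ≤ 1 := by
  have h : (1 + ε - t * Complex.I : ℂ) = starRingEnd ℂ (1 + ε + t * Complex.I) := by
    simp [sub_eq_add_neg]
  rw [norm_div, h, riemannZeta_conj, RCLike.norm_conj]
  exact div_self_le_one _

/-- Pointwise convergence holds for t ≠ 0: there ζ is continuous at 1 ± it and does not vanish on Re
s = 1. -/
theorem tendsto_integral_zeta_div_zeta {ρ : ℝ → ℂ} (hρ : Continuous ρ) (hs : HasCompactSupport ρ) :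
    Tendsto (fun ε : ℝ => ∫ t, ρ t * (riemannZeta (1 + ε - t * Complex.I) /
      riemannZeta (1 + ε + t * Complex.I))) (𝓝[>] 0)
      (𝓝 (∫ t, ρ t * (riemannZeta (1 - t * Complex.I) / riemannZeta (1 + t * Complex.I)))) := by
  have hc : ∀ (s : ℂ → ℂ) (ε t : ℝ), (s = id ∨ s = Neg.neg) → 0 ≤ ε → (ε ≠ 0 ∨ t ≠ 0) →
      ContinuousAt riemannZeta (1 + ε + s (t * Complex.I)) := by
    intro s ε t hs h0 h
    refine (differentiableAt_riemannZeta fun h1 => ?_).continuousAt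
    have h2 := congrArg Complex.re h1
    have h3 := congrArg Complex.im h1
    rcases hs with rfl | rfl <;> simp at h2 h3 <;> simp_all
  refine tendsto_integral_filter_of_dominated_convergence (fun t => ‖ρ t‖) ?_ ?_
    (hρ.integrable_of_hasCompactSupport hs).norm ?_
  · refine eventually_mem_nhdsWithin.mono fun ε hε => ?_
    have hε : 0 < ε := hε
    have h1 := continuous_zeta_comp hε
    have h2 : Continuous fun t : ℝ => riemannZeta (1 + ε + t * Complex.I) := by
      have := h1.comp continuous_neg
      simpa [Function.comp_def] using this
    exact (hρ.measurable.mul (h1.measurable.div h2.measurable)).aestronglyMeasurable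
  · refine Eventually.of_forall fun ε => Eventually.of_forall fun t => ?_
    rw [norm_mul]
    exact mul_le_of_le_one_right (norm_nonneg _) (norm_zeta_div_zeta_le ε t)
  · have h0 : ∀ᵐ t : ℝ, t ≠ 0 := by simp [ae_iff]
    filter_upwards [h0] with t ht
    have h1 : ContinuousAt riemannZeta (1 - t * Complex.I) := by
      simpa [sub_eq_add_neg] using hc Neg.neg 0 t (Or.inr rfl) le_rfl (Or.inr ht)
    have h2 : ContinuousAt riemannZeta (1 + t * Complex.I) := by
      simpa using hc id 0 t (Or.inl rfl) le_rfl (Or.inr ht)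
    have h3 : riemannZeta (1 + t * Complex.I) ≠ 0 :=
      riemannZeta_ne_zero_of_one_le_re (by simp)
    have h4 : Tendsto (fun ε : ℝ => (1 + ε - t * Complex.I : ℂ)) (𝓝[>] 0)
        (𝓝 (1 - t * Complex.I)) := by
      have : Continuous fun ε : ℝ => (1 + ε - t * Complex.I : ℂ) := by fun_prop
      simpa using (this.tendsto 0).mono_left nhdsWithin_le_nhds
    have h5 : Tendsto (fun ε : ℝ => (1 + ε + t * Complex.I : ℂ)) (𝓝[>] 0)
        (𝓝 (1 + t * Complex.I)) := by
      have : Continuous fun ε : ℝ => (1 + ε + t * Complex.I : ℂ) := by fun_prop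
      simpa using (this.tendsto 0).mono_left nhdsWithin_le_nhds
    exact ((h1.tendsto.comp h4).div (h2.tendsto.comp h5) h3).const_mul _

end RegularizedRadial

end SiegelVeech

namespace SiegelVeech

/-! ### Profiles sent to their negatives -/

section ZetaProfile

open Filter Topology
open scoped FourierTransform SchwartzMap

/-- The factor `H` will involve ζ(1 ± it), which has a pole at t = 0; the cutoff `g` vanishes near
that point. -/
theorem contDiff_mul_of_zero_notMem_tsupport {g H : ℝ → ℂ} (hg : ContDiff ℝ ∞ g)
    (h0 : (0 : ℝ) ∉ tsupport g) (hH : ∀ t ≠ 0, ContDiffAt ℝ ∞ H t) :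
    ContDiff ℝ ∞ fun t => g t * H t := by
  refine contDiff_iff_contDiffAt.mpr fun t => ?_
  rcases eq_or_ne t 0 with rfl | ht
  · have h : (fun t => g t * H t) =ᶠ[𝓝 0] fun _ => 0 := by
      filter_upwards [notMem_tsupport_iff_eventuallyEq.mp h0] with t ht
      simp [ht]
    exact contDiffAt_const.congr_of_eventuallyEq h
  · exact hg.contDiffAt.mul (hH t ht)

theorem exists_schwartz_eq_mul {g H : ℝ → ℂ} (hg : ContDiff ℝ ∞ g) (hs : HasCompactSupport g)
    (h0 : (0 : ℝ) ∉ tsupport g) (hH : ∀ t ≠ 0, ContDiffAt ℝ ∞ H t) :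
    ∃ ψ : 𝓢(ℝ, ℂ), ∀ t, ψ t = g t * H t :=
  ⟨HasCompactSupport.toSchwartzMap (f := fun t => g t * H t) hs.mul_right
    (contDiff_mul_of_zero_notMem_tsupport hg h0 hH), fun _ => rfl⟩

theorem contDiffAt_comp_one_add {F : ℂ → ℂ} {U : Set ℂ} (hU : IsOpen U)
    (hF : DifferentiableOn ℂ F U) {s t : ℝ} (ht : (1 + s * t * Complex.I : ℂ) ∈ U) :
    ContDiffAt ℝ ∞ (fun t : ℝ => F (1 + s * t * Complex.I)) t := by
  have h1 : ContDiffAt ℝ ∞ F (1 + s * t * Complex.I) :=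
    ((hF.analyticAt (hU.mem_nhds ht)).contDiffAt (n := ∞)).restrict_scalars ℝ
  have h2 : ContDiffAt ℝ ∞ (fun t : ℝ => (1 + s * t * Complex.I : ℂ)) t := by
    have : ContDiff ℝ ∞ fun t : ℝ => (t : ℂ) := Complex.ofRealCLM.contDiff
    fun_prop
  exact h1.comp t h2

theorem contDiffAt_zeta {s t : ℝ} (hs : s ≠ 0) (ht : t ≠ 0) :
    ContDiffAt ℝ ∞ (fun t : ℝ => riemannZeta (1 + s * t * Complex.I)) t := by
  refine contDiffAt_comp_one_add isOpen_compl_singleton differentiableOn_riemannZeta ?_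
  simp [hs, ht]

theorem contDiffAt_Gammaℝ (s t : ℝ) :
    ContDiffAt ℝ ∞ (fun t : ℝ => Complex.Gammaℝ (1 + s * t * Complex.I)) t := by
  refine contDiffAt_comp_one_add (U := {z : ℂ | 0 < z.re})
    (isOpen_lt continuous_const Complex.continuous_re) ?_ (by simp)
  intro z hz
  -- 1/Γ_ℝ is entire and nonzero on the right half plane, so its inverse is differentiable there.
  have h := (Complex.differentiable_Gammaℝ_inv z).inv
    (inv_ne_zero (Complex.Gammaℝ_ne_zero_of_re_pos hz))
  have h2 : (fun s => (Complex.Gammaℝ s)⁻¹)⁻¹ = Complex.Gammaℝ := by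
    funext s; simp
  rw [h2] at h
  exact h.differentiableWithinAt

theorem contDiff_cpow_mul_I {a : ℝ} (ha : 0 < a) :
    ContDiff ℝ ∞ fun t : ℝ => (a : ℂ) ^ (t * Complex.I) := by
  have ha' : (a : ℂ) ≠ 0 := by exact_mod_cast ha.ne'
  have : ContDiff ℝ ∞ fun t : ℝ => (t : ℂ) := Complex.ofRealCLM.contDiff
  simp_rw [Complex.cpow_def_of_ne_zero ha']
  fun_prop

/-- The function `t ↦ Γ_ℝ(1 - i t) ζ(1 - i t)`. -/
noncomputable def zetaFactor (t : ℝ) : ℂ :=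
  Complex.Gammaℝ (1 - t * Complex.I) * riemannZeta (1 - t * Complex.I)

theorem contDiffAt_zetaFactor {t : ℝ} (ht : t ≠ 0) : ContDiffAt ℝ ∞ zetaFactor t := by
  have h := (contDiffAt_Gammaℝ (-1) t).mul (contDiffAt_zeta (s := -1) (by norm_num) ht)
  refine h.congr_of_eventuallyEq (Eventually.of_forall fun t => ?_)
  simp [zetaFactor, sub_eq_add_neg]

theorem completedRiemannZeta_eq_zetaFactor (t : ℝ) :
    completedRiemannZeta (1 - t * Complex.I) = zetaFactor t := by
  have h : (1 - t * Complex.I : ℂ) ≠ 0 := fun h => by simpa using congrArg Complex.re h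
  have h2 : Complex.Gammaℝ (1 - t * Complex.I) ≠ 0 := Complex.Gammaℝ_ne_zero_of_re_pos (by simp)
  rw [zetaFactor, riemannZeta_def_of_ne_zero h]
  field_simp

theorem zetaFactor_ne_zero (t : ℝ) : zetaFactor t ≠ 0 :=
  mul_ne_zero (Complex.Gammaℝ_ne_zero_of_re_pos (by simp))
    (riemannZeta_ne_zero_of_one_le_re (by simp))

/-- Radial functions with an odd profile times the completed zeta function are mapped to their
negatives by the limit of the regularized operators. -/
theorem tendsto_inner_mellinRadialLp {g : ℝ → ℂ} (hg : ContDiff ℝ ∞ g) (hs : HasCompactSupport g)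
    (h0 : (0 : ℝ) ∉ tsupport g) (hodd : ∀ t, g (-t) = -g t) {ψ : 𝓢(ℝ, ℂ)}
    (hψ : ∀ t, ψ t = g t * zetaFactor t) :
    Tendsto (fun ε => inner ℂ (mellinRadialLp ψ) (regularizedOperator ε (mellinRadialLp ψ)))
      (𝓝[>] 0) (𝓝 (-((‖mellinRadialLp ψ‖ ^ 2 : ℝ) : ℂ))) := by
  -- The profile of F applied to ψ is ψ(-t) Γ_ℝ(1-it)/Γ_ℝ(1+it). For ψ = g · `zetaFactor` with g
  -- odd, Γ_ℝ(1+it) cancels and g · H remains.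
  set H : ℝ → ℂ := fun t =>
    -(Complex.Gammaℝ (1 - t * Complex.I) * riemannZeta (1 + t * Complex.I)) with hHdef
  have hH : ∀ t ≠ 0, ContDiffAt ℝ ∞ H t := by
    intro t ht
    have h := ((contDiffAt_Gammaℝ (-1) t).mul
      (contDiffAt_zeta (s := 1) (by norm_num) ht)).neg
    refine h.congr_of_eventuallyEq (Eventually.of_forall fun t => ?_)
    simp [hHdef, sub_eq_add_neg]
  obtain ⟨ψ', hψ'⟩ := exists_schwartz_eq_mul hg hs h0 hH
  have hF : symplecticFourier (mellinRadialLp ψ) = mellinRadialLp ψ' := by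
    refine symplecticFourier_mellinRadialLp fun t => ?_
    rw [hψ, hψ', hodd, zetaFactor, hHdef]
    push_cast
    ring_nf
  set ρ : ℝ → ℂ := fun t => ψ' t * starRingEnd ℂ (ψ t) with hρdef
  have hρc : Continuous ρ := ψ'.continuous.mul (Complex.continuous_conj.comp ψ.continuous)
  have hρs : HasCompactSupport ρ := by
    have : ρ = fun t => g t * (H t * starRingEnd ℂ (ψ t)) := by
      funext t
      rw [hρdef]
      beta_reduce
      rw [hψ', mul_assoc]
    rw [this]
    exact hs.mul_right
  set c : ℂ := (((2 * Real.pi) ^ 2 : ℝ) : ℂ) with hc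
  have hG : ∀ (a : ℝ) (ha : a ≠ 0), 0 < a →
      inner ℂ (mellinRadialLp ψ) (dilation ha (symplecticFourier (mellinRadialLp ψ))) =
        c * ∫ t, ρ t * (a : ℂ) ^ (t * Complex.I) := by
    intro a ha ha'
    obtain ⟨ψa, hψa⟩ := exists_schwartz_eq_mul hg hs h0
      (H := fun t => H t * (a : ℂ) ^ (t * Complex.I))
      fun t ht => (hH t ht).mul (contDiff_cpow_mul_I ha').contDiffAt
    rw [hF, dilation_mellinRadialLp ha ha' (ψ' := ψa) fun t => by rw [hψa, hψ', mul_assoc],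
      inner_mellinRadialLp]
    congr 1
    refine integral_congr_ae (Eventually.of_forall fun t => ?_)
    beta_reduce
    rw [RCLike.inner_apply, hψa, hρdef]
    beta_reduce
    rw [hψ']
    ring
  have hlim : -((‖mellinRadialLp ψ‖ ^ 2 : ℝ) : ℂ) = c * ∫ t, ρ t *
      (riemannZeta (1 - t * Complex.I) / riemannZeta (1 + t * Complex.I)) := by
    have h := inner_self_eq_norm_sq_to_K (𝕜 := ℂ) (mellinRadialLp ψ)
    rw [inner_mellinRadialLp] at h
    have h' : (((‖mellinRadialLp ψ‖ ^ 2 : ℝ)) : ℂ) = c * ∫ t, inner ℂ (ψ t) (ψ t) := by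
      rw [hc, h]
      push_cast
      rfl
    rw [h', ← mul_neg, ← integral_neg]
    congr 1
    refine integral_congr_ae (Eventually.of_forall fun t => ?_)
    have h3 : riemannZeta (1 + t * Complex.I) ≠ 0 :=
      riemannZeta_ne_zero_of_one_le_re (by simp)
    beta_reduce
    rw [RCLike.inner_apply, hρdef]
    beta_reduce
    -- The limiting multiplier replaces ζ(1+it) by ζ(1-it) in ψ' and so restores ψ, with the sign
    -- coming from the oddness of g.
    have h4 : ψ' t * (riemannZeta (1 - t * Complex.I) / riemannZeta (1 + t * Complex.I)) =
        -ψ t := by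
      rw [hψ', hψ, hHdef, zetaFactor]
      field_simp
    linear_combination -starRingEnd ℂ (ψ t) * h4
  rw [hlim]
  refine ((tendsto_integral_zeta_div_zeta hρc hρs).const_mul c).congr' ?_
  refine eventually_mem_nhdsWithin.mono fun ε hε => ?_
  have hε : 0 < ε := hε
  beta_reduce
  rw [inner_regularizedOperator_eq hε hG, ← tsum_tsum_eq_integral_zeta hρc hρs hε, ← tsum_mul_left]
  refine tsum_congr fun n => ?_
  rw [mul_left_comm, ← tsum_mul_left]
  congr 1
  exact tsum_congr fun m => by ring

theorem complexTransform_mellinRadialLp {g : ℝ → ℂ} (hg : ContDiff ℝ ∞ g)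
    (hs : HasCompactSupport g) (h0 : (0 : ℝ) ∉ tsupport g) (hodd : ∀ t, g (-t) = -g t)
    {ψ : 𝓢(ℝ, ℂ)} (hψ : ∀ t, ψ t = g t * zetaFactor t) :
    complexTransform (mellinRadialLp ψ) = 0 :=
  complexTransform_eq_zero (reflection_mellinRadialLp ψ)
    (tendsto_inner_mellinRadialLp hg hs h0 hodd hψ)

end ZetaProfile

end SiegelVeech

namespace SiegelVeech

/-! ### The functions f_η, and the strict inclusion -/

section RadialKernel

open Filter Topology
open scoped FourierTransform SchwartzMap

variable {η : ℝ → ℂ}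

/-- The odd extension of a function supported on the positive half-line. -/
noncomputable def oddExtension (η : ℝ → ℂ) (t : ℝ) : ℂ := η t - η (-t)

theorem oddExtension_neg (η : ℝ → ℂ) (t : ℝ) : oddExtension η (-t) = -oddExtension η t := by
  simp [oddExtension]

theorem contDiff_oddExtension (hη : ContDiff ℝ ∞ η) : ContDiff ℝ ∞ (oddExtension η) :=
  hη.sub (hη.comp contDiff_neg)

theorem hasCompactSupport_oddExtension (hs : HasCompactSupport η) :
    HasCompactSupport (oddExtension η) :=
  hs.sub (hs.comp_homeomorph (Homeomorph.neg ℝ))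

theorem zero_notMem_tsupport_comp_neg (h0 : (0 : ℝ) ∉ tsupport η) :
    (0 : ℝ) ∉ tsupport fun t => η (-t) := by
  have h2 : Tendsto (fun t : ℝ => -t) (𝓝 0) (𝓝 0) := by simpa using (continuous_neg (G := ℝ)).tendsto 0
  rw [notMem_tsupport_iff_eventuallyEq] at h0 ⊢
  exact h2.eventually h0

theorem zero_notMem_tsupport_oddExtension (h0 : (0 : ℝ) ∉ tsupport η) :
    (0 : ℝ) ∉ tsupport (oddExtension η) := by
  have h1 := notMem_tsupport_iff_eventuallyEq.mp h0
  have h2 := notMem_tsupport_iff_eventuallyEq.mp (zero_notMem_tsupport_comp_neg h0)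
  refine notMem_tsupport_iff_eventuallyEq.mpr ?_
  filter_upwards [h1, h2] with t h1 h2
  simp only [Pi.zero_apply] at h1 h2
  simp [oddExtension, h1, h2]

theorem apply_eq_zero_of_nonpos (hη : tsupport η ⊆ Set.Ioi 0) {t : ℝ} (ht : t ≤ 0) : η t = 0 :=
  image_eq_zero_of_notMem_tsupport fun h => absurd (hη h) (not_lt.mpr ht)

/-- The second term of the integrand is the first one at -t. Folding the integral over (0, ∞) out to
ℝ gives the profile (η(t) - η(-t)) ξ(1-it). -/
theorem exists_radial_profile (hη : ContDiff ℝ ∞ η) (hs : HasCompactSupport η)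
    (hη0 : tsupport η ⊆ Set.Ioi 0) :
    ∃ ψ : 𝓢(ℝ, ℂ), (∀ t, ψ t = oddExtension η t * zetaFactor t) ∧
      radialFunction η = mellinRadial ψ ∘ planeToComplex := by
  have h0 : (0 : ℝ) ∉ tsupport η := fun h => lt_irrefl (0 : ℝ) (hη0 h)
  obtain ⟨ψ, hψ⟩ := exists_schwartz_eq_mul (contDiff_oddExtension hη)
    (hasCompactSupport_oddExtension hs) (zero_notMem_tsupport_oddExtension h0)
    fun t ht => contDiffAt_zetaFactor ht
  obtain ⟨ψ₁, hψ₁⟩ := exists_schwartz_eq_mul hη hs h0 fun t ht => contDiffAt_zetaFactor ht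
  obtain ⟨ψ₂, hψ₂⟩ := exists_schwartz_eq_mul (hη.comp contDiff_neg)
    (hs.comp_homeomorph (Homeomorph.neg ℝ)) (zero_notMem_tsupport_comp_neg h0)
    fun t ht => contDiffAt_zetaFactor ht
  refine ⟨ψ, hψ, funext fun x => ?_⟩
  have hint : ∀ φ : 𝓢(ℝ, ℂ), Integrable fun t : ℝ =>
      φ t * ((‖x‖ : ℝ) : ℂ) ^ (-1 + t * Complex.I) := fun φ =>
    φ.integrable.mul_bdd (c := ‖x‖⁻¹) (Measurable.aestronglyMeasurable (by fun_prop))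
      (Eventually.of_forall fun t => (norm_ofReal_cpow_of_re_eq (norm_nonneg _) (by simp)).le)
  have h1 : mellinRadial ψ (planeToComplex x) =
      (∫ t, ψ₁ t * ((‖x‖ : ℝ) : ℂ) ^ (-1 + t * Complex.I)) -
      ∫ t, ψ₂ t * ((‖x‖ : ℝ) : ℂ) ^ (-1 + t * Complex.I) := by
    rw [← integral_sub (hint ψ₁) (hint ψ₂), mellinRadial, LinearIsometryEquiv.norm_map]
    refine integral_congr_ae (Eventually.of_forall fun t => ?_)
    beta_reduce
    rw [hψ, hψ₁, hψ₂, oddExtension]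
    simp only [Function.comp]
    ring
  have hint2 : Integrable fun t : ℝ =>
      ψ₂ (-t) * ((‖x‖ : ℝ) : ℂ) ^ (-1 + ((-t : ℝ) : ℂ) * Complex.I) := (hint ψ₂).comp_neg
  rw [Function.comp, h1,
    ← integral_neg_eq_self (fun t : ℝ => ψ₂ t * ((‖x‖ : ℝ) : ℂ) ^ (-1 + t * Complex.I)),
    ← integral_sub (hint ψ₁) hint2, radialFunction]
  refine Eq.trans ?_ (setIntegral_eq_integral_of_forall_compl_eq_zero (s := Set.Ioi (0 : ℝ)) ?_)
  · refine setIntegral_congr_fun measurableSet_Ioi fun t _ => ?_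
    have h2 := completedRiemannZeta_eq_zetaFactor (-t)
    rw [hψ₁, hψ₂, completedRiemannZeta_eq_zetaFactor t, ← h2]
    simp only [Function.comp, neg_neg]
    push_cast
    ring_nf
  · intro t ht
    have h2 := apply_eq_zero_of_nonpos hη0 (not_lt.mp ht)
    rw [hψ₁, hψ₂]
    simp [h2]

theorem toComplexLp_toLp {F : ℂ → ℂ} {f : Plane → ℂ} (hf : MemLp f 2) (hF : MemLp F 2)
    (h : f = F ∘ planeToComplex) : toComplexLp (hf.toLp f) = hF.toLp F := by
  refine Lp.ext ?_
  have h2 := planeToComplex.symm.measurePreserving.quasiMeasurePreserving.ae_eq_comp hf.coeFn_toLp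
  filter_upwards [coeFn_toComplexLp (hf.toLp f), h2, hF.coeFn_toLp] with v h1 h2 h3
  rw [h1, h3]
  refine h2.trans ?_
  simp [h]

/-- Plancherel makes the profile vanish almost everywhere, and continuity makes it vanish
everywhere. -/
theorem eq_zero_of_mellinRadialLp_eq_zero {ψ : 𝓢(ℝ, ℂ)} (h : mellinRadialLp ψ = 0) (t : ℝ) :
    ψ t = 0 := by
  have h1 := inner_mellinRadialLp ψ ψ
  rw [h, inner_zero_left] at h1
  have h2 : ∫ t, inner ℂ (ψ t) (ψ t) = ((∫ t, ‖ψ t‖ ^ 2 : ℝ) : ℂ) := by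
    rw [← integral_complex_ofReal]
    refine integral_congr_ae (Eventually.of_forall fun t => ?_)
    beta_reduce
    rw [inner_self_eq_norm_sq_to_K]
    push_cast
    rfl
  rw [h2] at h1
  have h3 : ∫ t, ‖ψ t‖ ^ 2 = 0 := by
    have hpi : (((2 * Real.pi) ^ 2 : ℝ) : ℂ) ≠ 0 := by
      exact_mod_cast (by positivity : (2 * Real.pi) ^ 2 ≠ 0)
    exact_mod_cast (mul_eq_zero.mp h1.symm).resolve_left hpi
  have hc : Continuous fun t => ‖ψ t‖ ^ 2 := ψ.continuous.norm.pow 2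
  have h4 := (integral_eq_zero_iff_of_nonneg (μ := (volume : Measure ℝ)) (f := fun t => ‖ψ t‖ ^ 2)
    (fun t => by positivity)
    ((memLp_two_iff_integrable_sq_norm ψ.continuous.aestronglyMeasurable).mp (ψ.memLp 2))).mp h3
  have h5 := (hc.ae_eq_iff_eq volume continuous_zero).mp h4
  simpa using congrFun h5 t

theorem radialFunction_neg (η : ℝ → ℂ) (x : Plane) :
    radialFunction η (-x) = radialFunction η x := by
  simp [radialFunction]

theorem toLp_eq_zero_of_even_of_odd {f : Plane → ℂ} (hf : MemLp f 2 volume) (he : ∀ x, f (-x) = f x)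
    (h : hf.toLp f ∈ oddFunctions) : hf.toLp f = 0 := by
  have h1 := (Measure.measurePreserving_neg (volume : Measure Plane)).quasiMeasurePreserving.ae_eq_comp
    hf.coeFn_toLp
  refine Lp.ext ?_
  have h : ∀ᵐ x : Plane, hf.toLp f (-x) = -hf.toLp f x := h
  filter_upwards [h, h1, hf.coeFn_toLp, Lp.coeFn_zero ℂ 2 (volume : Measure Plane)] with x h h1 h2 h3
  simp only [Function.comp, he] at h1
  rw [h3, Pi.zero_apply]
  rw [h1, h2] at h
  rw [h2]
  exact self_eq_neg.mp h

theorem exists_memLp_radialFunction (hη : ContDiff ℝ ∞ η) (hs : HasCompactSupport η)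
    (hη0 : tsupport η ⊆ Set.Ioi 0) :
    ∃ h : MemLp (radialFunction η) 2 volume,
      siegelVeechTransform (h.toLp (radialFunction η)) = 0 ∧
      (η ≠ 0 → h.toLp (radialFunction η) ∉ oddFunctions) := by
  have h0 : (0 : ℝ) ∉ tsupport η := fun h => lt_irrefl (0 : ℝ) (hη0 h)
  obtain ⟨ψ, hψ, hψη⟩ := exists_radial_profile hη hs hη0
  have hm : MemLp (radialFunction η) 2 := by
    rw [hψη]
    exact (memLp_mellinRadial ψ).comp_measurePreserving planeToComplex.measurePreserving
  have hL : toComplexLp (hm.toLp (radialFunction η)) = mellinRadialLp ψ :=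
    toComplexLp_toLp hm (memLp_mellinRadial ψ) hψη
  refine ⟨hm, ?_, fun hne hodd => hne ?_⟩
  · change complexTransform (toComplexLp _) = 0
    rw [hL]
    exact complexTransform_mellinRadialLp (contDiff_oddExtension hη)
      (hasCompactSupport_oddExtension hs) (zero_notMem_tsupport_oddExtension h0)
      (oddExtension_neg η) hψ
  · have h1 := toLp_eq_zero_of_even_of_odd hm (radialFunction_neg η) hodd
    rw [h1, map_zero] at hL
    funext t
    rcases le_or_gt t 0 with ht | ht
    · exact apply_eq_zero_of_nonpos hη0 ht
    -- For t > 0 the odd extension is η itself, and the zeta factor is nonzero because ζ has no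
    -- zeros on Re s = 1.
    · have h2 := eq_zero_of_mellinRadialLp_eq_zero hL.symm t
      rw [hψ, oddExtension, apply_eq_zero_of_nonpos hη0 (neg_nonpos.mpr ht.le), sub_zero] at h2
      exact (mul_eq_zero.mp h2).resolve_right (zetaFactor_ne_zero t)

theorem exists_ne_zero_bump : ∃ η : ℝ → ℂ, ContDiff ℝ ∞ η ∧ HasCompactSupport η ∧
    tsupport η ⊆ Set.Ioi 0 ∧ η ≠ 0 := by
  obtain ⟨f, h1, h2, h3, -, h4⟩ := exists_contDiff_tsupport_subset (n := ⊤)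
    (Ioi_mem_nhds (zero_lt_one (α := ℝ)))
  refine ⟨fun t => (f t : ℂ), Complex.ofRealCLM.contDiff.comp h3,
    h2.comp_left (g := fun r : ℝ => (r : ℂ)) Complex.ofReal_zero,
    (tsupport_comp_subset (g := fun r : ℝ => (r : ℂ)) Complex.ofReal_zero f).trans h1, fun h => ?_⟩
  have := congrFun h 1
  simp [h4] at this

theorem oddFunctions_ssubset_ker :
    oddFunctions ⊂ {f : L2Plane | siegelVeechTransform f = 0} := by
  obtain ⟨η, h1, h2, h3, h4⟩ := exists_ne_zero_bump
  obtain ⟨h, h5, h6⟩ := exists_memLp_radialFunction h1 h2 h3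
  exact (Set.ssubset_iff_of_subset fun _ hf => siegelVeechTransform_eq_zero_of_odd hf).mpr
    ⟨_, h5, h6 h4⟩

end RadialKernel

end SiegelVeech

theorem proposition6p8 :
    ∃ S : SiegelVeech.L2Plane →L[ℂ] SiegelVeech.L2H0,
      -- `S` is the Siegel--Veech transform as a bounded operator between the `L²`-spaces
      (SiegelVeech.IsTransformOperator S ∧
        ∀ S' : SiegelVeech.L2Plane →L[ℂ] SiegelVeech.L2H0,
          SiegelVeech.IsTransformOperator S' → S' = S) ∧
      -- its kernel strictly contains the odd functions
      SiegelVeech.oddFunctions ⊂ {f : SiegelVeech.L2Plane | S f = 0} ∧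
      -- the kernel contains the radial functions attached to test functions on `(0, ∞)`
      ∀ η : ℝ → ℂ, ContDiff ℝ ∞ η → HasCompactSupport η → tsupport η ⊆ Set.Ioi 0 →
        ∃ h : MemLp (SiegelVeech.radialFunction η) 2 volume,
          S (h.toLp (SiegelVeech.radialFunction η)) = 0 ∧
          (η ≠ 0 → h.toLp (SiegelVeech.radialFunction η) ∉ SiegelVeech.oddFunctions) := by
  exact ⟨SiegelVeech.siegelVeechTransform,
    ⟨SiegelVeech.isTransformOperator_siegelVeechTransform,
      fun _ hS => SiegelVeech.eq_siegelVeechTransform hS⟩,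
    SiegelVeech.oddFunctions_ssubset_ker,
    fun _ hη hs hη0 => SiegelVeech.exists_memLp_radialFunction hη hs hη0⟩
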